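/- Let $W\ge 2$ be an integer, and let $\mathbb Z(W)$ be the graph with vertex set $\mathbb Z$ in which $u\sim v$ iff $0<|u-v|\le W$. For an integer $q\ge 1$ set \[ \varphi_q(t)=\frac1{A_q}\int_{-\infty}^{\infty}\exp\left[-s^{2q}-(t-s)^{2q}\right]ds, \] with $A_q$ chosen so that $\varphi_q(0)=1$. Let $G=(V,E)$ be a finite connected multigraph (loops and multiple edges allowed) with a marked vertex $v_0\in V$; choose an ordering of its edges, an orientation $e=(u,v)$ of every edge, and a set $T$ of turns, that is, of pairs of distinct half-edges attached to a common vertex (for a closed path $p$ on $G$, $T$ is the set of pairs of half-edges that $p$ uses consecutively). Given ${\bf R}:V\to\mathbb Z$ and ${\bf n}:E\to\{1,2,\dots\}$, start for every edge $e=(u,v)$, independently, an $n_e$-step random walk on $\mathbb Z(W)$ from $R_u$ conditioned not to backtrack, that is, a uniformly distributed tuple $(x_0,\dots,x_{n_e})$ with $x_0=R_u$, $x_j\sim x_{j+1}$ and $x_j\ne x_{j+2}$. Let $\widetilde{\mathbb P}_e\{R_u\overset{n_e}{\rightsquigarrow}R_v\}$ be the probability, given that the walks of all edges $f<e$ have been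 constructed successfully, that the walk of $e$ is successful: it ends at $R_v$ and, for every turn in $T$ between a half-edge of $e$ and a half-edge of some $f\le e$, the points next to the common vertex on the two corresponding ends of the walks are distinct. (If the walks of the edges $f<e$ cannot all be successful, put $\widetilde{\mathbb P}_e=0$.) For $g\in\mathbb C$ with $|g|=1$ and $\epsilon>0$ set \[ \widetilde{\mathrm{Emb}}(G)=\sum_{{\bf R}:V\to\mathbb Z,\ R(v_0)=0}\ \sum_{{\bf n}:E\to\{1,2,\dots\}}\varphi_q\Big(\sum_{e\in E}n_e\epsilon\Big)\prod_{e=(u,v)\in E}g^{n_e}\,\widetilde{\mathbb P}_e\{R_u\overset{n_e}{\rightsquigarrow}R_v\}. \] Then for every $q\ge1$ there is a constant $C(q)>0$, depending only on $q$, such that for all $W\ge 2$, all $G$, $T$ as above, all $\epsilon>0$ and all $g\neq 1$ with $|g|=1$ the double series converges absolutely and: 1. $\displaystyle |\widetilde{\mathrm{Emb}}(G)|\le\left(\frac{C(q)}{|1-g|}\right)^{|E|+1}\left(\frac{\log W}{W}\right)^{|E|-|V|+1}$. 2. If $G$ is the multigraph of the unique diagram of genus $1$ (one vertex and one edge, a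 loop), the same bound holds without the logarithmic factor: $|\widetilde{\mathrm{Emb}}(G)|\le\left(\frac{C(q)}{|1-g|}\right)^{2}\frac1W$. -/

import Mathlib

open MeasureTheory

noncomputable section

/-- The regularising function
`φ_q(t) = A_q⁻¹ ∫ exp(-s^{2q} - (t-s)^{2q}) ds`, where the constant `A_q` is fixed by the
normalisation `φ_q(0) = 1`. -/
def phiReg (q : ℕ) (t : ℝ) : ℝ :=
  (∫ s : ℝ, Real.exp (-s ^ (2 * q) - (t - s) ^ (2 * q))) /
    (∫ s : ℝ, Real.exp (-s ^ (2 * q) - s ^ (2 * q)))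

/-- The graph `ℤ(W)`: the vertices are the integers, and `u ∼ v` iff `0 < |u - v| ≤ W`. -/
def bandGraph (W : ℕ) : SimpleGraph ℤ where
  Adj u v := 0 < |u - v| ∧ |u - v| ≤ W
  symm := ⟨fun u v h => by rwa [abs_sub_comm v u]⟩
  loopless := ⟨fun u h => by simp at h⟩

/-- `γ` is an `n`-step non-backtracking walk in `ℤ(W)` starting from `x`. -/
def IsNBWalk (W n : ℕ) (x : ℤ) (γ : Fin (n + 1) → ℤ) : Prop :=
  γ 0 = x ∧
  (∀ j : Fin n, (bandGraph W).Adj (γ j.castSucc) (γ j.succ)) ∧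
  (∀ (j : ℕ) (hj : j + 2 < n + 1), γ ⟨j, by omega⟩ ≠ γ ⟨j + 2, hj⟩)

/-- A multigraph (loops and multiple edges allowed) with vertex set `V`, edge set `E` and a marked
vertex `root`. Every edge `e = (u, v)` is listed with its two ends `u = src e`, `v = tgt e`. -/
structure MarkedMultigraph (V E : Type*) where
  src : E → V
  tgt : E → V
  root : V

namespace MarkedMultigraph

variable {V E : Type*}

/-- Connectedness of the multigraph (loops and multiplicities play no role in it). -/
def IsConnected (G : MarkedMultigraph V E) : Prop :=
  (SimpleGraph.fromRel fun u v => ∃ e, G.src e = u ∧ G.tgt e = v).Connected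

/-- The two half-edges of `e` are `(e, false)`, attached to `src e`, and `(e, true)`, attached to
`tgt e`. This is the vertex to which a half-edge is attached. -/
def base (G : MarkedMultigraph V E) (h : E × Bool) : V :=
  if h.2 then G.tgt h.1 else G.src h.1

/-- For walks `Γ e` (one for every edge, of length `n e ≥ 1`), the point of the walk next to the
end singled out by the half-edge: the second point of the walk for `(e, false)`, and the
last but one point for `(e, true)`. -/
def nextPoint (n : E → ℕ+) (Γ : (e : E) → Fin ((n e : ℕ) + 1) → ℤ) (h : E × Bool) : ℤ :=
  if h.2 then Γ h.1 ⟨(n h.1 : ℕ) - 1, by omega⟩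
  else Γ h.1 ⟨1, by have := (n h.1).pos; omega⟩

/-- The sample space: one non-backtracking walk in `ℤ(W)` for every edge `e = (u, v)`, with `n e`
steps and started from `R u`. The walks are independent and each is uniform among its
possibilities (the random walk conditioned not to backtrack), i.e. the tuple is uniformly
distributed on this finite set. -/
def walkTuples (G : MarkedMultigraph V E) (W : ℕ) (R : V → ℤ) (n : E → ℕ+) :
    Set ((e : E) → Fin ((n e : ℕ) + 1) → ℤ) :=
  {Γ | ∀ e, IsNBWalk W (n e) (R (G.src e)) (Γ e)}

/-- The walk of the edge `e = (u, v)` arrives at `R v`, and neither its first nor its last step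
violates the non-backtracking conditions created by the edges that precede it (or, if `e` is a
loop, by `e` itself). The conditions are prescribed by a set `T` of turns: `(h, h') ∈ T`, with
`h ≠ h'` two half-edges at the same vertex, says that a path that comes in along one of them and
goes out along the other must not backtrack there. (For a multigraph with a closed path `p`, `T`
is the set of pairs of half-edges which `p` uses consecutively.) -/
def Succeeds [LinearOrder E] (G : MarkedMultigraph V E) (T : Set ((E × Bool) × (E × Bool)))
    (R : V → ℤ) (n : E → ℕ+) (Γ : (e : E) → Fin ((n e : ℕ) + 1) → ℤ) (e : E) : Prop :=
  Γ e (Fin.last (n e : ℕ)) = R (G.tgt e) ∧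
  ∀ h h' : E × Bool, (h, h') ∈ T → h ≠ h' → G.base h = G.base h' →
    h.1 ≤ e → h'.1 ≤ e → (h.1 = e ∨ h'.1 = e) → nextPoint n Γ h ≠ nextPoint n Γ h'

/-- The probability `P̃_e {R_u ⇝ R_v}` (in `n e` steps): the edges are treated one after another in
the given order, and this is the probability that the walk of `e = (u, v)` arrives at `R v` without
violating the conditions created by the preceding edges, given that the walks of the
preceding edges have been constructed successfully. The sample space being uniform, it is a quotient
of cardinalities (and it is `0` if the preceding edges cannot be realised at all). -/
def tildeProb [LinearOrder E] (G : MarkedMultigraph V E) (T : Set ((E × Bool) × (E × Bool)))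
    (W : ℕ) (R : V → ℤ) (n : E → ℕ+) (e : E) : ℝ :=
  ({Γ | Γ ∈ G.walkTuples W R n ∧ ∀ f ≤ e, G.Succeeds T R n Γ f}.ncard : ℝ) /
    ({Γ | Γ ∈ G.walkTuples W R n ∧ ∀ f < e, G.Succeeds T R n Γ f}.ncard : ℝ)

/-- The term of `Ẽmb(G; g, ε)` that belongs to the positions `R` and the lengths `n`. -/
def embTerm [Fintype E] [LinearOrder E] (G : MarkedMultigraph V E)
    (T : Set ((E × Bool) × (E × Bool))) (q W : ℕ) (g : ℂ) (ε : ℝ) (R : V → ℤ) (n : E → ℕ+) : ℂ :=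
  (phiReg q (∑ e, ((n e : ℕ) : ℝ) * ε) : ℂ) *
    ∏ e, (g ^ (n e : ℕ) * (G.tildeProb T W R n e : ℂ))

/-- `Ẽmb(G; g, ε)`: the sum over all `R : V → ℤ` that send the marked vertex to `0`, and over all
lengths `n : E → {1, 2, …}`. -/
def emb [Fintype E] [LinearOrder E] (G : MarkedMultigraph V E)
    (T : Set ((E × Bool) × (E × Bool))) (q W : ℕ) (g : ℂ) (ε : ℝ) : ℂ :=
  ∑' R : {R : V → ℤ // R G.root = 0}, ∑' n : E → ℕ+, G.embTerm T q W g ε R.1 n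

end MarkedMultigraph

end

/-! The conditional probabilities telescope: the product of all `tildeProb` is the probability that
all walks succeed together. Whether the turns are respected depends only on the first and last
steps, so this probability is a sum over vectors of such steps of products, one factor `nbProb` per
edge depending only on the displacement along that edge (`prod_tildeProb`). Once absolute values are
taken, the turn conditions can be dropped.

Write δ = |1 - g|. For fixed positions and steps one has to bound the sum over n of f(|E| + ∑ n_e) ∏
g^{n_e} k_e(n_e), where f(m) = φ_q(mε). The edges are summed one at a time. Below N ≈ 1/δ absolute
values suffice; beyond N two summations by parts use the oscillation of gⁿ. Each of them replaces
k_e by its difference and applies the resolvent R = (1 - g S)⁻¹, S the shift, to f. Two analytic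
facts are needed.

(a) ‖R^j f‖ ≤ C (C/δ)^j for every j, uniformly in ε (`exists_shiftResolvent_phiReg_bound`). Since
exp(-z^{2q}) is entire with good bounds in strips, iterated differences of φ_q decay geometrically
with controlled constants. The identity (1 - g) R^{j+1} f = R^j f + g R^{j+1} Δf exchanges powers of
R for factors 1/δ.

(b) The transition operator Q of the non-backtracking walk satisfies ‖Qⁿ(Q - 1)‖ ≤ K/n and ‖Qⁿ(Q -
1)²‖ ≤ K/n² in the sup norm, uniformly in W (`exists_opLe_nbOp_pow_diff_sq`). Powers of Q are
expressed through polynomials in the simple walk operator P; the ℓ¹ norm of the resulting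
convolution kernels is bounded by weighted ℓ² norms, Parseval and estimates of the symbol of P.

Consequently every edge has a weight whose sum over displacements is O(1/δ), and whose supremum is
O(1/(δW)) because one further step of the walk spreads the mass over about 2W sites
(`exists_edgeWeight_bound`). Summing over positions along a spanning tree uses the first bound on
|V| - 1 edges and the second on the other |E| - |V| + 1 (`IsConnected.tsum_positions_le`). This
gives the bound without a logarithm for every graph; both claims follow, as log W > 1/2. -/

/-! ### Iterated differences of φ_q, by Cauchy estimates in a strip. -/

/-- One forward difference of a function holomorphic in a strip, with exponential weight. -/
lemma norm_fwdDiff_le_of_strip {H : ℂ → ℂ} (hd : Differentiable ℂ H) {M l ρ ε : ℝ} (hM : 0 ≤ M)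
    (hl : 0 < l) (hε : 0 < ε)
    (hH : ∀ z : ℂ, |z.im| ≤ ρ → ‖H z‖ ≤ M * Real.exp (-l * z.re)) (z : ℂ)
    (hz : |z.im| ≤ ρ - 1 / l) :
    ‖fwdDiff (ε : ℂ) H z‖ ≤ M * (Real.exp 1 * ε * l) * Real.exp (-l * z.re) := by
  have hl' : 0 < 1 / l := by positivity
  have hderiv : ∀ w : ℂ, w ∈ {w : ℂ | w.im = z.im ∧ z.re ≤ w.re} →
      ‖deriv H w‖ ≤ M * (Real.exp 1 * l) * Real.exp (-l * z.re) := by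
    rintro w ⟨hw, hw'⟩
    -- On a circle of radius 1/l the weight exp(-l Re z) changes by a factor at most e, so a
    -- derivative costs e·l and a width 1/l of the strip.
    have h1 := Complex.norm_deriv_le_of_forall_mem_sphere_norm_le (c := w) (R := 1 / l)
      (C := M * (Real.exp 1 * Real.exp (-l * z.re))) hl' hd.diffContOnCl ?_
    · refine h1.trans (le_of_eq ?_)
      field_simp
    · intro v hv
      have hv' : ‖v - w‖ = 1 / l := by simpa [dist_eq_norm] using hv
      have him : |v.im - w.im| ≤ 1 / l := by
        rw [← hv', ← Complex.sub_im]; exact Complex.abs_im_le_norm _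
      have hre : |v.re - w.re| ≤ 1 / l := by
        rw [← hv', ← Complex.sub_re]; exact Complex.abs_re_le_norm _
      have : |v.im| ≤ ρ := by
        have := abs_add_le (v.im - w.im) w.im
        rw [sub_add_cancel] at this
        rw [hw] at this him
        linarith
      refine (hH v this).trans ?_
      refine mul_le_mul_of_nonneg_left ?_ hM
      rw [← Real.exp_add, Real.exp_le_exp]
      have h2 := (abs_le.1 hre).1
      have h3 : z.re - 1 / l ≤ v.re := by linarith
      have h4 := mul_le_mul_of_nonneg_left h3 hl.le
      have h5 : l * (z.re - 1 / l) = l * z.re - 1 := by field_simp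
      linarith
  have hconv : Convex ℝ {w : ℂ | w.im = z.im ∧ z.re ≤ w.re} := by
    intro a ha b hb s t hs ht hst
    obtain ⟨ha1, ha2⟩ := ha
    obtain ⟨hb1, hb2⟩ := hb
    refine ⟨?_, ?_⟩
    · simp only [Complex.add_im, Complex.real_smul, Complex.mul_im, Complex.ofReal_re,
        Complex.ofReal_im, zero_mul, add_zero, ha1, hb1]
      rw [← add_mul, hst, one_mul]
    · simp only [Complex.add_re, Complex.real_smul, Complex.mul_re, Complex.ofReal_re,
        Complex.ofReal_im, zero_mul, sub_zero]
      calc z.re = s * z.re + t * z.re := by rw [← add_mul, hst, one_mul]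
        _ ≤ _ := add_le_add (mul_le_mul_of_nonneg_left ha2 hs) (mul_le_mul_of_nonneg_left hb2 ht)
  have h := Convex.norm_image_sub_le_of_norm_deriv_le (x := z) (y := z + ε)
    (fun w _ => hd w) hderiv hconv (by simp) (by simp [hε.le])
  rw [fwdDiff]
  refine h.trans (le_of_eq ?_)
  simp [abs_of_pos hε]
  ring

lemma norm_fwdDiff_iterate_le_of_strip {H : ℂ → ℂ} (hd : Differentiable ℂ H) {M l ρ ε : ℝ}
    (hM : 0 ≤ M) (hl : 0 < l) (hε : 0 < ε)
    (hH : ∀ z : ℂ, |z.im| ≤ ρ → ‖H z‖ ≤ M * Real.exp (-l * z.re)) (k : ℕ) :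
    Differentiable ℂ ((fwdDiff (ε : ℂ))^[k] H) ∧ ∀ z : ℂ, |z.im| ≤ ρ - k / l →
      ‖(fwdDiff (ε : ℂ))^[k] H z‖ ≤ M * (Real.exp 1 * ε * l) ^ k * Real.exp (-l * z.re) := by
  induction k with
  | zero => exact ⟨hd, fun z hz => by simpa using hH z (by simpa using hz)⟩
  | succ k ih =>
    rw [Function.iterate_succ_apply']
    refine ⟨?_, fun z hz => ?_⟩
    · have h1 := ih.1
      unfold fwdDiff at h1 ⊢
      fun_prop
    · have := norm_fwdDiff_le_of_strip ih.1 (ρ := ρ - k / l) (by positivity) hl hε ih.2 z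
        (by push_cast at hz; rw [add_div] at hz; linarith)
      refine this.trans (le_of_eq ?_)
      ring

/-- By homogeneity this is continuity of (1 + iu)^{2q} at u = 0 inside a narrow sector around the
real axis; outside the sector the real part is dominated by the imaginary part. -/
lemma exists_re_pow_lower_bound (q : ℕ) :
    ∃ K : ℝ, 0 ≤ K ∧ ∀ z : ℂ, z.re ^ (2 * q) / 2 - K * z.im ^ (2 * q) ≤ (z ^ (2 * q)).re := by
  have hcont : Filter.Tendsto (fun u : ℝ => ((1 + u * Complex.I) ^ (2 * q) : ℂ).re) (nhds 0)
      (nhds 1) := by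
    have : Continuous (fun u : ℝ => ((1 + u * Complex.I) ^ (2 * q) : ℂ).re) := by fun_prop
    simpa using this.tendsto 0
  obtain ⟨η, hη, hη'⟩ := Metric.eventually_nhds_iff.1
    (hcont.eventually (lt_mem_nhds (show (1 / 2 : ℝ) < 1 by norm_num)))
  have heven : Even (2 * q) := even_two_mul q
  refine ⟨(1 / η ^ 2 + 1) ^ q + (1 / η ^ 2) ^ q, by positivity, fun z => ?_⟩
  have hx : z.re ^ (2 * q) = (z.re ^ 2) ^ q := pow_mul _ _ _
  have hy : z.im ^ (2 * q) = (z.im ^ 2) ^ q := pow_mul _ _ _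
  by_cases h : |z.im| < η * |z.re|
  · have hre : z.re ≠ 0 := by
      intro h0
      rw [h0] at h
      simp at h
      exact absurd h (not_lt.2 (abs_nonneg _))
    have h1 := hη' (y := z.im / z.re) (by
      rw [Real.dist_eq, sub_zero, abs_div, div_lt_iff₀ (abs_pos.2 hre)]; exact h)
    have h2 : z ^ (2 * q) = ((z.re ^ (2 * q) : ℝ) : ℂ) *
        (1 + ((z.im / z.re : ℝ) : ℂ) * Complex.I) ^ (2 * q) := by
      push_cast
      rw [← mul_pow]
      congr 1
      have : (z.re : ℂ) ≠ 0 := by exact_mod_cast hre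
      conv_lhs => rw [← Complex.re_add_im z]
      field_simp
    rw [h2, Complex.re_ofReal_mul]
    have h3 : 0 ≤ z.re ^ (2 * q) := heven.pow_nonneg _
    have h4 : 0 ≤ z.im ^ (2 * q) := heven.pow_nonneg _
    have h5 : 0 ≤ ((1 / η ^ 2 + 1) ^ q + (1 / η ^ 2) ^ q) * z.im ^ (2 * q) := by positivity
    nlinarith [mul_le_mul_of_nonneg_left h1.le h3]
  · push Not at h
    have hsq : z.re ^ 2 ≤ 1 / η ^ 2 * z.im ^ 2 := by
      have h1 : (η * |z.re|) ^ 2 ≤ |z.im| ^ 2 := by gcongr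
      rw [mul_pow, sq_abs, sq_abs] at h1
      rw [one_div, inv_mul_eq_div, le_div_iff₀ (by positivity)]
      linarith
    have h1 : -(z ^ (2 * q)).re ≤ (1 / η ^ 2 + 1) ^ q * z.im ^ (2 * q) := by
      have h2 : |(z ^ (2 * q)).re| ≤ ‖z ^ (2 * q)‖ := Complex.abs_re_le_norm _
      have h3 : ‖z ^ (2 * q)‖ = (z.re ^ 2 + z.im ^ 2) ^ q := by
        rw [norm_pow, pow_mul, ← Complex.normSq_eq_norm_sq, Complex.normSq_apply]
        ring
      have h4 : (z.re ^ 2 + z.im ^ 2) ^ q ≤ ((1 / η ^ 2 + 1) * z.im ^ 2) ^ q := by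
        gcongr
        linarith
      rw [mul_pow] at h4
      rw [hy]
      have := neg_abs_le (z ^ (2 * q)).re
      linarith
    have h2 : z.re ^ (2 * q) ≤ (1 / η ^ 2) ^ q * z.im ^ (2 * q) := by
      rw [hx, hy, ← mul_pow]
      gcongr
    have h3 : 0 ≤ z.re ^ (2 * q) := heven.pow_nonneg _
    linarith

lemma self_le_pow_even_div_two_add_one (q : ℕ) (hq : 1 ≤ q) (u : ℝ) :
    u ≤ u ^ (2 * q) / 2 + 1 := by
  have h1 : u ^ 2 ≤ u ^ (2 * q) + 1 := by
    have hq0 : q ≠ 0 := by omega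
    rw [pow_mul]
    by_cases h : 1 ≤ u ^ 2
    · have := le_self_pow₀ h hq0
      linarith
    · have : 0 ≤ (u ^ 2) ^ q := by positivity
      linarith
  nlinarith [sq_nonneg (u - 1)]

lemma integrable_exp_neg_half_pow (q : ℕ) (hq : 1 ≤ q) :
    Integrable fun s : ℝ => Real.exp (-s ^ (2 * q) / 2) := by
  refine ((integrable_exp_neg_mul_sq (b := 1 / 2) (by norm_num)).const_mul
    (Real.exp (1 / 2))).mono' (by fun_prop) (Filter.Eventually.of_forall fun s => ?_)
  rw [Real.norm_of_nonneg (Real.exp_nonneg _), ← Real.exp_add, Real.exp_le_exp]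
  have hq0 : q ≠ 0 := by omega
  have : s ^ 2 ≤ s ^ (2 * q) + 1 := by
    rw [pow_mul]
    by_cases h : 1 ≤ s ^ 2
    · have := le_self_pow₀ h hq0
      linarith
    · have : 0 ≤ (s ^ 2) ^ q := by positivity
      linarith
  linarith

lemma fwdDiff_iterate_exp_neg_pow_ofReal (q : ℕ) (ε : ℝ) (k : ℕ) (x : ℝ) :
    (((fwdDiff ε)^[k] (fun t : ℝ => Real.exp (-t ^ (2 * q))) x : ℝ) : ℂ) =
      (fwdDiff (ε : ℂ))^[k] (fun z : ℂ => Complex.exp (-z ^ (2 * q))) x := by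
  induction k generalizing x with
  | zero => simp
  | succ k ih =>
    rw [Function.iterate_succ_apply', Function.iterate_succ_apply', fwdDiff, fwdDiff]
    push_cast
    rw [ih, ih]
    push_cast
    rfl

/-- φ_q is a convolution, so all differences can be put on one factor; the other one stays free to
absorb an exponential weight. -/
lemma integrable_and_fwdDiff_iterate_phiReg (q : ℕ) (hq : 1 ≤ q) (ε : ℝ) (k : ℕ) (t : ℝ) :
    Integrable (fun s : ℝ => Real.exp (-s ^ (2 * q)) *
      (fwdDiff ε)^[k] (fun t : ℝ => Real.exp (-t ^ (2 * q))) (t - s)) ∧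
    (fwdDiff ε)^[k] (phiReg q) t = (∫ s : ℝ, Real.exp (-s ^ (2 * q)) *
      (fwdDiff ε)^[k] (fun t : ℝ => Real.exp (-t ^ (2 * q))) (t - s)) /
    (∫ s : ℝ, Real.exp (-s ^ (2 * q) - s ^ (2 * q))) := by
  induction k generalizing t with
  | zero =>
    refine ⟨?_, ?_⟩
    · refine (integrable_exp_neg_half_pow q hq).mono' ?_ (Filter.Eventually.of_forall fun s => ?_)
      · simp only [Function.iterate_zero, id]
        fun_prop
      · simp only [Function.iterate_zero, id]
        rw [← Real.exp_add, Real.norm_of_nonneg (Real.exp_nonneg _), Real.exp_le_exp]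
        have h1 : 0 ≤ s ^ (2 * q) := (even_two_mul q).pow_nonneg _
        have h2 : 0 ≤ (t - s) ^ (2 * q) := (even_two_mul q).pow_nonneg _
        linarith
    · simp only [Function.iterate_zero, id, phiReg, ← Real.exp_add, sub_eq_add_neg]
  | succ k ih =>
    have key : ∀ s : ℝ, Real.exp (-s ^ (2 * q)) *
        (fwdDiff ε)^[k + 1] (fun t : ℝ => Real.exp (-t ^ (2 * q))) (t - s) =
        Real.exp (-s ^ (2 * q)) *
          (fwdDiff ε)^[k] (fun t : ℝ => Real.exp (-t ^ (2 * q))) (t + ε - s) -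
        Real.exp (-s ^ (2 * q)) *
          (fwdDiff ε)^[k] (fun t : ℝ => Real.exp (-t ^ (2 * q))) (t - s) := by
      intro s
      rw [Function.iterate_succ_apply', fwdDiff, ← mul_sub, sub_add_eq_add_sub]
    simp_rw [key]
    refine ⟨(ih (t + ε)).1.sub (ih t).1, ?_⟩
    rw [integral_sub (ih (t + ε)).1 (ih t).1, Function.iterate_succ_apply', fwdDiff,
      (ih (t + ε)).2, (ih t).2, sub_div]

/-- Weighted bounds for the iterated differences of `phiReg`. -/
lemma exists_fwdDiff_phiReg_bound (q : ℕ) (hq : 1 ≤ q) :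
    ∃ C : ℝ, 1 ≤ C ∧ ∀ J : ℕ, 1 ≤ J → ∃ l : ℝ, 0 < l ∧ ∀ ε : ℝ, 0 < ε → ∀ k ≤ J, ∀ t : ℝ,
      |(fwdDiff ε)^[k] (phiReg q) t| ≤ C ^ J * (Real.exp 1 * ε * l) ^ k * Real.exp (-l * t) := by
  obtain ⟨K, hK, hKz⟩ := exists_re_pow_lower_bound q
  set I0 := ∫ s : ℝ, Real.exp (-s ^ (2 * q) / 2) with hI0
  set A := ∫ s : ℝ, Real.exp (-s ^ (2 * q) - s ^ (2 * q)) with hA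
  have hI0' : 0 ≤ I0 := integral_nonneg fun s => Real.exp_nonneg _
  have hA' : 0 ≤ A := integral_nonneg fun s => Real.exp_nonneg _
  have hC1 : 1 ≤ I0 / A + 1 := by have : 0 ≤ I0 / A := by positivity
                                  linarith
  refine ⟨(I0 / A + 1) * Real.exp (K + 2), ?_, fun J hJ => ?_⟩
  · exact one_le_mul_of_one_le_of_one_le hC1 (Real.one_le_exp (by linarith))
  have hJ0 : (0 : ℝ) < J := by exact_mod_cast hJ
  -- The strip has half-width r with r^{2q} = J, so that exp(-z^{2q}) loses only a factor exp(O(J))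
  -- in it. The rate l = J/r is the largest order that Young's inequality allows at a cost exp(J).
  set r : ℝ := (J : ℝ) ^ (1 / ((2 * q : ℕ) : ℝ)) with hr
  have hr0 : 0 < r := by positivity
  have hrJ : r ^ (2 * q) = J := by
    rw [hr, ← Real.rpow_natCast, ← Real.rpow_mul hJ0.le, one_div,
      inv_mul_cancel₀ (by have : (2 * q) ≠ 0 := by omega
                          exact_mod_cast this), Real.rpow_one]
  set l := J / r with hl
  have hl0 : 0 < l := by positivity
  have young : ∀ x : ℝ, l * x ≤ x ^ (2 * q) / 2 + J := by
    intro x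
    have h := mul_le_mul_of_nonneg_left (self_le_pow_even_div_two_add_one q hq (x / r)) hJ0.le
    rw [div_pow, hrJ] at h
    have h2 : (J : ℝ) * (x ^ (2 * q) / J / 2 + 1) = x ^ (2 * q) / 2 + J := by
      field_simp
    have h3 : l * x = J * (x / r) := by rw [hl]; ring
    linarith
  refine ⟨l, hl0, fun ε hε k hk t => ?_⟩
  have hstrip : ∀ z : ℂ, |z.im| ≤ r → ‖Complex.exp (-z ^ (2 * q))‖ ≤
      Real.exp ((K + 1) * J) * Real.exp (-l * z.re) := by
    intro z hz
    rw [Complex.norm_exp, ← Real.exp_add, Real.exp_le_exp, Complex.neg_re]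
    have h1 := hKz z
    have h2 := young z.re
    have h3 : z.im ^ (2 * q) ≤ J := by
      rw [← hrJ, ← (even_two_mul q).pow_abs]
      gcongr
    have h4 := mul_le_mul_of_nonneg_left h3 hK
    linarith
  have hdiff : Differentiable ℂ (fun z : ℂ => Complex.exp (-z ^ (2 * q))) := by fun_prop
  have hreal : ∀ x : ℝ, |(fwdDiff ε)^[k] (fun t : ℝ => Real.exp (-t ^ (2 * q))) x| ≤
      Real.exp ((K + 1) * J) * (Real.exp 1 * ε * l) ^ k * Real.exp (-l * x) := by
    intro x
    -- Each difference uses up a width 1/l, and J/l = r: the strip suffices for exactly J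
    -- differences.
    have := (norm_fwdDiff_iterate_le_of_strip hdiff (Real.exp_nonneg _) hl0 hε hstrip k).2 x
      (by
        simp only [Complex.ofReal_im, abs_zero, sub_nonneg]
        rw [div_le_iff₀ hl0, hl, mul_div_cancel₀ _ hr0.ne']
        exact_mod_cast hk)
    rw [← fwdDiff_iterate_exp_neg_pow_ofReal, Complex.norm_real] at this
    simpa using this
  obtain ⟨hintg, heq⟩ := integrable_and_fwdDiff_iterate_phiReg q hq ε k t
  rw [heq, abs_div, abs_of_nonneg hA']
  have hbound : |∫ s : ℝ, Real.exp (-s ^ (2 * q)) *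
      (fwdDiff ε)^[k] (fun t : ℝ => Real.exp (-t ^ (2 * q))) (t - s)| ≤
      ∫ s : ℝ, (Real.exp ((K + 2) * J) * (Real.exp 1 * ε * l) ^ k * Real.exp (-l * t)) *
        Real.exp (-s ^ (2 * q) / 2) := by
    rw [← Real.norm_eq_abs]
    refine norm_integral_le_of_norm_le ((integrable_exp_neg_half_pow q hq).const_mul _)
      (Filter.Eventually.of_forall fun s => ?_)
    rw [norm_mul, Real.norm_of_nonneg (Real.exp_nonneg _), Real.norm_eq_abs]
    refine (mul_le_mul_of_nonneg_left (hreal (t - s)) (Real.exp_nonneg _)).trans ?_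
    have h1 : Real.exp (-s ^ (2 * q)) * (Real.exp ((K + 1) * J) * (Real.exp 1 * ε * l) ^ k *
        Real.exp (-l * (t - s))) = (Real.exp 1 * ε * l) ^ k *
        Real.exp (-s ^ (2 * q) + (K + 1) * J + -l * (t - s)) := by
      rw [Real.exp_add, Real.exp_add]; ring
    have h2 : Real.exp ((K + 2) * J) * (Real.exp 1 * ε * l) ^ k * Real.exp (-l * t) *
        Real.exp (-s ^ (2 * q) / 2) = (Real.exp 1 * ε * l) ^ k *
        Real.exp ((K + 2) * J + -l * t + -s ^ (2 * q) / 2) := by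
      rw [Real.exp_add, Real.exp_add]; ring
    rw [h1, h2]
    refine mul_le_mul_of_nonneg_left ?_ (by positivity)
    rw [Real.exp_le_exp]
    -- The factor exp(ls) from the shifted weight is absorbed by half of exp(-s^{2q}).
    have := young s
    linarith
  rw [integral_const_mul] at hbound
  have hfin : Real.exp ((K + 2) * J) * (I0 / A) ≤ ((I0 / A + 1) * Real.exp (K + 2)) ^ J := by
    rw [mul_pow, ← Real.exp_nat_mul, mul_comm, mul_comm (J : ℝ)]
    refine mul_le_mul_of_nonneg_right ?_ (Real.exp_nonneg _)
    calc I0 / A ≤ I0 / A + 1 := by linarith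
      _ ≤ _ := le_self_pow₀ hC1 (by omega)
  calc _ ≤ (Real.exp ((K + 2) * J) * (Real.exp 1 * ε * l) ^ k * Real.exp (-l * t)) * I0 / A :=
        div_le_div_of_nonneg_right hbound hA'
    _ = (Real.exp ((K + 2) * J) * (I0 / A)) * (Real.exp 1 * ε * l) ^ k * Real.exp (-l * t) := by
        ring
    _ ≤ _ := by gcongr

/-! ### Abel summation against gⁿ and the resolvent of the shift. -/

noncomputable section

open scoped ENNReal

/-- The correlation `m ↦ ∑ₙ u n * f (m + n)`. -/
def pairing (u f : ℕ → ℂ) (m : ℕ) : ℂ := ∑' n, u n * f (m + n)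

/-- `f` decays at least like `x ^ m`. -/
def ExpDecay (x : ℝ) (f : ℕ → ℂ) : Prop := ∃ M : ℝ, 0 ≤ M ∧ ∀ m, ‖f m‖ ≤ M * x ^ m

/-- `u` is a bounded sequence. -/
def BddSeq (u : ℕ → ℂ) : Prop := ∃ B : ℝ, 0 ≤ B ∧ ∀ n, ‖u n‖ ≤ B

section pairing

variable {x : ℝ} {u v f : ℕ → ℂ}

lemma summable_norm_pairing (hx : 0 ≤ x) (hx1 : x < 1) (hu : BddSeq u) (hf : ExpDecay x f)
    (m : ℕ) : Summable fun n => ‖u n * f (m + n)‖ := by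
  obtain ⟨B, hB, hu⟩ := hu
  obtain ⟨M, hM, hf⟩ := hf
  refine Summable.of_nonneg_of_le (fun n => norm_nonneg _) (fun n => ?_)
    ((summable_geometric_of_lt_one hx hx1).mul_left (B * M * x ^ m))
  rw [norm_mul]
  calc ‖u n‖ * ‖f (m + n)‖ ≤ B * (M * x ^ (m + n)) :=
        mul_le_mul (hu n) (hf _) (norm_nonneg _) hB
    _ = _ := by rw [pow_add]; ring

lemma norm_pairing_le (hx : 0 ≤ x) (hx1 : x < 1) {B M : ℝ} (hB : 0 ≤ B)
    (hu : ∀ n, ‖u n‖ ≤ B) (hf : ∀ m, ‖f m‖ ≤ M * x ^ m) (m : ℕ) :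
    ‖pairing u f m‖ ≤ B * M / (1 - x) * x ^ m := by
  refine tsum_of_norm_bounded (g := fun n => B * M * x ^ m * x ^ n) ?_ (fun n => ?_)
  · rw [show B * M / (1 - x) * x ^ m = B * M * x ^ m * (1 - x)⁻¹ by rw [div_eq_mul_inv]; ring]
    exact (hasSum_geometric_of_lt_one hx hx1).mul_left (B * M * x ^ m)
  · rw [norm_mul]
    calc ‖u n‖ * ‖f (m + n)‖ ≤ B * (M * x ^ (m + n)) :=
          mul_le_mul (hu n) (hf _) (norm_nonneg _) hB
      _ = _ := by rw [pow_add]; ring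

lemma ExpDecay.pairing (hx : 0 ≤ x) (hx1 : x < 1) (hf : ExpDecay x f) (hu : BddSeq u) :
    ExpDecay x (pairing u f) := by
  obtain ⟨B, hB, hu⟩ := hu
  obtain ⟨M, hM, hf⟩ := hf
  have : 0 < 1 - x := by linarith
  exact ⟨B * M / (1 - x), by positivity, norm_pairing_le hx hx1 hB hu hf⟩

lemma pairing_comm (hx : 0 ≤ x) (hx1 : x < 1) (hu : BddSeq u) (hv : BddSeq v)
    (hf : ExpDecay x f) : pairing u (pairing v f) = pairing v (pairing u f) := by
  funext m
  simp only [pairing, ← tsum_mul_left]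
  obtain ⟨B, hB, hu⟩ := hu
  obtain ⟨B', hB', hv⟩ := hv
  obtain ⟨M, hM, hf⟩ := hf
  have hs : Summable (Function.uncurry fun a b => v a * (u b * f (m + a + b))) := by
    have h1 := (summable_geometric_of_lt_one hx hx1)
    have h2 := (h1.mul_of_nonneg h1 (fun n => by positivity) (fun n => by positivity)).mul_left
      (B' * B * M * x ^ m)
    refine Summable.of_norm_bounded h2 ?_
    rintro ⟨a, b⟩
    simp only [Function.uncurry, norm_mul]
    calc ‖v a‖ * (‖u b‖ * ‖f (m + a + b)‖) ≤ B' * (B * (M * x ^ (m + a + b))) := by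
          gcongr
          · exact hv a
          · exact hu b
          · exact hf _
      _ = _ := by rw [pow_add, pow_add]; ring
  rw [← hs.tsum_comm]
  refine tsum_congr fun b => tsum_congr fun a => ?_
  rw [add_right_comm]
  ring

lemma bddSeq_pow {g : ℂ} (hg : ‖g‖ = 1) : BddSeq fun n => g ^ n :=
  ⟨1, zero_le_one, fun n => by simp [hg]⟩

/-- The operator `f ↦ (m ↦ ∑ₙ gⁿ f (m + n))`, the inverse of `1 - g S` for the shift `S`. -/
def shiftResolvent (g : ℂ) : (ℕ → ℂ) → ℕ → ℂ := pairing fun n => g ^ n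

variable {g : ℂ}

lemma ExpDecay.shiftResolvent_iterate (hx : 0 ≤ x) (hx1 : x < 1) (hg : ‖g‖ = 1)
    (hf : ExpDecay x f) (j : ℕ) : ExpDecay x ((shiftResolvent g)^[j] f) := by
  induction j with
  | zero => exact hf
  | succ j ih =>
    rw [Function.iterate_succ_apply']
    exact ih.pairing hx hx1 (bddSeq_pow hg)

lemma shiftResolvent_eq (hx : 0 ≤ x) (hx1 : x < 1) (hg : ‖g‖ = 1) (hf : ExpDecay x f) (m : ℕ) :
    shiftResolvent g f m = f m + g * shiftResolvent g f (m + 1) := by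
  unfold shiftResolvent
  have h := (summable_norm_pairing hx hx1 (bddSeq_pow hg) hf m).of_norm
  rw [pairing, h.tsum_eq_zero_add, pairing, ← tsum_mul_left]
  simp only [pow_zero, add_zero, one_mul, add_right_inj]
  refine tsum_congr fun n => ?_
  rw [pow_succ, show m + (n + 1) = m + 1 + n by ring]
  ring

/-- Both operations are power series in the shift and hence commute. Therefore summing out one edge
does not destroy the resolvent bounds needed for the next. -/
lemma shiftResolvent_iterate_pairing (hx : 0 ≤ x) (hx1 : x < 1) (hg : ‖g‖ = 1) (hu : BddSeq u)
    (hf : ExpDecay x f) (j : ℕ) :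
    (shiftResolvent g)^[j] (pairing u f) = pairing u ((shiftResolvent g)^[j] f) := by
  induction j with
  | zero => rfl
  | succ j ih =>
    rw [Function.iterate_succ_apply', ih, Function.iterate_succ_apply', shiftResolvent,
      pairing_comm hx hx1 (bddSeq_pow hg) hu]
    exact hf.shiftResolvent_iterate hx hx1 hg j

lemma bddSeq_pow_mul (hg : ‖g‖ = 1) {k : ℕ → ℝ} {B : ℝ} (hk : ∀ n, |k n| ≤ B) :
    BddSeq fun n => g ^ n * (k n : ℂ) :=
  ⟨B, (abs_nonneg _).trans (hk 0), fun n => by simp [hg, hk n]⟩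

/-- Summation by parts. -/
lemma pairing_pow_mul (hx : 0 ≤ x) (hx1 : x < 1) (hg : ‖g‖ = 1) (hf : ExpDecay x f)
    {k : ℕ → ℝ} {B : ℝ} (hk : ∀ n, |k n| ≤ B) (m : ℕ) :
    pairing (fun n => g ^ n * (k n : ℂ)) f m = k 0 * shiftResolvent g f m +
      g * pairing (fun n => g ^ n * ((k (n + 1) - k n : ℝ) : ℂ)) (shiftResolvent g f) (m + 1) := by
  have hR : ExpDecay x (shiftResolvent g f) := hf.shiftResolvent_iterate hx hx1 hg 1
  have h1 := (summable_norm_pairing hx hx1 (bddSeq_pow_mul hg hk) hR m).of_norm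
  have h2 := (summable_norm_pairing hx hx1 (bddSeq_pow_mul hg hk) hR (m + 1)).of_norm
  -- Insert f = (1 - gS) R f; shifting the index then moves the difference onto k.
  have e : ∀ n, g ^ n * (k n : ℂ) * f (m + n) = g ^ n * (k n : ℂ) * shiftResolvent g f (m + n) -
      g * (g ^ n * (k n : ℂ) * shiftResolvent g f (m + 1 + n)) := by
    intro n
    rw [shiftResolvent_eq hx hx1 hg hf (m + n), add_right_comm m n 1]
    ring
  have h3 := h1
  rw [← summable_nat_add_iff 1] at h3
  rw [pairing]
  simp_rw [e]
  rw [h1.tsum_sub (h2.mul_left g), h1.tsum_eq_zero_add, tsum_mul_left, pairing, ← sub_eq_zero]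
  have h4 : ∑' n, g ^ n * ((k (n + 1) - k n : ℝ) : ℂ) * shiftResolvent g f (m + 1 + n) * g =
      ∑' n, (g ^ (n + 1) * (k (n + 1) : ℂ) * shiftResolvent g f (m + (n + 1))) -
      ∑' n, g ^ n * (k n : ℂ) * shiftResolvent g f (m + 1 + n) * g := by
    rw [← h3.tsum_sub (h2.mul_right g)]
    refine tsum_congr fun n => ?_
    rw [show m + 1 + n = m + (n + 1) by ring]
    push_cast
    ring
  rw [tsum_mul_right, tsum_mul_right] at h4
  simp only [pow_zero, add_zero, one_mul]
  linear_combination -h4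

/-- The quantity that controls `pairing (gⁿ kₙ)` after splitting at `N` and summing the tail
by parts twice. -/
def abelNorm (N : ℕ) (c : ℝ≥0∞) (k : ℕ → ℝ) : ℝ≥0∞ :=
  ∑ n ∈ Finset.range N, ‖k n‖ₑ + c * ‖k N‖ₑ + c ^ 2 * (‖k (N + 1) - k N‖ₑ +
    ∑' n, ‖k (N + n + 2) - k (N + n + 1) - (k (N + n + 1) - k (N + n))‖ₑ)

lemma enorm_pow_eq_one (hg : ‖g‖ = 1) (n : ℕ) : ‖g ^ n‖ₑ = 1 := by
  rw [enorm_pow, ← ofReal_norm, hg]; simp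

lemma enorm_complex_ofReal (r : ℝ) : ‖(r : ℂ)‖ₑ = ‖r‖ₑ := by
  rw [← ofReal_norm, ← ofReal_norm, Complex.norm_real]

lemma enorm_pairing_le_tsum (hg : ‖g‖ = 1) {k : ℕ → ℝ} {F : ℝ≥0∞} (hF : ∀ m, ‖f m‖ₑ ≤ F)
    (m : ℕ) : ‖pairing (fun n => g ^ n * (k n : ℂ)) f m‖ₑ ≤ (∑' n, ‖k n‖ₑ) * F := by
  refine enorm_tsum_le_tsum_enorm.trans ?_
  rw [← ENNReal.tsum_mul_right]
  refine ENNReal.tsum_le_tsum fun n => ?_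
  rw [enorm_mul, enorm_mul, enorm_pow_eq_one hg, one_mul, enorm_complex_ofReal]
  gcongr
  exact hF _

/-- Two summations by parts are made because the first differences of the walk kernels decay only
like 1/n, which is not summable, while the second decay like 1/n². -/
lemma enorm_pairing_pow_mul_le (hx : 0 ≤ x) (hx1 : x < 1) (hg : ‖g‖ = 1) (hf : ExpDecay x f)
    {k : ℕ → ℝ} {B : ℝ} (hk : ∀ n, |k n| ≤ B) {M c : ℝ≥0∞}
    (hM : ∀ j ≤ 2, ∀ m, ‖(shiftResolvent g)^[j] f m‖ₑ ≤ M * c ^ j) (N m : ℕ) :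
    ‖pairing (fun n => g ^ n * (k n : ℂ)) f m‖ₑ ≤ M * abelNorm N c k := by
  have hg1 : ‖g‖ₑ = 1 := by simpa using enorm_pow_eq_one hg 1
  have hs := (summable_norm_pairing hx hx1 (bddSeq_pow_mul hg hk) hf m).of_norm
  have hkN : ∀ n, |k (N + n)| ≤ B := fun n => hk _
  have hkd : ∀ n, |k (N + (n + 1)) - k (N + n)| ≤ B + B := fun n =>
    (abs_sub _ _).trans (add_le_add (hk _) (hk _))
  have hR : ExpDecay x (shiftResolvent g f) := hf.shiftResolvent_iterate hx hx1 hg 1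
  have e1 : pairing (fun n => g ^ n * (k n : ℂ)) f m =
      ∑ n ∈ Finset.range N, g ^ n * (k n : ℂ) * f (m + n) +
      g ^ N * pairing (fun n => g ^ n * ((k (N + n) : ℝ) : ℂ)) f (m + N) := by
    rw [pairing, ← hs.sum_add_tsum_nat_add N, pairing, ← tsum_mul_left]
    congr 1
    refine tsum_congr fun n => ?_
    rw [pow_add, add_comm n N, add_assoc m N n]
    ring
  have e2 := pairing_pow_mul hx hx1 hg hf hkN (m + N)
  have e3 := pairing_pow_mul hx hx1 hg hR hkd (m + N + 1)
  have h0 : ∀ m, ‖f m‖ₑ ≤ M := fun m => by simpa using hM 0 (by norm_num) m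
  have h1 : ∀ m, ‖shiftResolvent g f m‖ₑ ≤ M * c := fun m => by
    simpa using hM 1 (by norm_num) m
  have h2 : ∀ m, ‖shiftResolvent g (shiftResolvent g f) m‖ₑ ≤ M * c ^ 2 := fun m =>
    hM 2 le_rfl m
  have h4 := enorm_pairing_le_tsum (k := fun n => k (N + (n + 1 + 1)) - k (N + (n + 1)) -
    (k (N + (n + 1)) - k (N + n))) hg h2 (m + N + 1 + 1)
  rw [e1, e2, e3]
  have step : ∀ a b c' d : ℂ, ‖a + g ^ N * (b + g * (c' + g * d))‖ₑ ≤
      ‖a‖ₑ + ‖b‖ₑ + (‖c'‖ₑ + ‖d‖ₑ) := by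
    intro a b c' d
    refine (enorm_add_le _ _).trans ?_
    rw [enorm_mul, enorm_pow_eq_one hg, one_mul, add_assoc]
    gcongr
    refine (enorm_add_le _ _).trans ?_
    gcongr
    rw [enorm_mul, hg1, one_mul]
    refine (enorm_add_le _ _).trans ?_
    rw [enorm_mul, hg1, one_mul]
  refine (step _ _ _ _).trans ?_
  rw [abelNorm, mul_add, mul_add]
  refine add_le_add (add_le_add ?_ ?_) ?_
  · refine (enorm_sum_le _ _).trans ?_
    rw [Finset.mul_sum]
    refine Finset.sum_le_sum fun n _ => ?_
    rw [enorm_mul, enorm_mul, enorm_pow_eq_one hg, one_mul, enorm_complex_ofReal, mul_comm]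
    gcongr
    exact h0 _
  · rw [enorm_mul, enorm_complex_ofReal, ← mul_assoc, mul_comm]
    gcongr
    · exact h1 _
    · simp
  · rw [← mul_assoc, mul_add]
    refine add_le_add ?_ ?_
    · rw [enorm_mul, enorm_complex_ofReal, mul_comm]
      gcongr
      · exact h2 _
      · simp
    · rw [mul_comm (M * c ^ 2)]
      exact h4

/-- All powers of the resolvent are bounded on `f`, with geometric constants. -/
def ResolventBound (g : ℂ) (c M : ℝ≥0∞) (f : ℕ → ℂ) : Prop :=
  ∀ j m, ‖(shiftResolvent g)^[j] f m‖ₑ ≤ M * c ^ j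

/-- The class of functions with geometric resolvent bounds is stable under summing out one edge,
with the same ratio `c`. All powers `j` are required because each further edge consumes two more. -/
lemma ResolventBound.pairing_pow_mul (hx : 0 ≤ x) (hx1 : x < 1) (hg : ‖g‖ = 1)
    (hf : ExpDecay x f) {k : ℕ → ℝ} {B : ℝ} (hk : ∀ n, |k n| ≤ B) {M c : ℝ≥0∞}
    (hM : ResolventBound g c M f) (N : ℕ) :
    ResolventBound g c (M * abelNorm N c k) (pairing (fun n => g ^ n * (k n : ℂ)) f) := by
  intro j m
  rw [shiftResolvent_iterate_pairing hx hx1 hg (bddSeq_pow_mul hg hk) hf]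
  refine (enorm_pairing_pow_mul_le hx hx1 hg (hf.shiftResolvent_iterate hx hx1 hg j) hk
    (M := M * c ^ j) (c := c) (fun i _ m => ?_) N m).trans (le_of_eq (by ring))
  rw [← Function.iterate_add_apply, add_comm i j, mul_assoc, ← pow_add, add_comm j i]
  exact hM _ _

lemma summable_norm_multi (hx : 0 ≤ x) (hx1 : x < 1) {r : ℕ} (u : Fin r → ℕ → ℂ)
    (hu : ∀ i, BddSeq (u i)) (hf : ExpDecay x f) (m : ℕ) :
    Summable fun n : Fin r → ℕ => ‖f (m + ∑ i, n i) * ∏ i, u i (n i)‖ := by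
  induction r generalizing f m with
  | zero => exact Summable.of_finite
  | succ r ih =>
    rw [← (Fin.consEquiv fun _ => ℕ).summable_iff]
    have hg := summable_geometric_of_lt_one hx hx1
    obtain ⟨B, hB, hu0⟩ := hu 0
    obtain ⟨M, hM, hfM⟩ := hf
    have h1 := ih (f := fun n => ((M * x ^ n : ℝ) : ℂ)) (fun i => u i.succ) (fun i => hu _)
      ⟨M, hM, fun n => by simp [abs_of_nonneg hM, abs_of_nonneg hx]⟩ m
    have h2 := (hg.mul_of_nonneg h1 (fun n => by positivity) (fun n => by positivity)).mul_left B
    refine Summable.of_nonneg_of_le (fun n => norm_nonneg _) ?_ h2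
    rintro ⟨a, n⟩
    simp only [Function.comp, Fin.consEquiv_apply, Fin.sum_univ_succ, Fin.prod_univ_succ,
      Fin.cons_zero, Fin.cons_succ, norm_mul, Complex.norm_real]
    rw [Real.norm_of_nonneg hM, Real.norm_of_nonneg (by positivity : 0 ≤ x ^ (m + ∑ i, n i))]
    calc ‖f (m + (a + ∑ i, n i))‖ * (‖u 0 a‖ * ‖∏ i : Fin r, u i.succ (n i)‖)
        ≤ (M * x ^ (m + (a + ∑ i, n i))) * (B * ‖∏ i : Fin r, u i.succ (n i)‖) := by
          gcongr
          · exact hfM _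
          · exact hu0 _
      _ = _ := by
          rw [show m + (a + ∑ i, n i) = a + (m + ∑ i, n i) by ring, pow_add]
          ring

lemma enorm_tsum_multi_le_fin (hx : 0 ≤ x) (hx1 : x < 1) (hg : ‖g‖ = 1) {r : ℕ}
    (k : Fin r → ℕ → ℝ) {B : ℝ} (hk : ∀ i n, |k i n| ≤ B) (hf : ExpDecay x f) {M c : ℝ≥0∞}
    (hM : ResolventBound g c M f) (N m : ℕ) :
    ‖∑' n : Fin r → ℕ, f (m + ∑ i, n i) * ∏ i, (g ^ n i * (k i (n i) : ℂ))‖ₑ ≤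
      M * ∏ i, abelNorm N c (k i) := by
  induction r generalizing f M with
  | zero => simpa using hM 0 m
  | succ r ih =>
    have hs := (summable_norm_multi hx hx1 (fun i n => g ^ n * (k i n : ℂ))
      (fun i => bddSeq_pow_mul hg (hk i)) hf m).of_norm
    rw [← (Fin.consEquiv fun _ => ℕ).summable_iff] at hs
    rw [← (Fin.consEquiv fun _ => ℕ).tsum_eq]
    have hs2 := (Equiv.prodComm _ _).summable_iff.2 hs
    simp only [Function.comp_def] at hs2
    rw [← (Equiv.prodComm _ _).tsum_eq, hs2.tsum_prod, Fin.prod_univ_succ, ← mul_assoc]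
    have h1 := ih (fun i => k i.succ) (fun i => hk _)
      (hf.pairing hx hx1 (bddSeq_pow_mul hg (hk 0)))
      (hM.pairing_pow_mul hx hx1 hg hf (hk 0) N)
    refine le_trans (le_of_eq ?_) h1
    congr 1
    refine tsum_congr fun n => ?_
    rw [pairing, ← tsum_mul_right]
    refine tsum_congr fun a => ?_
    simp only [Equiv.prodComm_apply, Prod.swap, Fin.consEquiv_apply, Fin.sum_univ_succ,
      Fin.prod_univ_succ, Fin.cons_zero, Fin.cons_succ]
    rw [show m + (a + ∑ i, n i) = m + ∑ i, n i + a by ring]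
    ring

lemma enorm_tsum_multi_le (hx : 0 ≤ x) (hx1 : x < 1) (hg : ‖g‖ = 1) {E : Type*} [Fintype E]
    (k : E → ℕ → ℝ) {B : ℝ} (hk : ∀ i n, |k i n| ≤ B) (hf : ExpDecay x f) {M c : ℝ≥0∞}
    (hM : ResolventBound g c M f) (N m : ℕ) :
    ‖∑' n : E → ℕ, f (m + ∑ i, n i) * ∏ i, (g ^ n i * (k i (n i) : ℂ))‖ₑ ≤
      M * ∏ i, abelNorm N c (k i) := by
  have e := Fintype.equivFin E
  have h := enorm_tsum_multi_le_fin hx hx1 hg (fun i => k (e.symm i)) (fun i => hk _) hf hM N m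
  rw [e.symm.prod_comp (fun i => abelNorm N c (k i))] at h
  refine le_trans (le_of_eq ?_) h
  congr 1
  rw [← (e.symm.arrowCongr (Equiv.refl ℕ)).tsum_eq]
  refine tsum_congr fun n => ?_
  simp only [Equiv.arrowCongr_apply, Equiv.coe_refl, Function.comp_apply, id, Equiv.symm_symm]
  rw [← e.symm.sum_comp, ← e.symm.prod_comp]
  simp

lemma summable_norm_multi_fintype (hx : 0 ≤ x) (hx1 : x < 1) {E : Type*} [Fintype E]
    (u : E → ℕ → ℂ) (hu : ∀ i, BddSeq (u i)) (hf : ExpDecay x f) (m : ℕ) :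
    Summable fun n : E → ℕ => ‖f (m + ∑ i, n i) * ∏ i, u i (n i)‖ := by
  have e := Fintype.equivFin E
  have h := summable_norm_multi hx hx1 (fun i => u (e.symm i)) (fun i => hu _) hf m
  rw [← (e.symm.arrowCongr (Equiv.refl ℕ)).summable_iff]
  refine h.congr fun n => ?_
  simp only [Equiv.arrowCongr_apply, Equiv.coe_refl, Function.comp_apply, id, Equiv.symm_symm]
  rw [← e.symm.sum_comp, ← e.symm.prod_comp]
  simp

end pairing

end

/-! ### Resolvent bounds for samples of φ_q, uniform in the mesh. -/

noncomputable section

open scoped ENNReal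

section resolvent

variable {x : ℝ} {f : ℕ → ℂ} {g : ℂ}

lemma norm_shiftResolvent_iterate_le (hx : 0 ≤ x) (hx1 : x < 1) (hg : ‖g‖ = 1) {M : ℝ}
    (hf : ∀ m, ‖f m‖ ≤ M * x ^ m) (j m : ℕ) :
    ‖(shiftResolvent g)^[j] f m‖ ≤ M * (1 / (1 - x)) ^ j * x ^ m := by
  induction j generalizing m with
  | zero => simpa using hf m
  | succ j ih =>
    rw [Function.iterate_succ_apply']
    refine (norm_pairing_le hx hx1 zero_le_one (fun n => by simp [hg]) ih m).trans (le_of_eq ?_)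
    rw [pow_succ]
    ring

lemma shiftResolvent_iterate_diff (hx : 0 ≤ x) (hx1 : x < 1) (hg : ‖g‖ = 1) (hf : ExpDecay x f)
    (j m : ℕ) : (shiftResolvent g)^[j] (fun m => f (m + 1) - f m) m =
      (shiftResolvent g)^[j] f (m + 1) - (shiftResolvent g)^[j] f m := by
  induction j generalizing m with
  | zero => rfl
  | succ j ih =>
    have hj := hf.shiftResolvent_iterate hx hx1 hg j
    have h1 := (summable_norm_pairing hx hx1 (bddSeq_pow hg) hj m).of_norm
    have h2 := (summable_norm_pairing hx hx1 (bddSeq_pow hg) hj (m + 1)).of_norm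
    rw [Function.iterate_succ_apply', Function.iterate_succ_apply', funext ih]
    simp only [shiftResolvent, pairing] at h1 h2 ⊢
    rw [← h2.tsum_sub h1]
    refine tsum_congr fun n => ?_
    rw [add_right_comm m n 1]
    ring

/-- This exchanges one power of the resolvent for a factor 1/(1 - g), up to an error in which the
function has been differenced once more. -/
lemma one_sub_mul_shiftResolvent_succ (hx : 0 ≤ x) (hx1 : x < 1) (hg : ‖g‖ = 1)
    (hf : ExpDecay x f) (j m : ℕ) :
    (1 - g) * (shiftResolvent g)^[j + 1] f m = (shiftResolvent g)^[j] f m +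
      g * (shiftResolvent g)^[j + 1] (fun m => f (m + 1) - f m) m := by
  have h := shiftResolvent_eq hx hx1 hg (hf.shiftResolvent_iterate hx hx1 hg j) m
  rw [shiftResolvent_iterate_diff hx hx1 hg hf, Function.iterate_succ_apply']
  linear_combination h

end resolvent

lemma norm_one_sub_le_two {g : ℂ} (hg : ‖g‖ = 1) : ‖1 - g‖ ≤ 2 := by
  refine (norm_sub_le _ _).trans ?_
  rw [hg]; norm_num

/-- The powers of the resolvent at `g` act on the samples of `phiReg` with geometric bounds,
uniformly in the mesh `ε`. -/
lemma exists_shiftResolvent_phiReg_bound (q : ℕ) (hq : 1 ≤ q) :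
    ∃ C : ℝ, 1 ≤ C ∧ ∀ g : ℂ, ‖g‖ = 1 → g ≠ 1 → ∀ ε : ℝ, 0 < ε →
      (∃ x : ℝ, 0 ≤ x ∧ x < 1 ∧ ExpDecay x (fun m => (phiReg q (m * ε) : ℂ))) ∧
      ∀ j m, ‖(shiftResolvent g)^[j] (fun m => (phiReg q (m * ε) : ℂ)) m‖ ≤
        C * (C / ‖1 - g‖) ^ j := by
  obtain ⟨C, hC, hJ⟩ := exists_fwdDiff_phiReg_bound q hq
  have he : (1 : ℝ) ≤ Real.exp 1 := Real.one_le_exp zero_le_one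
  refine ⟨C * (2 + 8 * Real.exp 1), by nlinarith, fun g hg hg1 ε hε => ?_⟩
  set δ := ‖1 - g‖ with hδ
  have hδ0 : 0 < δ := norm_pos_iff.2 (sub_ne_zero.2 hg1.symm)
  have hδ2 : δ ≤ 2 := norm_one_sub_le_two hg
  set h : ℕ → ℕ → ℂ := fun k m => ((fwdDiff ε)^[k] (phiReg q) (m * ε) : ℝ) with hh
  have hsucc : ∀ k, h (k + 1) = fun m => h k (m + 1) - h k m := by
    intro k
    funext m
    simp only [hh, Function.iterate_succ_apply', fwdDiff]
    push_cast
    rw [add_mul, one_mul]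
  have h0 : (fun m : ℕ => (phiReg q (m * ε) : ℂ)) = h 0 := rfl
  have bound : ∀ J : ℕ, 1 ≤ J → ∃ l : ℝ, 0 < l ∧ ∀ k ≤ J, ∀ m : ℕ,
      ‖h k m‖ ≤ C ^ J * (Real.exp 1 * (ε * l)) ^ k * Real.exp (-(ε * l)) ^ m := by
    intro J hJ1
    obtain ⟨l, hl, hb⟩ := hJ J hJ1
    refine ⟨l, hl, fun k hk m => ?_⟩
    have := hb ε hε k hk (m * ε)
    rw [← Real.exp_nat_mul]
    simp only [hh, Complex.norm_real, Real.norm_eq_abs]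
    refine this.trans (le_of_eq ?_)
    rw [show -l * (m * ε) = m * (-(ε * l)) by ring]
    ring
  have hxlt : ∀ σ : ℝ, 0 < σ → Real.exp (-σ) < 1 := fun σ hσ =>
    Real.exp_zero ▸ Real.exp_lt_exp.2 (by linarith)
  have hxinv : ∀ σ : ℝ, 0 < σ → 1 / (1 - Real.exp (-σ)) ≤ 1 + 1 / σ := by
    intro σ hσ
    have h1 : Real.exp (-σ) ≤ 1 / (1 + σ) := by
      rw [Real.exp_neg, ← one_div]
      exact one_div_le_one_div_of_le (by linarith) (by linarith [Real.add_one_le_exp σ])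
    have h2 : σ / (1 + σ) ≤ 1 - Real.exp (-σ) := by
      have : σ / (1 + σ) = 1 - 1 / (1 + σ) := by field_simp; ring
      linarith
    refine (one_div_le_one_div_of_le (by positivity) h2).trans (le_of_eq ?_)
    field_simp
    ring
  refine ⟨?_, ?_⟩
  · obtain ⟨l, hl, hb⟩ := bound 1 le_rfl
    refine ⟨Real.exp (-(ε * l)), (Real.exp_pos _).le, hxlt _ (by positivity), C ^ 1, by positivity,
      fun m => ?_⟩
    have := hb 0 (by norm_num) m
    rw [pow_zero, mul_one] at this
    exact this
  intro J m
  rw [h0]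
  rcases Nat.eq_zero_or_pos J with rfl | hJ1
  · obtain ⟨l, hl, hb⟩ := bound 1 le_rfl
    have := hb 0 (by norm_num) m
    simp only [pow_one, pow_zero, mul_one] at this
    simp only [Function.iterate_zero, id, pow_zero, mul_one]
    refine this.trans ?_
    have h1 : Real.exp (-(ε * l)) ^ m ≤ 1 :=
      pow_le_one₀ (Real.exp_nonneg _) (hxlt _ (by positivity)).le
    have : C * Real.exp (-(ε * l)) ^ m ≤ C * 1 := by gcongr
    nlinarith
  obtain ⟨l, hl, hb⟩ := bound J hJ1
  set σ := ε * l with hσ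
  have hσ0 : 0 < σ := by positivity
  set x := Real.exp (-σ) with hx
  have hx0 : 0 ≤ x := Real.exp_nonneg _
  have hx1 : x < 1 := hxlt σ hσ0
  have hxm : ∀ m, x ^ m ≤ 1 := fun m => pow_le_one₀ hx0 hx1.le
  have hdecay : ∀ k ≤ J, ExpDecay x (h k) := fun k hk =>
    ⟨C ^ J * (Real.exp 1 * σ) ^ k, by positivity, hb k hk⟩
  have hfinal : ∀ L : ℝ, 0 ≤ L → L ≤ 2 + 8 * Real.exp 1 → C ^ J * (L / δ) ^ J ≤
      C * (2 + 8 * Real.exp 1) * (C * (2 + 8 * Real.exp 1) / δ) ^ J := by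
    intro L hL0 hL
    have h1 : (1 : ℝ) ≤ C * (2 + 8 * Real.exp 1) := by nlinarith
    rw [← mul_pow, ← mul_div_assoc]
    have h2 : (C * L / δ) ^ J ≤ (C * (2 + 8 * Real.exp 1) / δ) ^ J := by gcongr
    refine h2.trans (le_mul_of_one_le_left (by positivity) h1)
  -- Here σ is the decay rate per sample point. If σ is at least of order δ, the geometric series
  -- gives R a norm O(1/σ) = O(1/δ) at once. Otherwise differences of the samples are small compared
  -- with δ, and the exchange identity is iterated.
  by_cases hcase : δ / 4 < Real.exp 1 * σ
  · have h1 := norm_shiftResolvent_iterate_le hx0 hx1 hg (M := C ^ J)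
      (fun m => by simpa using hb 0 (by omega) m) J m
    refine h1.trans ((?_ : _ ≤ C ^ J * ((2 + 4 * Real.exp 1) / δ) ^ J).trans
      (hfinal _ (by positivity) (by linarith)))
    have h2 : 1 / (1 - x) ≤ (2 + 4 * Real.exp 1) / δ := by
      refine (hxinv σ hσ0).trans ?_
      rw [add_div]
      refine add_le_add ?_ ?_
      · rw [le_div_iff₀ hδ0]; linarith
      · rw [div_le_div_iff₀ hσ0 hδ0]; linarith
    have h3 : 0 ≤ 1 / (1 - x) := by
      have : 0 < 1 - x := by linarith
      positivity
    calc C ^ J * (1 / (1 - x)) ^ J * x ^ m ≤ C ^ J * (1 / (1 - x)) ^ J * 1 := by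
          gcongr
          exact hxm m
      _ ≤ _ := by rw [mul_one]; gcongr
  · push Not at hcase
    -- Double induction, downwards in the number k of differences and upwards in the power j. The
    -- step closes since 1 + 2e ≤ 8e.
    have key : ∀ i k, k + i = J → ∀ j ≤ J, ∀ m, ‖(shiftResolvent g)^[j] (h k) m‖ ≤
        C ^ J * (8 * Real.exp 1 / δ) ^ j * (δ / 4) ^ k := by
      intro i
      induction i with
      | zero =>
        intro k hk j hj m
        obtain rfl : k = J := by omega
        have h1 := norm_shiftResolvent_iterate_le hx0 hx1 hg (hb k le_rfl) j m
        have h2 : 1 / (1 - x) ≤ 2 / σ := by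
          refine (hxinv σ hσ0).trans ?_
          have : 1 ≤ 1 / σ := by
            rw [le_div_iff₀ hσ0]
            nlinarith
          rw [show (2 : ℝ) / σ = 1 / σ + 1 / σ by ring]
          linarith
        have h3 : 0 ≤ 1 / (1 - x) := by
          have : 0 < 1 - x := by linarith
          positivity
        calc _ ≤ C ^ k * (Real.exp 1 * σ) ^ k * (1 / (1 - x)) ^ j * x ^ m := h1
          _ ≤ C ^ k * (Real.exp 1 * σ) ^ k * (1 / (1 - x)) ^ j * 1 := by
              gcongr
              exact hxm m
          _ ≤ C ^ k * (Real.exp 1 * σ) ^ k * (2 / σ) ^ j := by rw [mul_one]; gcongr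
          -- As j ≤ J, each factor 2/σ from a resolvent meets a factor eσ from a difference, and σ
          -- cancels.
          _ = C ^ k * ((Real.exp 1 * σ) ^ (k - j) * (2 * Real.exp 1) ^ j) := by
              obtain ⟨d, rfl⟩ := Nat.exists_eq_add_of_le hj
              rw [Nat.add_sub_cancel_left, pow_add (Real.exp 1 * σ), mul_assoc, mul_right_comm,
                ← mul_pow, mul_comm ((Real.exp 1 * σ) ^ d)]
              congr 3
              field_simp
          _ ≤ C ^ k * ((δ / 4) ^ (k - j) * (2 * Real.exp 1) ^ j) := by gcongr
          _ = _ := by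
              obtain ⟨d, rfl⟩ := Nat.exists_eq_add_of_le hj
              rw [Nat.add_sub_cancel_left, pow_add (δ / 4), mul_assoc, ← mul_assoc _ ((δ / 4) ^ j),
                ← mul_pow, mul_comm ((δ / 4) ^ d)]
              congr 3
              field_simp
              norm_num
      | succ i ihi =>
        intro k hk j
        induction j with
        | zero =>
          intro _ m
          simp only [Function.iterate_zero, id, pow_zero, mul_one]
          refine (hb k (by omega) m).trans ?_
          calc C ^ J * (Real.exp 1 * σ) ^ k * x ^ m ≤ C ^ J * (δ / 4) ^ k * 1 := by
                gcongr
                exact hxm m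
            _ = _ := mul_one _
        | succ j ihj =>
          intro hj m
          have h1 := one_sub_mul_shiftResolvent_succ hx0 hx1 hg (hdecay k (by omega)) j m
          rw [← hsucc] at h1
          have h2 := congrArg norm h1
          rw [norm_mul, ← hδ] at h2
          have h3 := norm_add_le ((shiftResolvent g)^[j] (h k) m)
            (g * (shiftResolvent g)^[j + 1] (h (k + 1)) m)
          rw [norm_mul, hg, one_mul, ← h2] at h3
          have h4 := ihj (by omega) m
          have h5 := ihi (k + 1) (by omega) (j + 1) hj m
          refine le_of_mul_le_mul_left (h3.trans (add_le_add h4 h5) |>.trans ?_) hδ0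
          have h6 : C ^ J * (8 * Real.exp 1 / δ) ^ j * (δ / 4) ^ k +
              C ^ J * (8 * Real.exp 1 / δ) ^ (j + 1) * (δ / 4) ^ (k + 1) =
              C ^ J * (8 * Real.exp 1 / δ) ^ j * (δ / 4) ^ k * (1 + 2 * Real.exp 1) := by
            rw [pow_succ, pow_succ]
            field_simp
            ring
          have h7 : δ * (C ^ J * (8 * Real.exp 1 / δ) ^ (j + 1) * (δ / 4) ^ k) =
              C ^ J * (8 * Real.exp 1 / δ) ^ j * (δ / 4) ^ k * (8 * Real.exp 1) := by
            rw [pow_succ]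
            field_simp
          rw [h6, h7]
          gcongr
          linarith
    have h1 := key J 0 (by omega) J le_rfl m
    rw [pow_zero, mul_one] at h1
    exact h1.trans (hfinal _ (by positivity) (by linarith))

end

/-! ### The polynomials of the non-backtracking walk: recursion and pointwise bounds. -/

noncomputable section

open Polynomial

/-- The polynomials `u₀ = 0`, `u₁ = 1`, `uₙ₊₂ = (1 + β) X uₙ₊₁ - β uₙ` that govern the
non-backtracking walk. -/
def nbPoly (β : ℝ) : ℕ → ℝ[X]
  | 0 => 0
  | 1 => 1
  | n + 2 => C (1 + β) * X * nbPoly β (n + 1) - C β * nbPoly β n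

/-- The increments of `nbPoly`. -/
def nbDiff (β : ℝ) (n : ℕ) : ℝ[X] := nbPoly β (n + 1) - nbPoly β n

lemma nbPoly_succ_succ (β : ℝ) (n : ℕ) :
    nbPoly β (n + 2) = C (1 + β) * X * nbPoly β (n + 1) - C β * nbPoly β n := by
  rw [nbPoly]

lemma eval_nbPoly_succ_succ (β p : ℝ) (n : ℕ) : (nbPoly β (n + 2)).eval p =
    (1 + β) * p * (nbPoly β (n + 1)).eval p - β * (nbPoly β n).eval p := by
  rw [nbPoly_succ_succ]; simp

lemma nbDiff_succ_succ (β : ℝ) (n : ℕ) :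
    nbDiff β (n + 2) = C (1 + β) * X * nbDiff β (n + 1) - C β * nbDiff β n := by
  simp only [nbDiff, nbPoly_succ_succ β (n + 1), nbPoly_succ_succ β n]
  ring

/-- This form of the recursion exhibits the factor 1 - p that makes the increments small near p = 1.
-/
lemma eval_nbDiff_succ (β p : ℝ) (n : ℕ) : (nbDiff β (n + 1)).eval p =
    β * (nbDiff β n).eval p - (1 + β) * (1 - p) * (nbPoly β (n + 1)).eval p := by
  simp only [nbDiff, eval_sub, eval_nbPoly_succ_succ]
  ring

/-- Differentiating the linear recursion gives the same recursion with source (1 + β) `nbDiff`; the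
sum is Duhamel's formula, with `nbPoly` as fundamental solution. -/
lemma derivative_nbDiff (β : ℝ) (n : ℕ) : derivative (nbDiff β n) =
    C (1 + β) * ∑ k ∈ Finset.range n, nbPoly β (n - k) * nbDiff β k := by
  induction n using Nat.twoStepInduction with
  | zero => simp [nbDiff, nbPoly]
  | one => simp [nbDiff, nbPoly]
  | more n ih0 ih1 =>
    have h : ∑ k ∈ Finset.range (n + 2), nbPoly β (n + 2 - k) * nbDiff β k =
        nbDiff β (n + 1) + C (1 + β) * X *
          (∑ k ∈ Finset.range (n + 1), nbPoly β (n + 1 - k) * nbDiff β k) -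
        C β * ∑ k ∈ Finset.range n, nbPoly β (n - k) * nbDiff β k := by
      have h1 : ∑ k ∈ Finset.range (n + 1), nbPoly β (n + 2 - k) * nbDiff β k =
          C (1 + β) * X * (∑ k ∈ Finset.range (n + 1), nbPoly β (n + 1 - k) * nbDiff β k) -
          C β * ∑ k ∈ Finset.range (n + 1), nbPoly β (n - k) * nbDiff β k := by
        rw [Finset.mul_sum, Finset.mul_sum, ← Finset.sum_sub_distrib]
        refine Finset.sum_congr rfl fun k hk => ?_
        have hk' : k ≤ n := by simpa [Nat.lt_succ_iff] using hk
        rw [show n + 2 - k = (n - k) + 2 by omega, show n + 1 - k = (n - k) + 1 by omega,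
          nbPoly_succ_succ]
        ring
      rw [Finset.sum_range_succ, h1, Finset.sum_range_succ (fun k => nbPoly β (n - k) * _)]
      simp [show n + 2 - (n + 1) = 1 by omega, nbPoly]
      ring
    rw [nbDiff_succ_succ, derivative_sub, derivative_mul, derivative_mul, derivative_mul,
      derivative_C, derivative_C, derivative_X, ih1, ih0, h]
    ring

section bounds

variable {β p : ℝ}

/-- Here w is the larger root of z² - (1 + β) p z + β. Non-real roots have modulus √β. A real root a
> 0 satisfies (1 - p)(1 + β) a = (1 - a)(a - β), whence 1 - a ≥ 1 - p; for a < 0 the same argument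
gives 1 - |a| ≥ 1 + p, and p ≥ -5/6 keeps this away from 0. -/
lemma norm_root_le (hβ : 0 < β) (hβ3 : β ≤ 1 / 3) (hp : -(5 / 6) ≤ p) (hp1 : p ≤ 1) {w v : ℂ}
    (hs : w + v = ((1 + β) * p : ℝ)) (hm : w * v = (β : ℝ)) (hwv : ‖v‖ ≤ ‖w‖) :
    ‖w‖ ≤ 1 - (1 - p) / 12 := by
  have hre1 := congrArg Complex.re hs
  have him1 := congrArg Complex.im hs
  have hre2 := congrArg Complex.re hm
  have him2 := congrArg Complex.im hm
  simp only [Complex.add_re, Complex.add_im, Complex.mul_re, Complex.mul_im, Complex.ofReal_re,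
    Complex.ofReal_im] at hre1 him1 hre2 him2
  have hnw : ‖w‖ ^ 2 = w.re ^ 2 + w.im ^ 2 := by
    rw [← Complex.normSq_eq_norm_sq, Complex.normSq_apply]; ring
  have hvi : v.im = -w.im := by linarith
  have hprod : ‖w‖ * ‖v‖ = β := by
    rw [← norm_mul, hm, Complex.norm_real, Real.norm_of_nonneg hβ.le]
  have hwβ : β ≤ ‖w‖ ^ 2 := by nlinarith [norm_nonneg w]
  by_cases hb : w.im = 0
  · have hnw' : ‖w‖ = |w.re| := by
      rw [← abs_of_nonneg (norm_nonneg w), ← sq_eq_sq_iff_abs_eq_abs, hnw, hb]; ring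
    have hvr : w.re * v.re = β := by rw [hb] at hre2; linarith
    have hsq : w.re ^ 2 + β = (1 + β) * p * w.re := by rw [← hre1, ← hvr]; ring
    have hge : β ≤ w.re ^ 2 := by rw [hnw, hb] at hwβ; linarith
    rw [hnw']
    set a := w.re
    rcases lt_trichotomy a 0 with ha | ha | ha
    · rw [abs_of_neg ha]
      have h1 : β < -a := by nlinarith
      have h2 : (1 + p) * (1 + β) * (-a) = (1 - -a) * (-a - β) := by linarith
      have h3 : -a ≤ 1 := by
        by_contra h
        push Not at h
        nlinarith [mul_pos (show 0 < -a - 1 by linarith) (show 0 < -a - β by linarith),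
          mul_nonneg (mul_nonneg (show 0 ≤ 1 + p by linarith) (show 0 ≤ 1 + β by linarith))
            (show 0 ≤ -a by linarith)]
      have h4 : (1 + p) * (1 + β) * (-a) ≤ (1 - -a) * (-a) := by
        rw [h2]; exact mul_le_mul_of_nonneg_left (by linarith) (by linarith)
      have h5 := le_of_mul_le_mul_right h4 (show 0 < -a by linarith)
      nlinarith
    · rw [ha] at hge; nlinarith
    · rw [abs_of_pos ha]
      have h1 : β < a := by nlinarith
      have h2 : (1 - p) * (1 + β) * a = (1 - a) * (a - β) := by linarith
      have h3 : a ≤ 1 := by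
        by_contra h
        push Not at h
        nlinarith [mul_pos (show 0 < a - 1 by linarith) (show 0 < a - β by linarith),
          mul_nonneg (mul_nonneg (show 0 ≤ 1 - p by linarith) (show 0 ≤ 1 + β by linarith))
            ha.le]
      have h4 : (1 - p) * (1 + β) * a ≤ (1 - a) * a := by
        rw [h2]; exact mul_le_mul_of_nonneg_left (by linarith) (by linarith)
      have h5 := le_of_mul_le_mul_right h4 ha
      nlinarith
  · have h1 : v.re = w.re := by
      rw [hvi] at him2
      have : w.im * (v.re - w.re) = 0 := by linarith
      rcases mul_eq_zero.1 this with h | h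
      · exact absurd h hb
      · linarith
    have h2 : ‖w‖ ^ 2 = β := by rw [hnw, ← hre2, h1, hvi]; ring
    nlinarith [norm_nonneg w]

lemma abs_eval_nbPoly_le (hβ : 0 < β) (hβ3 : β ≤ 1 / 3) (hp : -(5 / 6) ≤ p) (hp1 : p ≤ 1)
    (n : ℕ) : |(nbPoly β (n + 1)).eval p| ≤ 4 * (1 - (1 - p) / 12) ^ n := by
  obtain ⟨s, hs⟩ := IsAlgClosed.exists_pow_nat_eq ((((1 + β) * p) ^ 2 - 4 * β : ℝ) : ℂ)
    (n := 2) two_pos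
  obtain ⟨w, v, hsum, hmul, hwv⟩ : ∃ w v : ℂ, w + v = ((1 + β) * p : ℝ) ∧ w * v = (β : ℝ) ∧
      ‖v‖ ≤ ‖w‖ := by
    have h1 : ((((1 + β) * p : ℝ) : ℂ) + s) / 2 + ((((1 + β) * p : ℝ) : ℂ) - s) / 2 =
      (((1 + β) * p : ℝ) : ℂ) := by ring
    have h2 : ((((1 + β) * p : ℝ) : ℂ) + s) / 2 * (((((1 + β) * p : ℝ) : ℂ) - s) / 2) =
      (β : ℂ) := by
      push_cast at hs ⊢
      linear_combination -hs / 4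
    rcases le_total ‖((((1 + β) * p : ℝ) : ℂ) - s) / 2‖ ‖((((1 + β) * p : ℝ) : ℂ) + s) / 2‖ with
      h | h
    · exact ⟨_, _, h1, h2, h⟩
    · exact ⟨_, _, by rw [add_comm]; exact h1, by rw [mul_comm]; exact h2, h⟩
  have hw := norm_root_le hβ hβ3 hp hp1 hsum hmul hwv
  have hv : ‖v‖ ≤ 3 / 5 := by
    have : ‖w‖ * ‖v‖ = β := by
      rw [← norm_mul, hmul, Complex.norm_real, Real.norm_of_nonneg hβ.le]
    nlinarith [norm_nonneg v]
  -- Factoring the characteristic polynomial lowers the recursion to first order. This avoids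
  -- dividing by w - v, so a double root needs no separate treatment.
  have hrec : ∀ n, (((nbPoly β (n + 1)).eval p : ℝ) : ℂ) =
      w * ((nbPoly β n).eval p : ℝ) + v ^ n := by
    intro n
    induction n with
    | zero => simp [nbPoly]
    | succ n ih =>
      rw [eval_nbPoly_succ_succ]
      push_cast at hsum hmul ⊢
      rw [← hsum, ← hmul, pow_succ]
      linear_combination v * ih
  set m := 1 - (1 - p) / 12 with hm
  have hm56 : 5 / 6 ≤ m := by rw [hm]; linarith
  -- The subtracted term absorbs the source vⁿ, because |v| ≤ 3/5 and 3m ≥ 4 · 3/5.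
  have key : ∀ n, |(nbPoly β (n + 1)).eval p| ≤ 4 * m ^ n - 3 * (3 / 5) ^ n := by
    intro n
    induction n with
    | zero => simp [nbPoly]; norm_num
    | succ n ih =>
      have h1 := congrArg norm (hrec (n + 1))
      rw [Complex.norm_real, Real.norm_eq_abs] at h1
      rw [h1]
      refine (norm_add_le _ _).trans ?_
      rw [norm_mul, norm_pow, Complex.norm_real, Real.norm_eq_abs]
      have h2 : ‖w‖ * |(nbPoly β (n + 1)).eval p| ≤ m * (4 * m ^ n - 3 * (3 / 5) ^ n) :=
        mul_le_mul hw ih (abs_nonneg _) (by linarith)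
      have h3 : ‖v‖ ^ (n + 1) ≤ (3 / 5) ^ (n + 1) := by gcongr
      have h4 : (0 : ℝ) < (3 / 5) ^ n := by positivity
      rw [pow_succ (3 / 5 : ℝ)] at h3 ⊢
      rw [pow_succ m]
      linarith [mul_le_mul_of_nonneg_left hm56 h4.le]
  refine (key n).trans ?_
  have : (0 : ℝ) < (3 / 5) ^ n := by positivity
  linarith

lemma abs_eval_nbDiff_le (hβ : 0 < β) (hβ3 : β ≤ 1 / 3) (hp : -(5 / 6) ≤ p) (hp1 : p ≤ 1)
    (n : ℕ) :
    |(nbDiff β n).eval p| ≤ (1 / 3) ^ n + 11 * (1 - p) * (1 - (1 - p) / 12) ^ n := by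
  induction n with
  | zero =>
    simp [nbDiff, nbPoly]
    linarith
  | succ n ih =>
    rw [eval_nbDiff_succ]
    have h1 := abs_eval_nbPoly_le hβ hβ3 hp hp1 n
    set m := 1 - (1 - p) / 12 with hm
    have hm56 : 5 / 6 ≤ m := by rw [hm]; linarith
    have hmn : 0 < m ^ n := by positivity
    refine (abs_sub _ _).trans ?_
    rw [abs_mul, abs_mul, abs_of_pos hβ, abs_of_nonneg (by nlinarith : 0 ≤ (1 + β) * (1 - p))]
    have h2 : β * |(nbDiff β n).eval p| ≤ 1 / 3 * ((1 / 3) ^ n + 11 * (1 - p) * m ^ n) :=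
      mul_le_mul hβ3 ih (abs_nonneg _) (by norm_num)
    have h3 : (1 + β) * (1 - p) * |(nbPoly β (n + 1)).eval p| ≤
        4 / 3 * (1 - p) * (4 * m ^ n) := by
      refine mul_le_mul ?_ h1 (abs_nonneg _) (by nlinarith)
      nlinarith
    have h4 : (1 - p) * m ^ n * (5 / 6) ≤ (1 - p) * m ^ n * m := by
      gcongr
    rw [pow_succ, pow_succ]
    nlinarith [mul_nonneg (show 0 ≤ 1 - p by linarith) hmn.le]

lemma abs_eval_derivative_nbDiff_le (hβ : 0 < β) (hβ3 : β ≤ 1 / 3) (hp : -(5 / 6) ≤ p)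
    (hp1 : p ≤ 1) (n : ℕ) : |(derivative (nbDiff β n)).eval p| ≤
      71 * (1 + n * (1 - p)) * (1 - (1 - p) / 12) ^ n := by
  set m := 1 - (1 - p) / 12 with hm
  have hm56 : 5 / 6 ≤ m := by rw [hm]; linarith
  have hm0 : 0 < m := by linarith
  rcases n with _ | n
  · simp [nbDiff, nbPoly]
  have hterm : ∀ k ∈ Finset.range (n + 1),
      |(nbPoly β (n + 1 - k)).eval p * (nbDiff β k).eval p| ≤
        4 * m ^ n * ((2 / 5) ^ k + 11 * (1 - p)) := by
    intro k hk
    have hk' : k ≤ n := by simpa [Nat.lt_succ_iff] using hk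
    have h1 := abs_eval_nbPoly_le hβ hβ3 hp hp1 (n - k)
    have h2 := abs_eval_nbDiff_le hβ hβ3 hp hp1 k
    rw [← hm] at h1 h2
    rw [show n + 1 - k = (n - k) + 1 by omega, abs_mul]
    -- 1/3 = (2/5)(5/6) ≤ (2/5) m: after extracting m^k, a summable geometric factor remains.
    have h3 : (1 / 3 : ℝ) ^ k ≤ (2 / 5) ^ k * m ^ k := by
      rw [← mul_pow]
      gcongr
      linarith
    have h4 : m ^ n = m ^ (n - k) * m ^ k := by rw [← pow_add]; congr 1; omega
    calc _ ≤ 4 * m ^ (n - k) * ((1 / 3) ^ k + 11 * (1 - p) * m ^ k) :=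
          mul_le_mul h1 h2 (abs_nonneg _) (by positivity)
      _ ≤ 4 * m ^ (n - k) * ((2 / 5) ^ k * m ^ k + 11 * (1 - p) * m ^ k) := by gcongr
      _ = _ := by rw [h4]; ring
  have hgeom : ∑ k ∈ Finset.range (n + 1), (2 / 5 : ℝ) ^ k ≤ 5 / 3 := by
    have h := geom_sum_mul_neg (2 / 5 : ℝ) (n + 1)
    have : (0 : ℝ) < (2 / 5) ^ (n + 1) := by positivity
    linarith
  rw [derivative_nbDiff]
  simp only [eval_mul, eval_C, eval_finsetSum]
  rw [abs_mul, abs_of_pos (by linarith)]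
  have hsum : |∑ k ∈ Finset.range (n + 1), (nbPoly β (n + 1 - k)).eval p *
      (nbDiff β k).eval p| ≤ 4 * m ^ n * (5 / 3 + (n + 1) * (11 * (1 - p))) := by
    refine (Finset.abs_sum_le_sum_abs _ _).trans ((Finset.sum_le_sum hterm).trans ?_)
    rw [← Finset.mul_sum, Finset.sum_add_distrib]
    gcongr
    simp
  have hmn : 0 < m ^ n := by positivity
  have hmn' : m ^ n ≤ 6 / 5 * m ^ (n + 1) := by
    rw [pow_succ]; nlinarith
  have hτ : 0 ≤ ((n : ℝ) + 1) * (1 - p) := mul_nonneg (by positivity) (by linarith)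
  calc (1 + β) * _ ≤ 4 / 3 * (4 * m ^ n * (5 / 3 + (n + 1) * (11 * (1 - p)))) :=
        mul_le_mul (by linarith) hsum (abs_nonneg _) (by norm_num)
    _ ≤ 4 / 3 * (4 * (6 / 5 * m ^ (n + 1)) * (5 / 3 + (n + 1) * (11 * (1 - p)))) := by
        gcongr
    _ ≤ _ := by
        push_cast
        have : 0 < m ^ (n + 1) := by positivity
        nlinarith [mul_nonneg hτ this.le]

end bounds

end

/-! ### Squared bounds for the increments, near p = 1 and away from it. -/

noncomputable section

open Polynomial

lemma pow_mul_exp_neg_le (j : ℕ) {y : ℝ} (hy : 0 ≤ y) :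
    y ^ j * Real.exp (-(y / 12)) ≤ 12 ^ j * j.factorial := by
  have h := Real.pow_div_factorial_le_exp (y / 12) (by positivity) j
  rw [div_pow, div_div, div_le_iff₀ (by positivity)] at h
  rw [Real.exp_neg, ← div_eq_mul_inv, div_le_iff₀ (Real.exp_pos _)]
  linarith

lemma exists_pow_mul_pow_le (j : ℕ) {r : ℝ} (hr : 0 ≤ r) (hr1 : r < 1) :
    ∃ K : ℝ, 0 < K ∧ ∀ n : ℕ, (n : ℝ) ^ j * r ^ n ≤ K := by
  obtain ⟨K, hK⟩ := (tendsto_pow_const_mul_const_pow_of_abs_lt_one j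
    (by rwa [abs_of_nonneg hr] : |r| < 1)).bddAbove_range
  exact ⟨max K 1, by positivity, fun n => (hK ⟨n, rfl⟩).trans (le_max_left _ _)⟩

/-- Gaussian-type bounds for `nbDiff` and its derivative. -/
lemma exists_nbDiff_exp_bound : ∃ K : ℝ, 0 < K ∧ ∀ β p : ℝ, 0 < β → β ≤ 1 / 3 → -(5 / 6) ≤ p →
    p ≤ 1 → ∀ n : ℕ,
      n ^ 2 * (nbDiff β n).eval p ^ 2 ≤ K * Real.exp (-(n * (1 - p) / 12)) ∧
      n * (1 - p) * (derivative (nbDiff β n)).eval p ^ 2 ≤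
        K * Real.exp (-(n * (1 - p) / 12)) := by
  refine ⟨71 ^ 2 * (12 + 2 * 288 + 6 * 1728) + 242 * 288 + 2, by norm_num,
    fun β p hβ hβ3 hp hp1 n => ?_⟩
  have hF := abs_eval_nbDiff_le hβ hβ3 hp hp1 n
  have hF' := abs_eval_derivative_nbDiff_le hβ hβ3 hp hp1 n
  set m := 1 - (1 - p) / 12 with hm
  have hm56 : 5 / 6 ≤ m := by rw [hm]; linarith
  have hm0 : 0 < m := by linarith
  set y := n * (1 - p) with hy
  have hy0 : 0 ≤ y := mul_nonneg (by positivity) (by linarith)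
  set e := Real.exp (-(y / 12)) with he
  have he0 : 0 < e := Real.exp_pos _
  have hme : m ^ n ≤ e := by
    have h1 : m ≤ Real.exp (-((1 - p) / 12)) := by
      have := Real.add_one_le_exp (-((1 - p) / 12))
      linarith
    calc m ^ n ≤ Real.exp (-((1 - p) / 12)) ^ n := by gcongr
      _ = e := by rw [← Real.exp_nat_mul, he, hy]; congr 1; ring
  have y1 := pow_mul_exp_neg_le 1 hy0
  have y2 := pow_mul_exp_neg_le 2 hy0
  have y3 := pow_mul_exp_neg_le 3 hy0
  rw [← he] at y1 y2 y3
  norm_num [Nat.factorial] at y1 y2 y3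
  -- The term (1/3)ⁿ comes from the contraction by β and carries no factor 1 - p; it is
  -- exponentially small and fits under the same bound.
  have hn9 : (n : ℝ) ^ 2 * ((1 / 3) ^ n) ^ 2 ≤ e := by
    have h1 : (n : ℝ) ≤ 2 ^ n := by exact_mod_cast (Nat.lt_two_pow_self).le
    calc (n : ℝ) ^ 2 * ((1 / 3) ^ n) ^ 2 ≤ (2 ^ n) ^ 2 * ((1 / 3) ^ n) ^ 2 := by gcongr
      _ = (4 / 9) ^ n := by rw [← pow_mul, ← pow_mul, mul_comm n 2, pow_mul, pow_mul, ← mul_pow]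
                            norm_num
      _ ≤ m ^ n := by gcongr; linarith
      _ ≤ e := hme
  have hmn0 : 0 ≤ m ^ n := by positivity
  have hτ : 0 ≤ 1 - p := by linarith
  refine ⟨?_, ?_⟩
  · have h1 : (nbDiff β n).eval p ^ 2 ≤ ((1 / 3) ^ n + 11 * (1 - p) * m ^ n) ^ 2 := by
      rw [← sq_abs]; gcongr
    have h2 : ((1 / 3 : ℝ) ^ n + 11 * (1 - p) * m ^ n) ^ 2 ≤
        2 * ((1 / 3) ^ n) ^ 2 + 242 * (1 - p) ^ 2 * (m ^ n) ^ 2 := by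
      nlinarith [sq_nonneg ((1 / 3 : ℝ) ^ n - 11 * (1 - p) * m ^ n)]
    have h3 : (n : ℝ) ^ 2 * (242 * (1 - p) ^ 2 * (m ^ n) ^ 2) ≤ 242 * 288 * e := by
      calc (n : ℝ) ^ 2 * (242 * (1 - p) ^ 2 * (m ^ n) ^ 2) = 242 * y ^ 2 * (m ^ n) ^ 2 := by
            rw [hy]; ring
        _ ≤ 242 * y ^ 2 * e ^ 2 := by gcongr
        _ = 242 * (y ^ 2 * e) * e := by ring
        _ ≤ 242 * 288 * e := by gcongr
    have h4 := mul_le_mul_of_nonneg_left (h1.trans h2) (sq_nonneg (n : ℝ))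
    have h5 : (0 : ℝ) ≤ 71 ^ 2 * (12 + 2 * 288 + 6 * 1728) * e := by positivity
    linarith
  · have h1 : (derivative (nbDiff β n)).eval p ^ 2 ≤ (71 * (1 + y) * m ^ n) ^ 2 := by
      rw [← sq_abs]; gcongr
    have h2 : y * (71 * (1 + y) * m ^ n) ^ 2 ≤ 71 ^ 2 * (12 + 2 * 288 + 6 * 1728) * e := by
      calc y * (71 * (1 + y) * m ^ n) ^ 2 = 71 ^ 2 * (y * (1 + y) ^ 2) * (m ^ n) ^ 2 := by ring
        _ ≤ 71 ^ 2 * (y * (1 + y) ^ 2) * e ^ 2 := by gcongr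
        _ = 71 ^ 2 * (y * e + 2 * (y ^ 2 * e) + y ^ 3 * e) * e := by ring
        _ ≤ _ := by
          refine mul_le_mul_of_nonneg_right ?_ he0.le
          linarith
    have h3 := mul_le_mul_of_nonneg_left h1 hy0
    have h4 : (0 : ℝ) ≤ (242 * 288 + 2) * e := by positivity
    linarith

/-- Away from `p = 1` the bounds for `nbDiff` gain a factor `|p| + β`. -/
lemma exists_nbDiff_small_bound : ∃ K : ℝ, 0 < K ∧ ∀ β p : ℝ, 0 < β → β ≤ 1 / 3 →
    -(5 / 6) ≤ p → p ≤ 1 / 2 → ∀ n : ℕ, 3 ≤ n →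
      n ^ 3 * (nbDiff β n).eval p ^ 2 ≤ K * (|p| + β) ^ 2 ∧
      n ^ 2 * (1 - p) * (derivative (nbDiff β n)).eval p ^ 2 ≤ K * (|p| + β) ^ 2 := by
  obtain ⟨K, hK, hKn⟩ := exists_pow_mul_pow_le 4 (r := (23 / 24) ^ 2) (by positivity)
    (by norm_num)
  refine ⟨2 * 300 ^ 2 * K, by positivity, fun β p hβ hβ3 hp hp2 n hn => ?_⟩
  have hp1 : p ≤ 1 := by linarith
  have hu := abs_eval_nbPoly_le hβ hβ3 hp hp1
  set m := 1 - (1 - p) / 12 with hm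
  have hm56 : 5 / 6 ≤ m := by rw [hm]; linarith
  have hm0 : 0 < m := by linarith
  have hm24 : m ≤ 23 / 24 := by rw [hm]; linarith
  set κ := |p| + β with hκ
  have hκ0 : 0 < κ := by positivity
  have hinv : ∀ k, m ^ k ≤ 6 / 5 * m ^ (k + 1) := by
    intro k
    have : 0 < m ^ k := by positivity
    rw [pow_succ]; nlinarith
  -- From index 2 on, the recursion expresses `nbPoly` with coefficients (1 + β) p and β; this is
  -- the gain of |p| + β.
  have hu2 : ∀ k, |(nbPoly β (k + 2)).eval p| ≤ 8 * κ * m ^ k := by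
    intro k
    rw [eval_nbPoly_succ_succ]
    refine (abs_sub _ _).trans ?_
    rw [abs_mul, abs_mul, abs_mul, abs_of_pos hβ, abs_of_pos (by linarith : 0 < 1 + β)]
    have h1 : (1 + β) * |p| * |(nbPoly β (k + 1)).eval p| ≤ 4 / 3 * |p| * (4 * m ^ k) := by
      gcongr
      · linarith
      · exact hu k
    have h2 : β * |(nbPoly β k).eval p| ≤ β * (24 / 5 * m ^ k) := by
      refine mul_le_mul_of_nonneg_left ?_ hβ.le
      rcases k with _ | k
      · simp [nbPoly]; norm_num
      · have := hu k
        linarith [hinv k]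
    have h3 : 0 < m ^ k := by positivity
    rw [hκ]
    nlinarith [mul_nonneg (abs_nonneg p) h3.le, mul_pos hβ h3]
  have hF : ∀ k, |(nbDiff β k).eval p| ≤ 10 * m ^ k := by
    intro k
    rw [nbDiff, eval_sub]
    refine (abs_sub _ _).trans ?_
    have h3 : 0 < m ^ k := by positivity
    rcases k with _ | k
    · simp [nbPoly]
    · have h1 := hu k
      have h2 := hu (k + 1)
      linarith [hinv k]
  have hF2 : ∀ k, |(nbDiff β (k + 2)).eval p| ≤ 16 * κ * m ^ k := by
    intro k
    rw [nbDiff, eval_sub]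
    refine (abs_sub _ _).trans ?_
    have h1 := hu2 k
    have h2 := hu2 (k + 1)
    have h3 : m ^ (k + 1) ≤ m ^ k := pow_le_pow_of_le_one hm0.le (by linarith) (by omega)
    have h4 := mul_le_mul_of_nonneg_left h3 (by positivity : 0 ≤ 8 * κ)
    linarith
  obtain ⟨n, rfl⟩ : ∃ k, n = k + 3 := ⟨n - 3, by omega⟩
  have hm3 : m ^ n ≤ 2 * m ^ (n + 3) := by
    have := hinv n
    have := hinv (n + 1)
    have := hinv (n + 2)
    have h3 : 0 < m ^ (n + 3) := by positivity
    simp only [add_assoc] at *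
    norm_num at *
    linarith
  have hD : |(derivative (nbDiff β (n + 3))).eval p| ≤
      300 * (n + 3 : ℕ) * κ * m ^ (n + 3) := by
    rw [derivative_nbDiff]
    simp only [eval_mul, eval_C, eval_finsetSum]
    rw [abs_mul, abs_of_pos (by linarith : 0 < 1 + β)]
    have hterm : ∀ k ∈ Finset.range (n + 3),
        |(nbPoly β (n + 3 - k)).eval p * (nbDiff β k).eval p| ≤ 80 * κ * m ^ n := by
      intro k hk
      have hk' : k < n + 3 := by simpa using hk
      rw [abs_mul]
      -- In every term of the Duhamel sum one of the two factors has index at least 2 and yields the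
      -- gain. This is where a total index of at least 3 is needed.
      rcases Nat.lt_or_ge k (n + 2) with hk2 | hk2
      · have h1 := hu2 (n + 1 - k)
        rw [show n + 1 - k + 2 = n + 3 - k by omega] at h1
        calc _ ≤ 8 * κ * m ^ (n + 1 - k) * (10 * m ^ k) :=
              mul_le_mul h1 (hF k) (abs_nonneg _) (by positivity)
          _ = 80 * κ * m ^ (n + 1) := by
              rw [show n + 1 = (n + 1 - k) + k by omega, pow_add, Nat.add_sub_cancel]; ring
          _ ≤ 80 * κ * m ^ n := by
              gcongr 80 * κ * ?_
              exact pow_le_pow_of_le_one hm0.le (by linarith) (by omega)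
      · obtain rfl : k = n + 2 := by omega
        have h1 := hF2 n
        rw [show n + 3 - (n + 2) = 1 by omega]
        have h3 : 0 < κ * m ^ n := by positivity
        simp only [nbPoly, eval_one, abs_one, one_mul]
        linarith
    have hs : |∑ k ∈ Finset.range (n + 3), (nbPoly β (n + 3 - k)).eval p *
        (nbDiff β k).eval p| ≤ (n + 3 : ℕ) * (80 * κ * m ^ n) := by
      refine (Finset.abs_sum_le_sum_abs _ _).trans ((Finset.sum_le_sum hterm).trans ?_)
      simp
    calc _ ≤ 4 / 3 * ((n + 3 : ℕ) * (80 * κ * m ^ n)) :=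
          mul_le_mul (by linarith) hs (abs_nonneg _) (by norm_num)
      _ ≤ 4 / 3 * ((n + 3 : ℕ) * (80 * κ * (2 * m ^ (n + 3)))) := by gcongr
      _ ≤ _ := by
          have : 0 ≤ ((n + 3 : ℕ) : ℝ) * κ * m ^ (n + 3) := by positivity
          linarith
  have hFn : |(nbDiff β (n + 3)).eval p| ≤ 300 * κ * m ^ (n + 3) := by
    have h1 := hF2 (n + 1)
    have h2 := hinv (n + 1)
    have h3 := hinv (n + 2)
    have h5 : m ^ (n + 1) ≤ 2 * m ^ (n + 3) := by
      simp only [add_assoc] at h2 h3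
      norm_num at h2 h3
      have : 0 < m ^ (n + 3) := by positivity
      linarith
    have h4 : 0 < κ * m ^ (n + 3) := by positivity
    refine h1.trans ?_
    have := mul_le_mul_of_nonneg_left h5 (by positivity : 0 ≤ 16 * κ)
    linarith
  set N := n + 3 with hN
  have hN1 : (1 : ℝ) ≤ N := by exact_mod_cast (by omega : 1 ≤ N)
  have hmN : (N : ℝ) ^ 4 * (m ^ N) ^ 2 ≤ K := by
    refine le_trans ?_ (hKn N)
    rw [← pow_mul, mul_comm N 2, pow_mul]
    gcongr
  refine ⟨?_, ?_⟩
  · have h1 : (nbDiff β N).eval p ^ 2 ≤ (300 * κ * m ^ N) ^ 2 := by rw [← sq_abs]; gcongr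
    calc (N : ℝ) ^ 3 * (nbDiff β N).eval p ^ 2 ≤ N ^ 4 * (300 * κ * m ^ N) ^ 2 := by
          gcongr
          norm_num
      _ = 300 ^ 2 * κ ^ 2 * (N ^ 4 * (m ^ N) ^ 2) := by ring
      _ ≤ 300 ^ 2 * κ ^ 2 * K := by gcongr
      _ ≤ _ := by
          have : 0 < κ ^ 2 * K := by positivity
          linarith
  · have h1 : (derivative (nbDiff β N)).eval p ^ 2 ≤ (300 * N * κ * m ^ N) ^ 2 := by
      rw [← sq_abs]; gcongr
    have h2 : (N : ℝ) ^ 2 * (1 - p) ≤ N ^ 2 * 2 := by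
      gcongr
      linarith
    calc (N : ℝ) ^ 2 * (1 - p) * (derivative (nbDiff β N)).eval p ^ 2
        ≤ N ^ 2 * 2 * (300 * N * κ * m ^ N) ^ 2 := by gcongr
      _ = 2 * 300 ^ 2 * κ ^ 2 * (N ^ 4 * (m ^ N) ^ 2) := by ring
      _ ≤ 2 * 300 ^ 2 * κ ^ 2 * K := by gcongr
      _ = _ := by ring

end

/-! ### The symbol of the simple walk on ℤ(W), Parseval, and ℓ¹ against weighted ℓ². -/

noncomputable section

open Polynomial

/-- The steps of the walk on `ℤ(W)`. -/
def bandSteps (W : ℕ) : Finset ℤ := (Finset.Icc (-(W : ℤ)) W).erase 0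

lemma mem_bandSteps {W : ℕ} {t : ℤ} : t ∈ bandSteps W ↔ 0 < |t| ∧ |t| ≤ W := by
  simp [bandSteps, abs_le]

lemma mem_bandSteps_iff {W : ℕ} {t : ℤ} : t ∈ bandSteps W ↔ t ≠ 0 ∧ -(W : ℤ) ≤ t ∧ t ≤ W := by
  simp [bandSteps]

lemma neg_mem_bandSteps {W : ℕ} {t : ℤ} : -t ∈ bandSteps W ↔ t ∈ bandSteps W := by
  simp [mem_bandSteps]

lemma sum_bandSteps {M : Type*} [AddCommMonoid M] (W : ℕ) (f : ℤ → M) :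
    ∑ t ∈ bandSteps W, f t = ∑ k ∈ Finset.Icc 1 W, (f k + f (-k)) := by
  induction W with
  | zero => simp [bandSteps]
  | succ W ih =>
    have h : bandSteps (W + 1) = insert ((W : ℤ) + 1) (insert (-((W : ℤ) + 1)) (bandSteps W)) := by
      ext t
      simp only [mem_bandSteps_iff, Finset.mem_insert]
      push_cast
      omega
    rw [h, Finset.sum_insert, Finset.sum_insert, ih, Finset.sum_Icc_succ_top (by omega)]
    · push_cast
      rw [← add_assoc, add_comm]
    · simp only [mem_bandSteps_iff]; omega
    · simp only [Finset.mem_insert, mem_bandSteps_iff]; omega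

lemma card_bandSteps (W : ℕ) : (bandSteps W).card = 2 * W := by
  rw [Finset.card_eq_sum_ones, sum_bandSteps]
  simp [mul_comm]

/-- The symbol of the simple random walk on `ℤ(W)`. -/
def bandSymbol (W : ℕ) (θ : ℝ) : ℝ := (∑ k ∈ Finset.Icc 1 W, Real.cos (k * θ)) / W

section symbol

variable {W : ℕ}

lemma one_sub_bandSymbol (hW : 0 < W) (θ : ℝ) :
    1 - bandSymbol W θ = (∑ k ∈ Finset.Icc 1 W, (1 - Real.cos (k * θ))) / W := by
  have : (W : ℝ) ≠ 0 := by positivity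
  rw [bandSymbol, Finset.sum_sub_distrib, eq_div_iff this, sub_mul, div_mul_cancel₀ _ this]
  simp

lemma bandSymbol_le_one (hW : 0 < W) (θ : ℝ) : bandSymbol W θ ≤ 1 := by
  have h : 0 ≤ 1 - bandSymbol W θ := by
    rw [one_sub_bandSymbol hW]
    refine div_nonneg (Finset.sum_nonneg fun k _ => ?_) (by positivity)
    linarith [Real.cos_le_one (k * θ)]
  linarith

/-- cos x and cos 2x cannot both be near -1: 2(1 + cos x) + (1 + cos 2x) ≥ 3/2. Pairing k with 2k
for k ≤ W/2 gives the bound. For W = 1 the graph is bipartite and the symbol reaches -1. -/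
lemma neg_five_sixths_le_bandSymbol (hW : 2 ≤ W) (θ : ℝ) : -(5 / 6) ≤ bandSymbol W θ := by
  have hW0 : (0 : ℝ) < W := by positivity
  set a : ℕ → ℝ := fun k => 1 + Real.cos (k * θ) with ha
  have ha0 : ∀ k, 0 ≤ a k := fun k => by simp only [ha]; linarith [Real.neg_one_le_cos (k * θ)]
  have h1 : ∀ k, 3 / 2 ≤ 2 * a k + a (2 * k) := by
    intro k
    simp only [ha]
    push_cast
    rw [show 2 * (k : ℝ) * θ = 2 * (k * θ) by ring, Real.cos_two_mul]
    nlinarith [sq_nonneg (2 * Real.cos (k * θ) + 1)]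
  have h2 : ∑ k ∈ Finset.Icc 1 (W / 2), a k ≤ ∑ k ∈ Finset.Icc 1 W, a k :=
    Finset.sum_le_sum_of_subset_of_nonneg (Finset.Icc_subset_Icc le_rfl (by omega))
      fun k _ _ => ha0 k
  have h3 : ∑ k ∈ Finset.Icc 1 (W / 2), a (2 * k) ≤ ∑ k ∈ Finset.Icc 1 W, a k := by
    rw [← Finset.sum_image (f := a) (g := fun k => 2 * k) (by intro x _ y _ h; simpa using h)]
    refine Finset.sum_le_sum_of_subset_of_nonneg ?_ fun k _ _ => ha0 k
    intro k hk
    simp only [Finset.mem_image, Finset.mem_Icc] at hk ⊢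
    omega
  have h4 : ∑ k ∈ Finset.Icc 1 (W / 2), (3 / 2 : ℝ) ≤
      ∑ k ∈ Finset.Icc 1 (W / 2), (2 * a k + a (2 * k)) := Finset.sum_le_sum fun k _ => h1 k
  rw [Finset.sum_add_distrib, ← Finset.mul_sum] at h4
  simp only [Finset.sum_const, Nat.card_Icc, Nat.add_sub_cancel, nsmul_eq_mul] at h4
  have h5 : (W : ℝ) ≤ 3 * ((W / 2 : ℕ) : ℝ) := by exact_mod_cast (by omega : W ≤ 3 * (W / 2))
  have h6 : ∑ k ∈ Finset.Icc 1 W, a k = W + ∑ k ∈ Finset.Icc 1 W, Real.cos (k * θ) := by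
    simp [ha, Finset.sum_add_distrib]
  rw [bandSymbol, le_div_iff₀ hW0]
  linarith

lemma hasDerivAt_bandSymbol (θ : ℝ) : HasDerivAt (bandSymbol W)
    ((∑ k ∈ Finset.Icc 1 W, -(k * Real.sin (k * θ))) / W) θ := by
  unfold bandSymbol
  refine HasDerivAt.div_const (HasDerivAt.fun_sum fun k _ => ?_) _
  have := ((hasDerivAt_id θ).const_mul (k : ℝ)).cos
  simpa [mul_comm] using this

/-- Cauchy–Schwarz together with sin² ≤ 2(1 - cos). The factor 1 - p on the right compensates the
size of the derivative of `nbDiff`. -/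
lemma deriv_bandSymbol_sq_le (hW : 0 < W) (θ : ℝ) :
    ((∑ k ∈ Finset.Icc 1 W, -(k * Real.sin (k * θ))) / W) ^ 2 ≤
      2 * W ^ 2 * (1 - bandSymbol W θ) := by
  have hW0 : (0 : ℝ) < W := by positivity
  have h1 := Finset.sum_mul_sq_le_sq_mul_sq (Finset.Icc 1 W) (fun k : ℕ => (k : ℝ))
    (fun k => Real.sin (k * θ))
  have h2 : ∑ k ∈ Finset.Icc 1 W, (k : ℝ) ^ 2 ≤ W * W ^ 2 := by
    have : ∀ k ∈ Finset.Icc 1 W, (k : ℝ) ^ 2 ≤ W ^ 2 := by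
      intro k hk
      have : k ≤ W := (Finset.mem_Icc.1 hk).2
      gcongr
    refine (Finset.sum_le_sum this).trans ?_
    simp
  have h3 : ∑ k ∈ Finset.Icc 1 W, Real.sin (k * θ) ^ 2 ≤
      2 * ∑ k ∈ Finset.Icc 1 W, (1 - Real.cos (k * θ)) := by
    rw [Finset.mul_sum]
    refine Finset.sum_le_sum fun k _ => ?_
    rw [Real.sin_sq]
    nlinarith [Real.cos_le_one (k * θ), Real.neg_one_le_cos (k * θ)]
  have h4 : ∑ k ∈ Finset.Icc 1 W, (1 - Real.cos (k * θ)) = W * (1 - bandSymbol W θ) := by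
    rw [one_sub_bandSymbol hW, mul_div_cancel₀ _ hW0.ne']
  rw [h4] at h3
  rw [Finset.sum_neg_distrib, neg_div, neg_sq, div_pow, div_le_iff₀ (by positivity)]
  refine h1.trans ((mul_le_mul h2 h3 (Finset.sum_nonneg fun k _ => sq_nonneg _)
    (by positivity)).trans (le_of_eq (by ring)))

lemma one_sub_bandSymbol_ge (hW : 0 < W) {θ : ℝ} (hθ : |θ| ≤ Real.pi / W) :
    2 / (3 * Real.pi ^ 2) * (W ^ 2 * θ ^ 2) ≤ 1 - bandSymbol W θ := by
  have hW0 : (0 : ℝ) < W := by positivity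
  have hsq : ∀ n : ℕ, (n : ℝ) ^ 3 / 3 ≤ ∑ k ∈ Finset.Icc 1 n, (k : ℝ) ^ 2 := by
    intro n
    induction n with
    | zero => simp
    | succ n ih =>
      rw [Finset.sum_Icc_succ_top (by omega)]
      push_cast
      have : (0 : ℝ) ≤ n := by positivity
      linarith [show ((n : ℝ) + 1) ^ 3 / 3 = n ^ 3 / 3 + (n + 1) ^ 2 - n - 2 / 3 by ring]
  have h1 : ∀ k ∈ Finset.Icc 1 W, 2 / Real.pi ^ 2 * θ ^ 2 * (k : ℝ) ^ 2 ≤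
      1 - Real.cos (k * θ) := by
    intro k hk
    have hkW : (k : ℝ) ≤ W := by exact_mod_cast (Finset.mem_Icc.1 hk).2
    have : |k * θ| ≤ Real.pi := by
      rw [abs_mul, Nat.abs_cast]
      calc (k : ℝ) * |θ| ≤ W * (Real.pi / W) := by gcongr
        _ = Real.pi := by field_simp
    have := Real.cos_le_one_sub_mul_cos_sq ‹|k * θ| ≤ Real.pi›
    rw [mul_pow] at this
    linarith
  rw [one_sub_bandSymbol hW, le_div_iff₀ hW0]
  refine le_trans ?_ (Finset.sum_le_sum h1)
  rw [← Finset.mul_sum]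
  refine le_trans (le_of_eq ?_) (mul_le_mul_of_nonneg_left (hsq W) (by positivity))
  field_simp

/-- Closed form of the Dirichlet kernel; for |θ| ≥ π/W its denominator satisfies sin(|θ|/2) ≥ 1/W.
-/
lemma bandSymbol_le_half (hW : 0 < W) {θ : ℝ} (hθ : Real.pi / W ≤ |θ|) (hθ' : |θ| ≤ Real.pi) :
    bandSymbol W θ ≤ 1 / 2 := by
  have hW0 : (0 : ℝ) < W := by positivity
  have heven : bandSymbol W θ = bandSymbol W |θ| := by
    rcases abs_cases θ with ⟨h, _⟩ | ⟨h, _⟩ <;> simp [bandSymbol, h]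
  rw [heven]
  set x := |θ|
  have hclosed : ∀ n : ℕ, 2 * Real.sin (x / 2) * ∑ k ∈ Finset.Icc 1 n, Real.cos (k * x) =
      Real.sin (n * x + x / 2) - Real.sin (x / 2) := by
    intro n
    induction n with
    | zero => simp
    | succ n ih =>
      rw [Finset.sum_Icc_succ_top (by omega), mul_add, ih]
      push_cast
      rw [show ((n : ℝ) + 1) * x + x / 2 = (n + 1) * x + x / 2 by ring,
        show (n : ℝ) * x + x / 2 = (n + 1) * x - x / 2 by ring, Real.sin_add, Real.sin_sub]
      ring
  have hsin : 1 / (W : ℝ) ≤ Real.sin (x / 2) := by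
    have h1 := Real.mul_le_sin (x := x / 2) (by positivity) (by linarith)
    refine le_trans ?_ h1
    rw [div_le_iff₀ hW0] at hθ ⊢
    have : 2 / Real.pi * (x / 2) * W = (x * W) / Real.pi := by ring
    rw [this, le_div_iff₀ Real.pi_pos]
    linarith
  have hs0 : 0 < Real.sin (x / 2) := lt_of_lt_of_le (by positivity) hsin
  have h2 := hclosed W
  have h3 := Real.sin_le_one (W * x + x / 2)
  rw [bandSymbol, div_le_iff₀ hW0]
  rw [div_le_iff₀ hW0] at hsin
  have h4 : 2 * Real.sin (x / 2) * ∑ k ∈ Finset.Icc 1 W, Real.cos (k * x) ≤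
      2 * Real.sin (x / 2) * (1 / 2 * W) := by linarith
  exact le_of_mul_le_mul_left h4 (by positivity)

lemma continuous_bandSymbol : Continuous (bandSymbol W) := by
  unfold bandSymbol
  fun_prop

end symbol

/-- The trigonometric polynomial with coefficients `c`. -/
def trigSum (s : Finset ℤ) (c : ℤ → ℝ) (θ : ℝ) : ℂ :=
  ∑ x ∈ s, (c x : ℂ) * Complex.exp (x * θ * Complex.I)

lemma integral_exp_int_mul_I (n : ℤ) : ∫ θ in (-Real.pi)..Real.pi, Complex.exp (n * θ * Complex.I) =
    if n = 0 then (2 * Real.pi : ℂ) else 0 := by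
  split_ifs with h
  · subst h
    simp
    ring
  · have hc : (n * Complex.I : ℂ) ≠ 0 := by simp [h]
    have e : ∀ θ : ℝ, Complex.exp (n * θ * Complex.I) = Complex.exp (n * Complex.I * θ) := by
      intro θ; congr 1; ring
    simp_rw [e]
    rw [integral_exp_mul_complex hc]
    have h1 : Complex.exp (n * Complex.I * (Real.pi : ℝ)) =
        Complex.exp (n * Complex.I * ((-Real.pi : ℝ) : ℂ)) := by
      rw [Complex.exp_eq_exp_iff_exists_int]
      exact ⟨n, by push_cast; ring⟩
    rw [h1, sub_self, zero_div]

lemma integral_norm_sq_trigSum (s : Finset ℤ) (c : ℤ → ℝ) :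
    ∫ θ in (-Real.pi)..Real.pi, ‖trigSum s c θ‖ ^ 2 = 2 * Real.pi * ∑ x ∈ s, c x ^ 2 := by
  have key : ∫ θ in (-Real.pi)..Real.pi, ((‖trigSum s c θ‖ ^ 2 : ℝ) : ℂ) =
      ((2 * Real.pi * ∑ x ∈ s, c x ^ 2 : ℝ) : ℂ) := by
    have e : ∀ θ : ℝ, ((‖trigSum s c θ‖ ^ 2 : ℝ) : ℂ) = ∑ x ∈ s, ∑ y ∈ s,
        (c x * c y : ℂ) * Complex.exp ((x - y : ℤ) * θ * Complex.I) := by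
      intro θ
      push_cast
      rw [← Complex.mul_conj', trigSum, map_sum, Finset.sum_mul_sum]
      refine Finset.sum_congr rfl fun x _ => Finset.sum_congr rfl fun y _ => ?_
      rw [map_mul, Complex.conj_ofReal, ← Complex.exp_conj, mul_mul_mul_comm, ← Complex.exp_add]
      congr 2
      simp
      ring
    simp_rw [e]
    rw [intervalIntegral.integral_finsetSum]
    · rw [Complex.ofReal_mul, Complex.ofReal_sum, Finset.mul_sum]
      refine Finset.sum_congr rfl fun x hx => ?_
      rw [intervalIntegral.integral_finsetSum]
      · rw [Finset.sum_eq_single x]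
        · rw [intervalIntegral.integral_const_mul, integral_exp_int_mul_I]
          simp
          ring
        · intro y _ hy
          rw [intervalIntegral.integral_const_mul, integral_exp_int_mul_I, if_neg, mul_zero]
          rw [sub_eq_zero]; exact hy.symm
        · intro h; exact absurd hx h
      · intro y _
        exact Continuous.intervalIntegrable (by fun_prop) _ _
    · intro x _
      exact Continuous.intervalIntegrable (by fun_prop) _ _
  rw [intervalIntegral.integral_ofReal] at key
  exact_mod_cast key

lemma hasDerivAt_trigSum (s : Finset ℤ) (c : ℤ → ℝ) (θ : ℝ) :
    HasDerivAt (trigSum s c) (Complex.I * trigSum s (fun x => x * c x) θ) θ := by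
  unfold trigSum
  rw [Finset.mul_sum]
  refine HasDerivAt.fun_sum fun x _ => ?_
  have h1 : HasDerivAt (fun θ : ℝ => (x : ℂ) * (θ : ℂ) * Complex.I) (x * 1 * Complex.I) θ :=
    ((Complex.ofRealCLM.hasDerivAt (x := θ)).const_mul (x : ℂ)).mul_const Complex.I
  have h2 := (h1.cexp).const_mul (c x : ℂ)
  refine h2.congr_deriv ?_
  push_cast
  ring

/-- `ℓ¹` norms are controlled by weighted `ℓ²` norms. -/
lemma sum_abs_sq_le (s : Finset ℤ) (c : ℤ → ℝ) {L : ℕ} (hL : 1 ≤ L) :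
    (∑ x ∈ s, |c x|) ^ 2 ≤ 5 * L * (∑ x ∈ s, (c x ^ 2 + (x * c x) ^ 2 / L ^ 2)) := by
  have hL0 : (0 : ℝ) < L := by positivity
  -- Cauchy–Schwarz with a Cauchy-type weight at scale L, whose total mass is O(L).
  set w : ℤ → ℝ := fun x => 1 / (1 + x ^ 2 / L ^ 2) with hw
  have hw0 : ∀ x, 0 ≤ w x := fun x => by simp only [hw]; positivity
  have h1 : (∑ x ∈ s, |c x|) ^ 2 ≤
      (∑ x ∈ s, w x) * ∑ x ∈ s, (c x ^ 2 + (x * c x) ^ 2 / L ^ 2) := by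
    refine Finset.sum_sq_le_sum_mul_sum_of_sq_le_mul s (fun x _ => hw0 x)
      (fun x _ => by positivity) fun x _ => ?_
    simp only [hw]
    rw [sq_abs, one_div, inv_mul_eq_div, le_div_iff₀ (by positivity)]
    refine le_of_eq ?_
    field_simp
  refine h1.trans (mul_le_mul_of_nonneg_right ?_ (Finset.sum_nonneg fun x _ => by positivity))
  obtain ⟨M, hM⟩ : ∃ M : ℕ, s ⊆ insert 0 (bandSteps M) := by
    refine ⟨s.sup Int.natAbs, fun x hx => ?_⟩
    have := Finset.le_sup (f := Int.natAbs) hx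
    simp only [Finset.mem_insert, mem_bandSteps_iff]
    omega
  have h2 : ∑ x ∈ s, w x ≤ ∑ x ∈ insert 0 (bandSteps M), w x :=
    Finset.sum_le_sum_of_subset_of_nonneg hM fun x _ _ => hw0 x
  rw [Finset.sum_insert (by simp [mem_bandSteps]), sum_bandSteps] at h2
  -- Comparison with a telescoping sum, as (L + k - 1)(L + k) ≤ 2(L² + k²).
  have h3 : ∀ k ∈ Finset.Icc 1 M, w (k : ℤ) + w (-(k : ℤ)) ≤
      4 * L ^ 2 * (1 / (L + k - 1) - 1 / (L + k)) := by
    intro k hk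
    have hk1 : (1 : ℝ) ≤ k := by exact_mod_cast (Finset.mem_Icc.1 hk).1
    simp only [hw]
    push_cast
    rw [neg_sq, ← two_mul, div_sub_div _ _ (by nlinarith) (by nlinarith)]
    have e1 : 2 * (1 / (1 + (k : ℝ) ^ 2 / L ^ 2)) = 2 * L ^ 2 / (L ^ 2 + k ^ 2) := by
      field_simp
    have e2 : 4 * (L : ℝ) ^ 2 * ((1 * (L + k) - (L + k - 1) * 1) / ((L + k - 1) * (L + k))) =
        4 * L ^ 2 / ((L + k - 1) * (L + k)) := by ring
    rw [e1, e2, div_le_div_iff₀ (by positivity) (mul_pos (by linarith) (by linarith))]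
    have : (L + k - 1 : ℝ) * (L + k) ≤ 2 * (L ^ 2 + k ^ 2) := by nlinarith [sq_nonneg (L - k : ℝ)]
    nlinarith [mul_le_mul_of_nonneg_left this (by positivity : (0 : ℝ) ≤ 2 * L ^ 2)]
  have h4 : ∀ M : ℕ, ∑ k ∈ Finset.Icc 1 M, (1 / ((L : ℝ) + k - 1) - 1 / (L + k)) =
      1 / L - 1 / (L + M) := by
    intro M
    induction M with
    | zero => simp
    | succ M ih =>
      rw [Finset.sum_Icc_succ_top (by omega), ih]
      push_cast
      rw [show (L : ℝ) + (M + 1) - 1 = L + M by ring]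
      ring
  have h5 : ∑ k ∈ Finset.Icc 1 M, (w (k : ℤ) + w (-(k : ℤ))) ≤ 4 * L := by
    refine (Finset.sum_le_sum h3).trans ?_
    rw [← Finset.mul_sum, h4]
    have : 4 * (L : ℝ) ^ 2 * (1 / L) = 4 * L := by field_simp
    have : 0 ≤ 4 * (L : ℝ) ^ 2 * (1 / (L + M)) := by positivity
    linarith
  have h6 : w 0 = 1 := by simp [hw]
  have h7 : (1 : ℝ) ≤ L := by exact_mod_cast hL
  linarith

end

/-! ### The ℓ¹ norm of the increments as convolution kernels. -/

noncomputable section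

open Polynomial

lemma bandSymbol_eq_trigSum {W : ℕ} (hW : 0 < W) (θ : ℝ) :
    trigSum (bandSteps W) (fun _ => 1 / (2 * W)) θ = (bandSymbol W θ : ℂ) := by
  have hW0 : (W : ℂ) ≠ 0 := by exact_mod_cast hW.ne'
  rw [trigSum, sum_bandSteps, bandSymbol]
  push_cast
  rw [Finset.sum_div]
  refine Finset.sum_congr rfl fun k _ => ?_
  rw [Complex.cos]
  field_simp

/-- Parseval for the uniform step distribution. Away from θ = 0 this supplies the factor 1/W that a
pointwise bound on the symbol would lose. -/
lemma integral_bandSymbol_sq {W : ℕ} (hW : 0 < W) :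
    ∫ θ in (-Real.pi)..Real.pi, bandSymbol W θ ^ 2 = Real.pi / W := by
  have hW0 : (W : ℝ) ≠ 0 := by exact_mod_cast hW.ne'
  have h := integral_norm_sq_trigSum (bandSteps W) (fun _ => 1 / (2 * W))
  simp_rw [bandSymbol_eq_trigSum hW, Complex.norm_real, Real.norm_eq_abs, sq_abs] at h
  rw [h, Finset.sum_const, card_bandSteps]
  simp
  field_simp

set_option maxHeartbeats 1000000 in
/-- The coefficients of `nbDiff β n` at the symbol of the walk have `ℓ¹` norm `O(1 / n)`,
uniformly in `W`. -/
lemma exists_sum_abs_nbDiff_le : ∃ K : ℝ, 0 < K ∧ ∀ W : ℕ, 2 ≤ W → ∀ n : ℕ, 3 ≤ n →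
    ∀ (s : Finset ℤ) (c : ℤ → ℝ), (∀ θ : ℝ, trigSum s c θ =
      (((nbDiff (1 / (2 * W - 1)) n).eval (bandSymbol W θ) : ℝ) : ℂ)) →
    ∑ x ∈ s, |c x| ≤ K / n := by
  obtain ⟨K₁, hK₁, hexp⟩ := exists_nbDiff_exp_bound
  obtain ⟨K₂, hK₂, hsmall⟩ := exists_nbDiff_small_bound
  set A : ℝ := 3 * K₁ * Real.sqrt (18 * Real.pi ^ 3) + 18 * K₂ * Real.pi with hA
  have hA0 : 0 < A := by positivity
  refine ⟨Real.sqrt (10 * A), by positivity, fun W hW n hn s c hc => ?_⟩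
  have hW0 : 0 < W := by omega
  have hWr : (2 : ℝ) ≤ W := by exact_mod_cast hW
  have hnr : (3 : ℝ) ≤ n := by exact_mod_cast hn
  have hn0 : (0 : ℝ) < n := by linarith
  set β : ℝ := 1 / (2 * W - 1) with hβ
  have hβ0 : 0 < β := by rw [hβ]; exact one_div_pos.2 (by linarith)
  have hβ3 : β ≤ 1 / 3 := one_div_le_one_div_of_le (by norm_num) (by linarith)
  have hβW : β ≤ 1 / W := one_div_le_one_div_of_le (by linarith) (by linarith)
  set F : ℝ → ℝ := fun p => (nbDiff β n).eval p with hF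
  set F' : ℝ → ℝ := fun p => (derivative (nbDiff β n)).eval p with hF'
  set p := bandSymbol W with hp
  set p' : ℝ → ℝ := fun θ => (∑ k ∈ Finset.Icc 1 W, -(k * Real.sin (k * θ))) / W with hp'
  -- L = W⌈√n⌉ is the diffusive scale after n steps. The integral below is O(n^{-5/2}/W), so
  -- multiplication by L leaves O(1/n²), the square of the desired bound.
  set r : ℕ := ⌈Real.sqrt n⌉₊ with hr
  have hsq1 : (1 : ℝ) ≤ Real.sqrt n := Real.one_le_sqrt.2 (by linarith)
  have hr1 : Real.sqrt n ≤ r := Nat.le_ceil _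
  have hr2 : (r : ℝ) ≤ 2 * Real.sqrt n := by
    have := Nat.ceil_lt_add_one (Real.sqrt_nonneg n)
    linarith
  have hr0 : (0 : ℝ) < r := by linarith
  have hrn : (n : ℝ) ≤ r ^ 2 := by
    rw [← Real.sq_sqrt hn0.le]; gcongr
  set L : ℕ := W * r with hL
  have hL1 : 1 ≤ L := by
    have : 0 < r := by exact_mod_cast hr0
    exact Nat.mul_pos hW0 this
  have hLr : (L : ℝ) = W * r := by rw [hL]; push_cast; rfl
  have hcont : Continuous p := continuous_bandSymbol
  -- Parseval for the coefficients and for their first moments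
  have hP1 : 2 * Real.pi * ∑ x ∈ s, c x ^ 2 = ∫ θ in (-Real.pi)..Real.pi, F (p θ) ^ 2 := by
    rw [← integral_norm_sq_trigSum]
    refine intervalIntegral.integral_congr fun θ _ => ?_
    simp only [hc, Complex.norm_real, Real.norm_eq_abs, sq_abs]
    rfl
  have hderiv : ∀ θ, ‖trigSum s (fun x => x * c x) θ‖ ^ 2 = (F' (p θ) * p' θ) ^ 2 := by
    intro θ
    have h1 := hasDerivAt_trigSum s c θ
    have h2 : HasDerivAt (fun θ => ((F (p θ) : ℝ) : ℂ)) ((F' (p θ) * p' θ : ℝ) : ℂ) θ :=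
      (((nbDiff β n).hasDerivAt (p θ)).comp θ (hasDerivAt_bandSymbol θ)).ofReal_comp
    rw [show trigSum s c = fun θ => ((F (p θ) : ℝ) : ℂ) from funext hc] at h1
    have h3 := congrArg norm (h1.unique h2)
    rw [norm_mul, Complex.norm_I, one_mul, Complex.norm_real, Real.norm_eq_abs] at h3
    rw [h3, sq_abs]
  have hP2 : 2 * Real.pi * ∑ x ∈ s, (x * c x) ^ 2 =
      ∫ θ in (-Real.pi)..Real.pi, (F' (p θ) * p' θ) ^ 2 := by
    have := integral_norm_sq_trigSum s (fun x => x * c x)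
    rw [← this]
    exact intervalIntegral.integral_congr fun θ _ => hderiv θ
  have hFc : Continuous fun θ => F (p θ) ^ 2 := by
    simp only [hF]; exact ((nbDiff β n).continuous.comp hcont).pow 2
  have hF'c : Continuous fun θ => (F' (p θ) * p' θ) ^ 2 := by
    have h1 : Continuous p' := by simp only [hp']; fun_prop
    exact (((derivative (nbDiff β n)).continuous.comp hcont).mul h1).pow 2
  -- pointwise bound of the integrand
  set b : ℝ := n * W ^ 2 / (18 * Real.pi ^ 2) with hb
  have hb0 : 0 < b := by positivity
  have hpt : ∀ θ ∈ Set.Icc (-Real.pi) Real.pi, F (p θ) ^ 2 + (F' (p θ) * p' θ) ^ 2 / L ^ 2 ≤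
      3 * K₁ / n ^ 2 * Real.exp (-b * θ ^ 2) + 6 * K₂ / n ^ 3 * (p θ ^ 2 + β ^ 2) := by
    intro θ hθ
    have hp1 : p θ ≤ 1 := bandSymbol_le_one hW0 θ
    have hp6 : -(5 / 6) ≤ p θ := neg_five_sixths_le_bandSymbol hW θ
    have hθπ : |θ| ≤ Real.pi := abs_le.2 hθ
    have h1 : (F' (p θ) * p' θ) ^ 2 / L ^ 2 ≤ 2 * (1 - p θ) * F' (p θ) ^ 2 / n := by
      have h2 := deriv_bandSymbol_sq_le hW0 θ
      change p' θ ^ 2 ≤ 2 * W ^ 2 * (1 - p θ) at h2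
      rw [div_le_div_iff₀ (by positivity) hn0, hLr]
      calc (F' (p θ) * p' θ) ^ 2 * n = F' (p θ) ^ 2 * n * p' θ ^ 2 := by ring
        _ ≤ F' (p θ) ^ 2 * r ^ 2 * (2 * W ^ 2 * (1 - p θ)) := by gcongr
        _ = _ := by ring
    have h0 : 0 ≤ 3 * K₁ / n ^ 2 * Real.exp (-b * θ ^ 2) := by positivity
    have h0' : 0 ≤ 6 * K₂ / n ^ 3 * (p θ ^ 2 + β ^ 2) := by positivity
    -- For |θ| ≤ π/W one has 1 - p ≳ W²θ² and obtains a Gaussian of width 1/(W√n). Beyond, p ≤ 1/2,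
    -- and the factor (|p| + β)² is integrated by means of ∫ p² = π/W.
    rcases le_total |θ| (Real.pi / W) with hcase | hcase
    · obtain ⟨e1, e2⟩ := hexp β (p θ) hβ0 hβ3 hp6 hp1 n
      have e3 : Real.exp (-(n * (1 - p θ) / 12)) ≤ Real.exp (-b * θ ^ 2) := by
        rw [Real.exp_le_exp]
        have h4 := one_sub_bandSymbol_ge hW0 hcase
        have h5 := mul_le_mul_of_nonneg_left h4 (by positivity : (0 : ℝ) ≤ n / 12)
        have h6 : (n : ℝ) / 12 * (2 / (3 * Real.pi ^ 2) * (W ^ 2 * θ ^ 2)) = b * θ ^ 2 := by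
          rw [hb]; field_simp; ring
        have h7 : (n : ℝ) / 12 * (1 - bandSymbol W θ) = n * (1 - p θ) / 12 := by rw [hp]; ring
        linarith
      have e4 := mul_le_mul_of_nonneg_left e3 hK₁.le
      have h8 : F (p θ) ^ 2 ≤ K₁ / n ^ 2 * Real.exp (-b * θ ^ 2) := by
        rw [div_mul_eq_mul_div, le_div_iff₀ (by positivity)]
        linarith
      have h9 : 2 * (1 - p θ) * F' (p θ) ^ 2 / n ≤ 2 * K₁ / n ^ 2 * Real.exp (-b * θ ^ 2) := by
        rw [div_mul_eq_mul_div, div_le_div_iff₀ hn0 (by positivity)]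
        calc 2 * (1 - p θ) * F' (p θ) ^ 2 * n ^ 2 = 2 * (n * (1 - p θ) * F' (p θ) ^ 2) * n := by
              ring
          _ ≤ 2 * (K₁ * Real.exp (-b * θ ^ 2)) * n := by
              exact mul_le_mul_of_nonneg_right (mul_le_mul_of_nonneg_left (e2.trans e4) two_pos.le)
                hn0.le
          _ = _ := by ring
      have h10 : 3 * K₁ / n ^ 2 * Real.exp (-b * θ ^ 2) = K₁ / n ^ 2 * Real.exp (-b * θ ^ 2) +
          2 * K₁ / n ^ 2 * Real.exp (-b * θ ^ 2) := by ring
      linarith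
    · have hph := bandSymbol_le_half hW0 hcase hθπ
      obtain ⟨e1, e2⟩ := hsmall β (p θ) hβ0 hβ3 hp6 hph n hn
      have e3 : (|p θ| + β) ^ 2 ≤ 2 * (p θ ^ 2 + β ^ 2) := by
        rw [← sq_abs (p θ)]
        nlinarith [sq_nonneg (|p θ| - β)]
      have e4 := mul_le_mul_of_nonneg_left e3 hK₂.le
      have h8 : F (p θ) ^ 2 ≤ 2 * K₂ / n ^ 3 * (p θ ^ 2 + β ^ 2) := by
        rw [div_mul_eq_mul_div, le_div_iff₀ (by positivity)]
        linarith
      have h9 : 2 * (1 - p θ) * F' (p θ) ^ 2 / n ≤ 4 * K₂ / n ^ 3 * (p θ ^ 2 + β ^ 2) := by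
        rw [div_mul_eq_mul_div, div_le_div_iff₀ hn0 (by positivity)]
        calc 2 * (1 - p θ) * F' (p θ) ^ 2 * n ^ 3 =
              2 * (n ^ 2 * (1 - p θ) * F' (p θ) ^ 2) * n := by ring
          _ ≤ 2 * (K₂ * (2 * (p θ ^ 2 + β ^ 2))) * n := by
              exact mul_le_mul_of_nonneg_right (mul_le_mul_of_nonneg_left (e2.trans e4) two_pos.le)
                hn0.le
          _ = _ := by ring
      have h10 : 6 * K₂ / n ^ 3 * (p θ ^ 2 + β ^ 2) = 2 * K₂ / n ^ 3 * (p θ ^ 2 + β ^ 2) +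
          4 * K₂ / n ^ 3 * (p θ ^ 2 + β ^ 2) := by ring
      linarith
  -- integration
  have hpi : -Real.pi ≤ Real.pi := by linarith [Real.pi_pos]
  have hgauss : ∫ θ in (-Real.pi)..Real.pi, Real.exp (-b * θ ^ 2) ≤
      Real.sqrt (18 * Real.pi ^ 3) / (W * Real.sqrt n) := by
    have h1 : ∫ θ in (-Real.pi)..Real.pi, Real.exp (-b * θ ^ 2) ≤
        ∫ θ : ℝ, Real.exp (-b * θ ^ 2) := by
      rw [intervalIntegral.integral_of_le hpi]
      exact setIntegral_le_integral (integrable_exp_neg_mul_sq hb0)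
        (Filter.Eventually.of_forall fun θ => (Real.exp_pos _).le)
    refine h1.trans (le_of_eq ?_)
    rw [integral_gaussian]
    rw [show Real.pi / b = 18 * Real.pi ^ 3 / (W ^ 2 * n) by rw [hb]; field_simp,
      Real.sqrt_div' _ (by positivity), Real.sqrt_mul' _ hn0.le, Real.sqrt_sq (by linarith)]
  have hintg : ∫ θ in (-Real.pi)..Real.pi, (F (p θ) ^ 2 + (F' (p θ) * p' θ) ^ 2 / L ^ 2) ≤
      A / (n ^ 2 * (W * Real.sqrt n)) := by
    have h1 : ∫ θ in (-Real.pi)..Real.pi, (F (p θ) ^ 2 + (F' (p θ) * p' θ) ^ 2 / L ^ 2) ≤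
        ∫ θ in (-Real.pi)..Real.pi, (3 * K₁ / n ^ 2 * Real.exp (-b * θ ^ 2) +
          6 * K₂ / n ^ 3 * (p θ ^ 2 + β ^ 2)) := by
      refine intervalIntegral.integral_mono_on hpi ?_ ?_ hpt
      · exact (hFc.add (hF'c.div_const _)).intervalIntegrable _ _
      · exact Continuous.intervalIntegrable (by fun_prop) _ _
    refine h1.trans ?_
    rw [intervalIntegral.integral_add, intervalIntegral.integral_const_mul,
      intervalIntegral.integral_const_mul, intervalIntegral.integral_add,
      integral_bandSymbol_sq hW0, intervalIntegral.integral_const]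
    rotate_left
    · exact (hcont.pow 2).intervalIntegrable _ _
    · exact continuous_const.intervalIntegrable _ _
    · exact Continuous.intervalIntegrable (by fun_prop) _ _
    · exact Continuous.intervalIntegrable (by fun_prop) _ _
    have h2 : Real.pi / W + (Real.pi - -Real.pi) • β ^ 2 ≤ 3 * Real.pi / W := by
      have h3 : β ^ 2 ≤ 1 / W := by
        have : β ^ 2 ≤ β * 1 := by rw [sq]; gcongr; linarith
        linarith
      rw [smul_eq_mul]
      have h4 := mul_le_mul_of_nonneg_left h3 (by positivity : 0 ≤ 2 * Real.pi)
      have h5 : 3 * Real.pi / W = Real.pi / W + 2 * Real.pi * (1 / W) := by ring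
      linarith
    have h3 : 6 * K₂ / (n : ℝ) ^ 3 * (3 * Real.pi / W) ≤
        18 * K₂ * Real.pi / (n ^ 2 * (W * Real.sqrt n)) := by
      rw [div_mul_div_comm, show 6 * K₂ * (3 * Real.pi) = 18 * K₂ * Real.pi by ring]
      refine div_le_div_of_nonneg_left (by positivity) (by positivity) ?_
      have : Real.sqrt n ≤ n := by
        rw [Real.sqrt_le_iff]; exact ⟨hn0.le, by nlinarith⟩
      calc (n : ℝ) ^ 2 * (W * Real.sqrt n) ≤ n ^ 2 * (W * n) := by gcongr
        _ = _ := by ring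
    calc _ ≤ 3 * K₁ / n ^ 2 * (Real.sqrt (18 * Real.pi ^ 3) / (W * Real.sqrt n)) +
          6 * K₂ / n ^ 3 * (3 * Real.pi / W) := by
          refine add_le_add ?_ ?_
          · exact mul_le_mul_of_nonneg_left hgauss (by positivity)
          · exact mul_le_mul_of_nonneg_left h2 (by positivity)
      _ ≤ 3 * K₁ * Real.sqrt (18 * Real.pi ^ 3) / (n ^ 2 * (W * Real.sqrt n)) +
          18 * K₂ * Real.pi / (n ^ 2 * (W * Real.sqrt n)) := by
          rw [div_mul_div_comm]
          gcongr
      _ = _ := by rw [hA]; ring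
  have hsum : 2 * Real.pi * ∑ x ∈ s, (c x ^ 2 + (x * c x) ^ 2 / L ^ 2) =
      ∫ θ in (-Real.pi)..Real.pi, (F (p θ) ^ 2 + (F' (p θ) * p' θ) ^ 2 / L ^ 2) := by
    rw [intervalIntegral.integral_add (hFc.intervalIntegrable _ _)
      ((hF'c.div_const _).intervalIntegrable _ _), intervalIntegral.integral_div, ← hP1, ← hP2,
      Finset.sum_add_distrib, ← Finset.sum_div]
    ring
  have hfin : (∑ x ∈ s, |c x|) ^ 2 ≤ 10 * A / n ^ 2 := by
    refine (sum_abs_sq_le s c hL1).trans ?_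
    have h1 : ∑ x ∈ s, (c x ^ 2 + (x * c x) ^ 2 / L ^ 2) ≤ A / (n ^ 2 * (W * Real.sqrt n)) := by
      have h0 : 0 ≤ ∑ x ∈ s, (c x ^ 2 + (x * c x) ^ 2 / L ^ 2) :=
        Finset.sum_nonneg fun x _ => by positivity
      have : (1 : ℝ) ≤ 2 * Real.pi := by linarith [Real.pi_gt_three]
      nlinarith [le_mul_of_one_le_left h0 this]
    have hs0 : 0 < Real.sqrt n := by linarith
    calc 5 * (L : ℝ) * ∑ x ∈ s, (c x ^ 2 + (x * c x) ^ 2 / L ^ 2)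
        ≤ 5 * (W * (2 * Real.sqrt n)) * (A / (n ^ 2 * (W * Real.sqrt n))) := by
          rw [hLr] at h1 ⊢; gcongr
      _ = _ := by field_simp; ring
  have h0 : 0 ≤ ∑ x ∈ s, |c x| := Finset.sum_nonneg fun x _ => abs_nonneg _
  rw [← abs_of_nonneg h0, ← Real.sqrt_sq_eq_abs]
  refine (Real.sqrt_le_sqrt hfin).trans (le_of_eq ?_)
  rw [Real.sqrt_div' _ (by positivity), Real.sqrt_sq hn0.le]

end

/-! ### The transition operator of the non-backtracking walk and the decay of its increments. -/

noncomputable section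

open Polynomial

section algebra

variable {A : Type*} [Ring A] [Algebra ℝ A]

/-- The powers of `(1 + β) X - β B` in terms of the polynomials `nbPoly` in `P`, when
`X² = P X`, `X B X = X`, `B² = 1` and `P` commutes with `X` and `B`. -/
lemma pow_nb_eq {P X B : A} (hXX : X * X = P * X) (hXBX : X * B * X = X) (hBB : B * B = 1)
    (hPX : Commute P X) (hPB : Commute P B) (β : ℝ) (n : ℕ) :
    ((1 + β) • X - β • B) ^ (n + 2) - β ^ 2 • ((1 + β) • X - β • B) ^ n =
      (1 + β) • (aeval P (nbPoly β (n + 2)) * X -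
        β • (aeval P (nbPoly β (n + 1)) * (B * X + X * B)) +
        β ^ 2 • (aeval P (nbPoly β n) * (B * X * B))) := by
  have hg : ∀ Z : A, Commute P Z → ∀ f : ℝ[X], Z * aeval P f = aeval P f * Z := fun Z hZ f =>
    ((Polynomial.aeval_eq_sum_range (x := P) (p := f)) ▸
      (Commute.sum_right _ _ _ fun i _ => ((hZ.symm.pow_right i).smul_right _))).eq
  have hgX := hg X hPX
  have hgB := hg B hPB
  have hrec : ∀ n, (1 + β) • (aeval P (nbPoly β (n + 1)) * P) =
      aeval P (nbPoly β (n + 2)) + β • aeval P (nbPoly β n) := by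
    intro n
    rw [nbPoly_succ_succ, map_sub, map_mul, map_mul, map_mul, aeval_C, aeval_C, aeval_X,
      mul_assoc, ← Algebra.smul_def, ← Algebra.smul_def, sub_add_cancel]
    rw [hg P (Commute.refl P)]
  -- Every word in X and B containing an X reduces to X, BX, XB or BXB with a coefficient in ℝ[P].
  -- The only other word in the n-th power is (-βB)ⁿ; subtracting β² times the n-th power from the
  -- (n+2)-nd cancels it.
  induction n with
  | zero =>
    have h2 : aeval P (nbPoly β 2) = (1 + β) • P := by
      simpa [nbPoly] using (hrec 0).symm
    rw [zero_add, h2]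
    simp only [nbPoly, map_zero, zero_mul, smul_zero, add_zero, map_one, one_mul,
      pow_zero]
    rw [sq, mul_sub, sub_mul, sub_mul]
    simp only [smul_mul_assoc, mul_smul_comm, hXX, hBB]
    module
  | succ n ih =>
    have e : ((1 + β) • X - β • B) ^ (n + 1 + 2) - β ^ 2 • ((1 + β) • X - β • B) ^ (n + 1) =
        ((1 + β) • X - β • B) * (((1 + β) • X - β • B) ^ (n + 2) -
          β ^ 2 • ((1 + β) • X - β • B) ^ n) := by
      rw [mul_sub, mul_smul_comm, ← pow_succ', ← pow_succ']
    rw [e, ih]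
    set a := aeval P (nbPoly β (n + 2))
    set b := aeval P (nbPoly β (n + 1))
    set c := aeval P (nbPoly β n)
    have ha : (1 + β) • (a * P) = aeval P (nbPoly β (n + 3)) + β • b := hrec (n + 1)
    have hb : (1 + β) • (b * P) = a + β • c := hrec n
    have hBBX : ∀ z : A, B * (B * z) = z := fun z => by rw [← mul_assoc, hBB, one_mul]
    have hXB' : X * (B * X) = X := by rw [← mul_assoc]; exact hXBX
    have hXBXB : X * (B * (X * B)) = X * B := by rw [← mul_assoc, ← mul_assoc, hXBX]
    have hXX' : ∀ z : A, X * (X * z) = P * (X * z) := fun z => by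
      rw [← mul_assoc, hXX, mul_assoc]
    have xa : ∀ z : A, X * (a * z) = a * (X * z) := fun z => by
      rw [← mul_assoc, hgX, mul_assoc]
    have xb : ∀ z : A, X * (b * z) = b * (X * z) := fun z => by
      rw [← mul_assoc, hgX, mul_assoc]
    have xc : ∀ z : A, X * (c * z) = c * (X * z) := fun z => by
      rw [← mul_assoc, hgX, mul_assoc]
    have ba : ∀ z : A, B * (a * z) = a * (B * z) := fun z => by
      rw [← mul_assoc, hgB, mul_assoc]
    have bb : ∀ z : A, B * (b * z) = b * (B * z) := fun z => by
      rw [← mul_assoc, hgB, mul_assoc]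
    have bc : ∀ z : A, B * (c * z) = c * (B * z) := fun z => by
      rw [← mul_assoc, hgB, mul_assoc]
    have h1 := congrArg (fun z => z * X) ha
    have h2 := congrArg (fun z => z * (X * B)) hb
    simp only [smul_mul_assoc, add_mul, mul_assoc] at h1 h2
    rw [mul_smul_comm]
    congr 1
    simp only [sub_mul, mul_sub, mul_add, smul_mul_assoc, mul_smul_comm, mul_assoc, xa, xb, xc,
      ba, bb, bc, hXX, hXX', hXB', hXBXB, hBBX]
    linear_combination (norm := module) h1 - β • h2

end algebra

/-- Functions of the position and the last step of a walk. -/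
abbrev StepFun := ℤ → ℤ → ℝ

/-- `A` is bounded by `c` in the sup norm over all positions and all steps in `bandSteps W`. -/
def OpLe (W : ℕ) (A : Module.End ℝ StepFun) (c : ℝ) : Prop :=
  ∀ (f : StepFun) (M : ℝ), (∀ x, ∀ s ∈ bandSteps W, |f x s| ≤ M) →
    ∀ x, ∀ s ∈ bandSteps W, |A f x s| ≤ c * M

namespace OpLe

variable {W : ℕ} {A B : Module.End ℝ StepFun} {a b : ℝ}

lemma mono (h : OpLe W A a) (hab : a ≤ b) : OpLe W A b := fun f M hf x s hs =>
  (h f M hf x s hs).trans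
    (mul_le_mul_of_nonneg_right hab ((abs_nonneg _).trans (hf x s hs)))

lemma add (hA : OpLe W A a) (hB : OpLe W B b) : OpLe W (A + B) (a + b) := fun f M hf x s hs => by
  rw [add_mul]
  exact (abs_add_le _ _).trans (add_le_add (hA f M hf x s hs) (hB f M hf x s hs))

lemma smul (hA : OpLe W A a) (c : ℝ) : OpLe W (c • A) (|c| * a) := fun f M hf x s hs => by
  rw [mul_assoc]
  change |c * A f x s| ≤ _
  rw [abs_mul]
  exact mul_le_mul_of_nonneg_left (hA f M hf x s hs) (abs_nonneg _)

lemma sub (hA : OpLe W A a) (hB : OpLe W B b) : OpLe W (A - B) (a + b) := fun f M hf x s hs => by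
  rw [add_mul]
  exact (abs_sub _ _).trans (add_le_add (hA f M hf x s hs) (hB f M hf x s hs))

lemma mul (hA : OpLe W A a) (hB : OpLe W B b) : OpLe W (A * B) (a * b) := fun f M hf x s hs => by
  rw [mul_assoc]
  exact hA (B f) (b * M) (hB f M hf) x s hs

lemma one : OpLe W 1 1 := fun f M hf x s hs => by
  rw [one_mul]; exact hf x s hs

lemma zero : OpLe W 0 0 := fun f M hf x s hs => by
  simp

lemma sum {ι : Type*} (s : Finset ι) {A : ι → Module.End ℝ StepFun} {a : ι → ℝ}
    (h : ∀ i ∈ s, OpLe W (A i) (a i)) : OpLe W (∑ i ∈ s, A i) (∑ i ∈ s, a i) := by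
  classical
  induction s using Finset.induction_on with
  | empty => simpa using zero
  | insert i s hi ih =>
    rw [Finset.sum_insert hi, Finset.sum_insert hi]
    exact (h i (Finset.mem_insert_self _ _)).add
      (ih fun j hj => h j (Finset.mem_insert_of_mem hj))

end OpLe

/-- Translation of the position. -/
def shiftOp (d : ℤ) : Module.End ℝ StepFun where
  toFun f x s := f (x + d) s
  map_add' _ _ := rfl
  map_smul' _ _ := rfl

/-- `shiftOp` as a monoid homomorphism. -/
def shiftHom : Multiplicative ℤ →* Module.End ℝ StepFun where
  toFun d := shiftOp d.toAdd
  map_one' := by ext f x s; simp [shiftOp]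
  map_mul' a b := by ext f x s; simp [shiftOp, add_assoc]

/-- Average over all continuations by one step. -/
def avgOp (W : ℕ) : Module.End ℝ StepFun where
  toFun f x _ := (1 / (2 * W : ℝ)) * ∑ t ∈ bandSteps W, f (x + t) t
  map_add' f g := by funext x s; simp [Finset.sum_add_distrib, mul_add]
  map_smul' c f := by funext x s; simp [Finset.mul_sum, mul_left_comm]

/-- Reversal of the last step. -/
def revOp : Module.End ℝ StepFun where
  toFun f x s := f (x - s) (-s)
  map_add' _ _ := rfl
  map_smul' _ _ := rfl

/-- The transition operator of the simple random walk on `ℤ(W)`. -/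
def walkOp (W : ℕ) : Module.End ℝ StepFun := (1 / (2 * W : ℝ)) • ∑ t ∈ bandSteps W, shiftOp t

/-- The transition operator of the non-backtracking walk. -/
def nbOp (W : ℕ) : Module.End ℝ StepFun :=
  (1 + 1 / (2 * W - 1 : ℝ)) • avgOp W - (1 / (2 * W - 1 : ℝ)) • revOp

section operators

variable {W : ℕ}

lemma walkOp_apply (f : StepFun) (x s : ℤ) :
    walkOp W f x s = (1 / (2 * W : ℝ)) * ∑ t ∈ bandSteps W, f (x + t) s := by
  simp [walkOp, shiftOp, LinearMap.sum_apply, Finset.sum_apply]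

lemma avgOp_apply (f : StepFun) (x s : ℤ) :
    avgOp W f x s = (1 / (2 * W : ℝ)) * ∑ t ∈ bandSteps W, f (x + t) t := rfl

lemma revOp_apply (f : StepFun) (x s : ℤ) : revOp f x s = f (x - s) (-s) := rfl

lemma avgOp_mul_avgOp : avgOp W * avgOp W = walkOp W * avgOp W := by
  refine LinearMap.ext fun f => ?_
  funext x s
  rw [Module.End.mul_apply, Module.End.mul_apply, walkOp_apply, avgOp_apply]
  rfl

lemma revOp_mul_revOp : revOp * revOp = 1 := by
  refine LinearMap.ext fun f => ?_
  funext x s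
  rw [Module.End.mul_apply, revOp_apply, revOp_apply]
  simp

/-- Reversing a step returns to the starting point, and the average of the next step does not depend
on how that point was reached. -/
lemma avgOp_mul_revOp_mul_avgOp (hW : 0 < W) : avgOp W * revOp * avgOp W = avgOp W := by
  have hW0 : (W : ℝ) ≠ 0 := by positivity
  refine LinearMap.ext fun f => ?_
  funext x s
  rw [Module.End.mul_apply, Module.End.mul_apply, avgOp_apply]
  simp only [revOp_apply, avgOp_apply, add_sub_cancel_right, Finset.sum_const, card_bandSteps,
    nsmul_eq_mul]
  push_cast
  field_simp

lemma commute_walkOp_avgOp : Commute (walkOp W) (avgOp W) := by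
  refine LinearMap.ext fun f => ?_
  funext x s
  rw [Module.End.mul_apply, Module.End.mul_apply, walkOp_apply]
  simp only [avgOp_apply, walkOp_apply, ← Finset.mul_sum]
  congr 2
  rw [Finset.sum_comm]
  refine Finset.sum_congr rfl fun t _ => Finset.sum_congr rfl fun r _ => ?_
  rw [add_right_comm]

lemma commute_walkOp_revOp : Commute (walkOp W) revOp := by
  refine LinearMap.ext fun f => ?_
  funext x s
  rw [Module.End.mul_apply, Module.End.mul_apply, walkOp_apply]
  simp only [revOp_apply, walkOp_apply]
  congr 1
  refine Finset.sum_congr rfl fun t _ => ?_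
  rw [add_sub_right_comm]

lemma opLe_shiftOp (d : ℤ) : OpLe W (shiftOp d) 1 := fun f M hf x s hs => by
  rw [one_mul]; exact hf _ s hs

lemma opLe_revOp : OpLe W revOp 1 := fun f M hf x s hs => by
  rw [one_mul]; exact hf _ _ (neg_mem_bandSteps.2 hs)

lemma opLe_avgOp (hW : 0 < W) : OpLe W (avgOp W) 1 := fun f M hf x s _ => by
  have hW0 : (0 : ℝ) < W := by positivity
  rw [avgOp_apply, abs_mul, abs_of_pos (by positivity), one_mul]
  have h : |∑ t ∈ bandSteps W, f (x + t) t| ≤ 2 * W * M := by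
    refine (Finset.abs_sum_le_sum_abs _ _).trans
      ((Finset.sum_le_sum fun t ht => hf (x + t) t ht).trans ?_)
    simp [card_bandSteps]
  calc 1 / (2 * W : ℝ) * _ ≤ 1 / (2 * W : ℝ) * (2 * W * M) := by gcongr
    _ = M := by field_simp

/-- On admissible steps the operator `nbOp` averages over the non-backtracking continuations. -/
lemma nbOp_apply (hW : 0 < W) (f : StepFun) (x : ℤ) {s : ℤ} (hs : s ∈ bandSteps W) :
    nbOp W f x s = (1 / (2 * W - 1 : ℝ)) * ∑ t ∈ (bandSteps W).erase (-s), f (x + t) t := by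
  have hW1 : (1 : ℝ) ≤ W := by exact_mod_cast hW
  have h1 : (2 * W - 1 : ℝ) ≠ 0 := by linarith
  have h2 : (2 * W : ℝ) ≠ 0 := by linarith
  have e : nbOp W f x s = (1 + 1 / (2 * W - 1 : ℝ)) * avgOp W f x s -
      (1 / (2 * W - 1 : ℝ)) * revOp f x s := rfl
  rw [e, avgOp_apply, revOp_apply,
    ← Finset.add_sum_erase _ (fun t => f (x + t) t) (neg_mem_bandSteps.2 hs), ← sub_eq_add_neg]
  field_simp
  ring

lemma opLe_nbOp (hW : 0 < W) : OpLe W (nbOp W) 1 := fun f M hf x s hs => by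
  have hW1 : (1 : ℝ) ≤ W := by exact_mod_cast hW
  have h1 : (0 : ℝ) < 2 * W - 1 := by linarith
  rw [nbOp_apply hW f x hs, abs_mul, abs_of_pos (one_div_pos.2 h1), one_mul]
  have h : |∑ t ∈ (bandSteps W).erase (-s), f (x + t) t| ≤ (2 * W - 1) * M := by
    refine (Finset.abs_sum_le_sum_abs _ _).trans
      ((Finset.sum_le_sum fun t ht => hf (x + t) t (Finset.mem_of_mem_erase ht)).trans ?_)
    rw [Finset.sum_const, Finset.card_erase_of_mem (neg_mem_bandSteps.2 hs), card_bandSteps,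
      nsmul_eq_mul, Nat.cast_sub (by omega)]
    simp
  calc 1 / (2 * W - 1 : ℝ) * _ ≤ 1 / (2 * W - 1 : ℝ) * ((2 * W - 1) * M) := by gcongr
    _ = M := by field_simp

lemma opLe_nbOp_pow (hW : 0 < W) (n : ℕ) : OpLe W (nbOp W ^ n) 1 := by
  induction n with
  | zero => simpa using OpLe.one
  | succ n ih =>
    rw [pow_succ]
    simpa using ih.mul (opLe_nbOp hW)

/-- The step distribution as an element of the group algebra of `ℤ`. -/
def bandElt (W : ℕ) : AddMonoidAlgebra ℝ ℤ :=
  (1 / (2 * W : ℝ)) • ∑ t ∈ bandSteps W, AddMonoidAlgebra.single t 1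

/-- The character `x ↦ exp (i x θ)` of `ℤ`. -/
def charHom (θ : ℝ) : Multiplicative ℤ →* ℂ where
  toFun x := Complex.exp (x.toAdd * θ * Complex.I)
  map_one' := by simp
  map_mul' a b := by
    rw [← Complex.exp_add, toAdd_mul]
    push_cast
    ring_nf

lemma lift_charHom (θ : ℝ) (a : AddMonoidAlgebra ℝ ℤ) :
    AddMonoidAlgebra.lift ℝ ℂ ℤ (charHom θ) a = trigSum a.coeff.support a.coeff θ := by
  rw [AddMonoidAlgebra.lift_apply]
  rfl

lemma lift_charHom_bandElt (hW : 0 < W) (θ : ℝ) :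
    AddMonoidAlgebra.lift ℝ ℂ ℤ (charHom θ) (bandElt W) = (bandSymbol W θ : ℂ) := by
  rw [bandElt, map_smul, map_sum, ← bandSymbol_eq_trigSum hW, trigSum, Finset.smul_sum]
  refine Finset.sum_congr rfl fun t _ => ?_
  rw [AddMonoidAlgebra.lift_single, one_smul]
  simp [charHom]

lemma lift_shiftHom_bandElt :
    AddMonoidAlgebra.lift ℝ (Module.End ℝ StepFun) ℤ shiftHom (bandElt W) = walkOp W := by
  rw [bandElt, map_smul, map_sum, walkOp]
  congr 1
  refine Finset.sum_congr rfl fun t _ => ?_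
  rw [AddMonoidAlgebra.lift_single, one_smul]
  rfl

/-- Translations are contractions, so a convolution operator is bounded by the ℓ¹ norm of its
coefficients; this is how the Fourier estimates enter. -/
lemma opLe_lift_shiftHom (a : AddMonoidAlgebra ℝ ℤ) :
    OpLe W (AddMonoidAlgebra.lift ℝ (Module.End ℝ StepFun) ℤ shiftHom a)
      (∑ x ∈ a.coeff.support, |a.coeff x|) := by
  rw [AddMonoidAlgebra.lift_apply, Finsupp.sum]
  refine OpLe.sum _ fun x _ => ?_
  have h := (opLe_shiftOp (W := W) x).smul (a.coeff x)
  rw [mul_one] at h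
  exact h

end operators

lemma exists_opLe_nbDiff : ∃ K : ℝ, 0 < K ∧ ∀ W : ℕ, 2 ≤ W → ∀ n : ℕ, 3 ≤ n →
    OpLe W (aeval (walkOp W) (nbDiff (1 / (2 * W - 1)) n)) (K / n) := by
  obtain ⟨K, hK, h⟩ := exists_sum_abs_nbDiff_le
  refine ⟨K, hK, fun W hW n hn => ?_⟩
  have hW0 : 0 < W := by omega
  set a : AddMonoidAlgebra ℝ ℤ := aeval (bandElt W) (nbDiff (1 / (2 * W - 1)) n) with ha
  have h1 : AddMonoidAlgebra.lift ℝ (Module.End ℝ StepFun) ℤ shiftHom a =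
      aeval (walkOp W) (nbDiff (1 / (2 * W - 1)) n) := by
    rw [ha, ← Polynomial.aeval_algHom_apply, lift_shiftHom_bandElt]
  rw [← h1]
  refine (opLe_lift_shiftHom a).mono (h W hW n hn _ _ fun θ => ?_)
  rw [← lift_charHom, ha, ← Polynomial.aeval_algHom_apply, lift_charHom_bandElt hW0]
  exact Polynomial.aeval_algebraMap_apply_eq_algebraMap_eval _ _

/-- The increments of the powers of `nbOp` decay like `1 / n`, uniformly in `W`. -/
lemma exists_opLe_nbOp_pow_diff : ∃ K : ℝ, 1 ≤ K ∧ ∀ W : ℕ, 2 ≤ W → ∀ n : ℕ,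
    OpLe W (nbOp W ^ n * (nbOp W - 1)) (K / (n + 1)) := by
  obtain ⟨K, hK, h⟩ := exists_opLe_nbDiff
  refine ⟨12 + 8 * K, by linarith, fun W hW n => ?_⟩
  have hW0 : 0 < W := by omega
  have hWr : (2 : ℝ) ≤ W := by exact_mod_cast hW
  induction n using Nat.strong_induction_on with
  | _ n ih =>
  -- For small n the trivial bound 2 is enough; the remaining n have the form k + 2 with k ≥ 3,
  -- where the ℓ¹ bound of the increments applies.
  rcases Nat.lt_or_ge n 5 with hn | hn
  · have h1 := (opLe_nbOp_pow hW0 n).mul ((opLe_nbOp hW0).sub (OpLe.one (W := W)))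
    refine h1.mono ?_
    rw [le_div_iff₀ (by positivity)]
    have : (n : ℝ) + 1 ≤ 5 := by exact_mod_cast hn
    linarith
  obtain ⟨n, rfl⟩ : ∃ k, n = k + 2 := ⟨n - 2, by omega⟩
  have hn3 : 3 ≤ n := by omega
  have hnr : (3 : ℝ) ≤ n := by exact_mod_cast hn3
  have ihn := ih n (by omega)
  set β : ℝ := 1 / (2 * W - 1) with hβ
  have hβ0 : 0 < β := by rw [hβ]; exact one_div_pos.2 (by linarith)
  have hβ3 : β ≤ 1 / 3 := one_div_le_one_div_of_le (by norm_num) (by linarith)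
  have e0 := pow_nb_eq (avgOp_mul_avgOp (W := W)) (avgOp_mul_revOp_mul_avgOp hW0)
    revOp_mul_revOp commute_walkOp_avgOp commute_walkOp_revOp β n
  have e1 := pow_nb_eq (avgOp_mul_avgOp (W := W)) (avgOp_mul_revOp_mul_avgOp hW0)
    revOp_mul_revOp commute_walkOp_avgOp commute_walkOp_revOp β (n + 1)
  have hQ : (1 + β) • avgOp W - β • revOp = nbOp W := rfl
  rw [hQ] at e0 e1
  -- The leftover from n is multiplied by β² ≤ 1/9. Even after replacing n + 1 by n + 3 in the
  -- denominator its coefficient is at most 1/6, so the strong induction closes.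
  have key : nbOp W ^ (n + 2) * (nbOp W - 1) = β ^ 2 • (nbOp W ^ n * (nbOp W - 1)) +
      (1 + β) • (aeval (walkOp W) (nbDiff β (n + 2)) * avgOp W -
        β • (aeval (walkOp W) (nbDiff β (n + 1)) * (revOp * avgOp W + avgOp W * revOp)) +
        β ^ 2 • (aeval (walkOp W) (nbDiff β n) * (revOp * avgOp W * revOp))) := by
    simp only [nbDiff, map_sub, sub_mul, mul_sub, mul_one, ← pow_succ]
    linear_combination (norm := module) e1 - e0
  rw [key]
  have hX := opLe_avgOp hW0
  have hB := opLe_revOp (W := W)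
  have b2 := (h W hW (n + 2) (by omega)).mul hX
  have b1 := ((h W hW (n + 1) (by omega)).mul ((hB.mul hX).add (hX.mul hB))).smul β
  have b0 := ((h W hW n hn3).mul ((hB.mul hX).mul hB)).smul (β ^ 2)
  have b := (ihn.smul (β ^ 2)).add (((b2.sub b1).add b0).smul (1 + β))
  refine b.mono ?_
  rw [abs_of_pos hβ0, abs_of_pos (by positivity), abs_of_pos (by positivity)]
  push_cast
  have hK2 : K / ((n : ℝ) + 2) ≤ K / n := by gcongr; linarith
  have hK1 : K / ((n : ℝ) + 1) ≤ K / n := by gcongr; linarith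
  have hKn : 0 < K / n := by positivity
  have hβ2 : β ^ 2 ≤ 1 / 9 := by nlinarith
  have c1 : (1 + β) * (K / ((n : ℝ) + 2) * 1 + β * (K / ((n : ℝ) + 1) * (1 * 1 + 1 * 1)) +
      β ^ 2 * (K / n * (1 * 1 * 1))) ≤ 3 * (K / n) := by
    have d1 : β * (K / ((n : ℝ) + 1) * (1 * 1 + 1 * 1)) ≤ 1 / 3 * (K / n * 2) := by
      have : (1 * 1 + 1 * 1 : ℝ) = 2 := by norm_num
      rw [this]
      gcongr
    have d2 : β ^ 2 * (K / n * (1 * 1 * 1)) ≤ 1 / 9 * (K / n) := by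
      rw [one_mul, one_mul, mul_one]
      gcongr
    have d3 : 0 ≤ K / ((n : ℝ) + 2) * 1 + β * (K / ((n : ℝ) + 1) * (1 * 1 + 1 * 1)) +
      β ^ 2 * (K / n * (1 * 1 * 1)) := by positivity
    have d4 : K / ((n : ℝ) + 2) * 1 + β * (K / ((n : ℝ) + 1) * (1 * 1 + 1 * 1)) +
      β ^ 2 * (K / n * (1 * 1 * 1)) ≤ 2 * (K / n) := by linarith
    calc _ ≤ (4 / 3) * (2 * (K / n)) := mul_le_mul (by linarith) d4 d3 (by norm_num)
      _ ≤ _ := by linarith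
  have c2 : β ^ 2 * ((12 + 8 * K) / ((n : ℝ) + 1)) ≤ 1 / 9 * ((12 + 8 * K) / ((n : ℝ) + 1)) := by
    gcongr
  have c3 : 1 / 9 * ((12 + 8 * K) / ((n : ℝ) + 1)) ≤ 1 / 6 * ((12 + 8 * K) / ((n : ℝ) + 3)) := by
    rw [← mul_div_assoc, ← mul_div_assoc, div_le_div_iff₀ (by positivity) (by positivity)]
    nlinarith
  have c4 : 3 * (K / n) ≤ 6 * K / ((n : ℝ) + 3) := by
    rw [← mul_div_assoc, div_le_div_iff₀ (by positivity) (by positivity)]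
    nlinarith
  have c5 : 1 / 6 * ((12 + 8 * K) / ((n : ℝ) + 3)) + 6 * K / (n + 3) ≤
      (12 + 8 * K) / (n + 2 + 1) := by
    rw [show (n : ℝ) + 2 + 1 = n + 3 by ring, ← mul_div_assoc, ← add_div]
    exact div_le_div_of_nonneg_right (by linarith) (by positivity)
  linarith

/-- The second increments of the powers of `nbOp` decay like `1 / n ^ 2`, uniformly in `W`. -/
lemma exists_opLe_nbOp_pow_diff_sq : ∃ K : ℝ, 1 ≤ K ∧ ∀ W : ℕ, 2 ≤ W → ∀ n : ℕ,
    OpLe W (nbOp W ^ n * (nbOp W - 1)) (K / (n + 1)) ∧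
    OpLe W (nbOp W ^ n * (nbOp W - 1) ^ 2) (K / (n + 1) ^ 2) := by
  obtain ⟨K, hK, h⟩ := exists_opLe_nbOp_pow_diff
  refine ⟨4 * K ^ 2, by nlinarith, fun W hW n => ⟨?_, ?_⟩⟩
  · refine (h W hW n).mono ?_
    gcongr
    nlinarith
  · have h1 := (h W hW (n / 2)).mul (h W hW (n - n / 2))
    have e : nbOp W ^ (n / 2) * (nbOp W - 1) * (nbOp W ^ (n - n / 2) * (nbOp W - 1)) =
        nbOp W ^ n * (nbOp W - 1) ^ 2 := by
      have hc : Commute (nbOp W - 1) (nbOp W ^ (n - n / 2)) :=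
        ((Commute.refl (nbOp W)).sub_left (Commute.one_left _)).pow_right _
      rw [mul_assoc, ← mul_assoc (nbOp W - 1), hc.eq, mul_assoc, ← mul_assoc, ← pow_add,
        Nat.add_sub_cancel' (Nat.div_le_self _ _), sq]
    rw [e] at h1
    refine h1.mono ?_
    rw [div_mul_div_comm, div_le_div_iff₀ (by positivity) (by positivity)]
    have h2 : ((n : ℝ) + 1) ≤ 2 * ((n / 2 : ℕ) + 1) := by
      exact_mod_cast (by omega : n + 1 ≤ 2 * (n / 2 + 1))
    have h3 : ((n : ℝ) + 1) ≤ 2 * ((n - n / 2 : ℕ) + 1) := by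
      exact_mod_cast (by omega : n + 1 ≤ 2 * (n - n / 2 + 1))
    calc K * K * ((n : ℝ) + 1) ^ 2 = K * K * (((n : ℝ) + 1) * (n + 1)) := by ring
      _ ≤ K * K * ((2 * ((n / 2 : ℕ) + 1)) * (2 * ((n - n / 2 : ℕ) + 1))) := by gcongr
      _ = _ := by ring

end

/-! ### Summation over vertex positions along a spanning tree. -/

noncomputable section

open scoped ENNReal

lemma ENNReal.tsum_pi_prod_fin {α : Type*} {n : ℕ} (f : Fin n → α → ℝ≥0∞) :
    ∑' r : Fin n → α, ∏ i, f i (r i) = ∏ i, ∑' a, f i a := by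
  induction n with
  | zero => simp
  | succ n ih =>
    rw [← (Fin.consEquiv fun _ => α).tsum_eq, ENNReal.tsum_prod', Fin.prod_univ_succ,
      ← ENNReal.tsum_mul_right]
    refine tsum_congr fun a => ?_
    simp only [Fin.consEquiv_apply, Fin.prod_univ_succ, Fin.cons_zero, Fin.cons_succ]
    rw [ENNReal.tsum_mul_left, ih]

lemma ENNReal.tsum_pi_prod {ι α : Type*} [Fintype ι] (f : ι → α → ℝ≥0∞) :
    ∑' r : ι → α, ∏ i, f i (r i) = ∏ i, ∑' a, f i a := by
  have e := Fintype.equivFin ι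
  have h := ENNReal.tsum_pi_prod_fin fun i => f (e.symm i)
  rw [e.symm.prod_comp (fun i => ∑' a, f i a)] at h
  rw [← h, ← (e.symm.arrowCongr (Equiv.refl α)).tsum_eq]
  refine tsum_congr fun n => ?_
  simp only [Equiv.arrowCongr_apply, Equiv.coe_refl, Function.comp_apply, id, Equiv.symm_symm]
  rw [← e.symm.prod_comp]
  simp

namespace MarkedMultigraph

variable {V E : Type*} {G : MarkedMultigraph V E}

/-- Every vertex other than the root has an edge that leads closer to the root. -/
lemma IsConnected.exists_parent_edge (hG : G.IsConnected) : ∃ ρ : V → ℕ, ∀ v, v ≠ G.root →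
    ∃ e w, ρ w < ρ v ∧ ((G.src e = v ∧ G.tgt e = w) ∨ (G.src e = w ∧ G.tgt e = v)) := by
  set H := SimpleGraph.fromRel fun u v => ∃ e, G.src e = u ∧ G.tgt e = v with hH
  have hc : H.Connected := hG
  refine ⟨fun v => H.dist v G.root, fun v hv => ?_⟩
  obtain ⟨p, hp⟩ := hc.exists_walk_length_eq_dist v G.root
  cases p with
  | nil => exact absurd rfl hv
  | @cons _ w _ h q =>
    have h1 := SimpleGraph.dist_le q
    rw [SimpleGraph.Walk.length_cons] at hp
    rw [hH, SimpleGraph.fromRel_adj] at h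
    rcases h.2 with ⟨e, he⟩ | ⟨e, he⟩
    · exact ⟨e, w, by dsimp only; omega, Or.inl he⟩
    · exact ⟨e, w, by dsimp only; omega, Or.inr he⟩

/-- Summation over the positions of the vertices along a spanning tree. -/
lemma IsConnected.tsum_positions_le [Fintype V] [Fintype E] (hG : G.IsConnected)
    (ψ : E → ℤ → ℝ≥0∞) {A b : ℝ≥0∞} (hA : ∀ e, ∑' d, ψ e d ≤ A) (hb : ∀ e d, ψ e d ≤ b) :
    Fintype.card V ≤ Fintype.card E + 1 ∧
    ∑' R : {R : V → ℤ // R G.root = 0}, ∏ e, ψ e (R.1 (G.tgt e) - R.1 (G.src e)) ≤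
      A ^ (Fintype.card V - 1) * b ^ (Fintype.card E + 1 - Fintype.card V) := by
  classical
  obtain ⟨ρ, hρ⟩ := hG.exists_parent_edge
  choose ed w hw hed using fun v : {v // v ≠ G.root} => hρ v.1 v.2
  -- `ρ` strictly decreases from a vertex to the other end of its parent edge, so one edge cannot
  -- serve two vertices. The parent edges form a spanning tree.
  have hinj : Function.Injective ed := by
    intro v v' h
    have h1 := hed v
    have h2 := hed v'
    have h3 := hw v
    have h4 := hw v'
    rw [← h] at h2
    apply Subtype.ext
    rcases h1 with ⟨a, a'⟩ | ⟨a, a'⟩ <;> rcases h2 with ⟨c, c'⟩ | ⟨c, c'⟩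
    · exact a.symm.trans c
    · rw [← a'] at h3; rw [← c] at h4; rw [← a] at h3; rw [← c'] at h4; omega
    · rw [← a] at h3; rw [← c'] at h4; rw [← a'] at h3; rw [← c] at h4; omega
    · exact a'.symm.trans c'
  have hcard : Fintype.card {v // v ≠ G.root} = Fintype.card V - 1 := by
    rw [Fintype.card_subtype_compl, Fintype.card_subtype_eq]
  have hle : Fintype.card V - 1 ≤ Fintype.card E := by
    rw [← hcard]; exact Fintype.card_le_of_injective ed hinj
  refine ⟨by omega, ?_⟩
  set inc : {R : V → ℤ // R G.root = 0} → {v // v ≠ G.root} → ℤ := fun R v =>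
    R.1 (G.tgt (ed v)) - R.1 (G.src (ed v)) with hinc
  -- The position of the root is fixed, and the others are recovered from the tree increments by
  -- induction on `ρ`.
  have hincinj : Function.Injective inc := by
    intro R R' h
    apply Subtype.ext
    have key : ∀ n v, ρ v = n → R.1 v = R'.1 v := by
      intro n
      induction n using Nat.strong_induction_on with
      | _ n ih =>
        intro v hv
        by_cases hr : v = G.root
        · rw [hr, R.2, R'.2]
        · have h1 := congrFun h ⟨v, hr⟩
          have h2 := hw ⟨v, hr⟩
          have h3 := ih _ (hv ▸ h2) _ rfl
          simp only [hinc] at h1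
          rcases hed ⟨v, hr⟩ with ⟨a, a'⟩ | ⟨a, a'⟩
          · rw [a, a', h3] at h1
            change _ - R.1 v = _ - R'.1 v at h1
            omega
          · rw [a, a', h3] at h1
            change R.1 v - _ = R'.1 v - _ at h1
            omega
    exact funext fun v => key _ v rfl
  have hprod : ∀ R : {R : V → ℤ // R G.root = 0},
      ∏ e, ψ e (R.1 (G.tgt e) - R.1 (G.src e)) ≤
        (∏ v, ψ (ed v) (inc R v)) * b ^ (Fintype.card E + 1 - Fintype.card V) := by
    intro R
    rw [← Finset.prod_mul_prod_compl (Finset.univ.image ed)]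
    refine mul_le_mul' (le_of_eq (Finset.prod_image fun x _ y _ h => hinj h)) ?_
    refine (Finset.prod_le_pow_card _ _ b fun e _ => hb e _).trans (le_of_eq ?_)
    congr 1
    rw [Finset.card_compl, Finset.card_image_of_injective _ hinj, Finset.card_univ, hcard]
    have : 0 < Fintype.card V := Fintype.card_pos_iff.2 ⟨G.root⟩
    omega
  calc _ ≤ ∑' R, (∏ v, ψ (ed v) (inc R v)) * b ^ (Fintype.card E + 1 - Fintype.card V) :=
        ENNReal.tsum_le_tsum hprod
    _ = (∑' R, ∏ v, ψ (ed v) (inc R v)) * b ^ (Fintype.card E + 1 - Fintype.card V) :=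
        ENNReal.tsum_mul_right
    _ ≤ (∑' r : {v // v ≠ G.root} → ℤ, ∏ v, ψ (ed v) (r v)) *
          b ^ (Fintype.card E + 1 - Fintype.card V) := by
        gcongr
        exact ENNReal.tsum_comp_le_tsum_of_injective hincinj fun r => ∏ v, ψ (ed v) (r v)
    _ ≤ _ := by
        rw [ENNReal.tsum_pi_prod]
        gcongr
        refine (Finset.prod_le_pow_card _ _ A fun v _ => hA _).trans (le_of_eq ?_)
        rw [Finset.card_univ, hcard]

end MarkedMultigraph

end

/-! ### Matrix elements of the walk and weights of edges. -/

noncomputable section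

open scoped ENNReal

/-- The indicator of the position `d` and the last step `t`. -/
def deltaFun (d t : ℤ) : StepFun := fun x s => if x = d ∧ s = t then 1 else 0

/-- The matrix element of `A` between the state reached from the origin by the step `s` and the
state with position `d` and last step `t`. -/
def nbKer (A : Module.End ℝ StepFun) (s t d : ℤ) : ℝ := A (deltaFun d t) s s

section kernel

variable {W : ℕ} {A : Module.End ℝ StepFun} {a : ℝ}

/-- Duality: apply `A` to the function of signs of the matrix elements in the row of `s`. -/
lemma OpLe.sum_abs_apply_deltaFun_le (hA : OpLe W A a) {s : ℤ} (hs : s ∈ bandSteps W)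
    (P : Finset (ℤ × ℤ)) : ∑ p ∈ P, |nbKer A s p.2 p.1| ≤ a := by
  set f : StepFun := ∑ p ∈ P, ((SignType.sign (nbKer A s p.2 p.1) : SignType) : ℝ) •
    deltaFun p.1 p.2 with hf
  have hfx : ∀ x r, f x r = if (x, r) ∈ P then
      ((SignType.sign (nbKer A s r x) : SignType) : ℝ) else 0 := by
    intro x r
    rw [hf, Finset.sum_apply, Finset.sum_apply, ← Finset.sum_ite_eq P (x, r)
      (fun p => ((SignType.sign (nbKer A s p.2 p.1) : SignType) : ℝ))]
    refine Finset.sum_congr rfl fun p _ => ?_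
    rw [Pi.smul_apply, Pi.smul_apply, smul_eq_mul, deltaFun, mul_ite, mul_one, mul_zero]
    simp only [Prod.ext_iff]
  have h1 := hA f 1 (fun x r _ => by
    rw [hfx]
    split_ifs
    · rcases SignType.trichotomy (SignType.sign (nbKer A s r x)) with h | h | h <;> rw [h] <;> simp
    · simp) s s hs
  rw [mul_one] at h1
  refine le_trans (le_of_eq ?_) ((le_abs_self _).trans h1)
  rw [hf, map_sum, Finset.sum_apply, Finset.sum_apply]
  refine Finset.sum_congr rfl fun p _ => ?_
  rw [map_smul, Pi.smul_apply, Pi.smul_apply, smul_eq_mul]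
  exact (sign_mul_self _).symm

/-- The bound with M = 0: such an operator sees only the values at admissible steps. This matters
because `nbOp` averages over non-backtracking continuations only at these. -/
lemma OpLe.congr (hA : OpLe W A a) {f g : StepFun} (h : ∀ x, ∀ s ∈ bandSteps W, f x s = g x s)
    (x : ℤ) {s : ℤ} (hs : s ∈ bandSteps W) : A f x s = A g x s := by
  have h1 := hA (f - g) 0 (fun x s hs => by simp [h x s hs]) x s hs
  rw [mul_zero, map_sub] at h1
  have h2 := abs_nonpos_iff.1 h1
  exact sub_eq_zero.1 h2

lemma nbOp_deltaFun (hW : 0 < W) (d x : ℤ) {t s : ℤ} (ht : t ∈ bandSteps W)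
    (hs : s ∈ bandSteps W) : nbOp W (deltaFun d t) x s =
      ((1 / (2 * W - 1 : ℝ)) • ∑ r ∈ (bandSteps W).erase (-t), deltaFun (d - t) r) x s := by
  rw [nbOp_apply hW _ _ hs, Pi.smul_apply, Pi.smul_apply, smul_eq_mul, Finset.sum_apply,
    Finset.sum_apply]
  congr 1
  simp only [deltaFun, ite_and]
  have e1 : ∀ r, (if x + r = d then if r = t then (1 : ℝ) else 0 else 0) =
      if r = t then (if x + t = d then 1 else 0) else 0 := by
    intro r; split_ifs <;> simp_all
  have e2 : ∀ r, (if x = d - t then if s = r then (1 : ℝ) else 0 else 0) =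
      if s = r then (if x = d - t then 1 else 0) else 0 := by
    intro r; split_ifs <;> simp_all
  simp_rw [e1, e2]
  rw [Finset.sum_ite_eq', Finset.sum_ite_eq]
  simp only [Finset.mem_erase, ht, hs, and_true, eq_sub_iff_add_eq]
  have : t ≠ -s ↔ s ≠ -t := by omega
  simp only [this]

lemma OpLe.nbKer_mul_nbOp (hA : OpLe W A a) (hW : 0 < W) (d : ℤ) {t s : ℤ}
    (ht : t ∈ bandSteps W) (hs : s ∈ bandSteps W) : nbKer (A * nbOp W) s t d =
      (1 / (2 * W - 1 : ℝ)) * ∑ r ∈ (bandSteps W).erase (-t), nbKer A s r (d - t) := by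
  rw [nbKer, Module.End.mul_apply,
    hA.congr (fun x s hs => nbOp_deltaFun hW d x ht hs) s hs, map_smul, map_sum, Pi.smul_apply,
    Pi.smul_apply, smul_eq_mul, Finset.sum_apply, Finset.sum_apply]
  rfl

/-- Ending at `d` with last step `t` means having been at d - t before. These points are distinct
for distinct `t`, so the sum runs over part of a single row of `A`, and the last step contributes
1/(2W - 1). -/
lemma OpLe.sum_abs_nbKer_mul_nbOp_le (hA : OpLe W A a) (hW : 0 < W) (d : ℤ) {s : ℤ}
    (hs : s ∈ bandSteps W) :
    ∑ t ∈ bandSteps W, |nbKer (A * nbOp W) s t d| ≤ (1 / (2 * W - 1 : ℝ)) * a := by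
  have hW1 : (1 : ℝ) ≤ W := by exact_mod_cast hW
  have hβ : 0 < 1 / (2 * W - 1 : ℝ) := one_div_pos.2 (by linarith)
  have h1 : ∀ t ∈ bandSteps W, |nbKer (A * nbOp W) s t d| ≤
      (1 / (2 * W - 1 : ℝ)) * ∑ r ∈ bandSteps W, |nbKer A s r (d - t)| := by
    intro t ht
    rw [hA.nbKer_mul_nbOp hW d ht hs, abs_mul, abs_of_pos hβ]
    refine mul_le_mul_of_nonneg_left ((Finset.abs_sum_le_sum_abs _ _).trans ?_) hβ.le
    exact Finset.sum_le_sum_of_subset_of_nonneg (Finset.erase_subset _ _)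
      fun _ _ _ => abs_nonneg _
  refine (Finset.sum_le_sum h1).trans ?_
  rw [← Finset.mul_sum]
  refine mul_le_mul_of_nonneg_left ?_ hβ.le
  have h2 := hA.sum_abs_apply_deltaFun_le hs
    ((bandSteps W ×ˢ bandSteps W).image fun p => (d - p.1, p.2))
  rw [Finset.sum_image, Finset.sum_product] at h2
  · exact h2
  · rintro ⟨p, p'⟩ _ ⟨r, r'⟩ _ h
    simp only [Prod.mk.injEq, sub_right_inj] at h
    exact Prod.ext h.1 h.2

/-- The normalised sum of the matrix elements of `A` over all first and last steps. -/
def kerTotal (W : ℕ) (A : Module.End ℝ StepFun) (d : ℤ) : ℝ≥0∞ :=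
  ∑ s ∈ bandSteps W, ∑ t ∈ bandSteps W, ‖(1 / (2 * W : ℝ)) * nbKer A s t d‖ₑ

lemma sum_ofReal_div_card_le (hW : 0 < W) {f : ℤ → ℝ}
    (hf : ∀ s ∈ bandSteps W, f s ≤ a) :
    ∑ s ∈ bandSteps W, ENNReal.ofReal (1 / (2 * W) * f s) ≤ ENNReal.ofReal a := by
  have hW0 : (0 : ℝ) < W := by positivity
  have : ∀ s ∈ bandSteps W, ENNReal.ofReal (1 / (2 * W) * f s) ≤
      ENNReal.ofReal (1 / (2 * W) * a) := fun s hs => by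
    gcongr; exact hf s hs
  refine (Finset.sum_le_sum this).trans ?_
  rw [Finset.sum_const, card_bandSteps, nsmul_eq_mul, ← ENNReal.ofReal_natCast,
    ← ENNReal.ofReal_mul (by positivity)]
  refine ENNReal.ofReal_le_ofReal (le_of_eq ?_)
  push_cast
  field_simp

lemma sum_enorm_nbKer_eq (s d : ℤ) : ∑ t ∈ bandSteps W, ‖(1 / (2 * W : ℝ)) * nbKer A s t d‖ₑ =
    ENNReal.ofReal (1 / (2 * W) * ∑ t ∈ bandSteps W, |nbKer A s t d|) := by
  rw [Finset.mul_sum, ENNReal.ofReal_sum_of_nonneg fun t _ => by positivity]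
  refine Finset.sum_congr rfl fun t _ => ?_
  rw [← ofReal_norm, norm_mul, Real.norm_of_nonneg (by positivity : 0 ≤ 1 / (2 * W : ℝ)),
    Real.norm_eq_abs]

lemma OpLe.tsum_kerTotal_le (hA : OpLe W A a) (hW : 0 < W) :
    ∑' d, kerTotal W A d ≤ ENNReal.ofReal a := by
  rw [ENNReal.tsum_eq_iSup_sum]
  refine iSup_le fun D => ?_
  simp only [kerTotal, sum_enorm_nbKer_eq]
  rw [Finset.sum_comm]
  refine le_trans (le_of_eq ?_) (sum_ofReal_div_card_le hW
    (f := fun s => ∑ d ∈ D, ∑ t ∈ bandSteps W, |nbKer A s t d|) fun s hs => ?_)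
  · refine Finset.sum_congr rfl fun s _ => ?_
    rw [Finset.mul_sum, ENNReal.ofReal_sum_of_nonneg]
    intro d _
    exact mul_nonneg (by positivity) (Finset.sum_nonneg fun _ _ => abs_nonneg _)
  · have := hA.sum_abs_apply_deltaFun_le hs (D ×ˢ bandSteps W)
    rwa [Finset.sum_product] at this

lemma OpLe.kerTotal_mul_nbOp_le (hA : OpLe W A a) (hW : 0 < W) (d : ℤ) :
    kerTotal W (A * nbOp W) d ≤ ENNReal.ofReal (1 / (2 * W - 1)) * ENNReal.ofReal a := by
  have hW1 : (1 : ℝ) ≤ W := by exact_mod_cast hW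
  have hβ : 0 < 1 / (2 * W - 1 : ℝ) := one_div_pos.2 (by linarith)
  simp only [kerTotal, sum_enorm_nbKer_eq]
  rw [← ENNReal.ofReal_mul hβ.le]
  exact sum_ofReal_div_card_le hW fun s hs =>
    hA.sum_abs_nbKer_mul_nbOp_le hW d hs

lemma kerTotal_one_le (hW : 0 < W) (d : ℤ) :
    kerTotal W 1 d ≤ ENNReal.ofReal (1 / (2 * W - 1)) := by
  have hW1 : (1 : ℝ) ≤ W := by exact_mod_cast hW
  simp only [kerTotal, sum_enorm_nbKer_eq]
  have h : ∀ s ∈ bandSteps W, ENNReal.ofReal (1 / (2 * W) * ∑ t ∈ bandSteps W, |nbKer 1 s t d|) =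
      if s = d then ENNReal.ofReal (1 / (2 * W)) else 0 := by
    intro s hs
    have : ∀ t, |nbKer 1 s t d| = if s = t then (if s = d then 1 else 0) else 0 := by
      intro t
      simp only [nbKer, Module.End.one_apply, deltaFun]
      split_ifs <;> simp_all
    simp_rw [this, Finset.sum_ite_eq, if_pos hs]
    split_ifs <;> simp
  rw [Finset.sum_congr rfl h, Finset.sum_ite_eq']
  split_ifs
  · refine ENNReal.ofReal_le_ofReal (one_div_le_one_div_of_le (by linarith) (by linarith))
  · simp

/-- The probability that the non-backtracking walk of `n + 1` steps makes the first step `s`, the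
last step `t` and the total displacement `d`. -/
def nbProb (W n : ℕ) (s t d : ℤ) : ℝ := (1 / (2 * W : ℝ)) * nbKer (nbOp W ^ n) s t d

lemma nbProb_sub (n m : ℕ) (s t d : ℤ) : nbProb W n s t d - nbProb W m s t d =
    (1 / (2 * W : ℝ)) * nbKer (nbOp W ^ n - nbOp W ^ m) s t d := by
  rw [nbProb, nbProb, ← mul_sub]
  rfl

lemma nbProb_sub_sub (n : ℕ) (s t d : ℤ) :
    nbProb W (n + 2) s t d - nbProb W (n + 1) s t d -
      (nbProb W (n + 1) s t d - nbProb W n s t d) =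
    (1 / (2 * W : ℝ)) * nbKer (nbOp W ^ n * (nbOp W - 1) ^ 2) s t d := by
  have e : nbOp W ^ n * (nbOp W - 1) ^ 2 = nbOp W ^ (n + 2) - nbOp W ^ (n + 1) -
      (nbOp W ^ (n + 1) - nbOp W ^ n) := by
    rw [pow_add, pow_succ (nbOp W) n, sq, sq]
    simp only [mul_sub, sub_mul, mul_one, one_mul]
  rw [nbProb_sub, nbProb_sub, ← mul_sub, e]
  rfl

/-- The sum of `abelNorm` of the walk probabilities over all first and last steps. -/
def edgeWeight (W N : ℕ) (c : ℝ≥0∞) (d : ℤ) : ℝ≥0∞ :=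
  ∑ s ∈ bandSteps W, ∑ t ∈ bandSteps W, abelNorm N c fun n => nbProb W n s t d

lemma edgeWeight_eq (N : ℕ) (c : ℝ≥0∞) (d : ℤ) : edgeWeight W N c d =
    ∑ n ∈ Finset.range N, kerTotal W (nbOp W ^ n) d + c * kerTotal W (nbOp W ^ N) d +
    c ^ 2 * (kerTotal W (nbOp W ^ N * (nbOp W - 1)) d +
      ∑' n, kerTotal W (nbOp W ^ (N + n) * (nbOp W - 1) ^ 2) d) := by
  have e : nbOp W ^ N * (nbOp W - 1) = nbOp W ^ (N + 1) - nbOp W ^ N := by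
    rw [mul_sub, mul_one, ← pow_succ]
  simp only [edgeWeight, abelNorm, nbProb_sub_sub]
  simp only [nbProb_sub, Finset.sum_add_distrib, ← Finset.mul_sum, e, kerTotal]
  congr 1
  · congr 1
    rw [Finset.sum_comm]
    rw [Finset.sum_comm]
    conv_lhs => enter [2, s]; rw [Finset.sum_comm]
    rw [Finset.sum_comm]
    rfl
  · congr 2
    rw [Summable.tsum_finsetSum fun _ _ => ENNReal.summable]
    refine Finset.sum_congr rfl fun s _ => ?_
    rw [Summable.tsum_finsetSum fun _ _ => ENNReal.summable]

lemma tsum_ofReal_div_sq_le {K : ℝ} (hK : 0 ≤ K) {N : ℕ} (hN : 2 ≤ N) :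
    ∑' n : ℕ, ENNReal.ofReal (K / (N + n) ^ 2) ≤ ENNReal.ofReal (K / (N - 1)) := by
  have hN2 : (2 : ℝ) ≤ N := by exact_mod_cast hN
  rw [ENNReal.tsum_eq_iSup_nat]
  refine iSup_le fun M => ?_
  rw [← ENNReal.ofReal_sum_of_nonneg fun n _ => by positivity]
  refine ENNReal.ofReal_le_ofReal ?_
  have h : ∀ M : ℕ, ∑ n ∈ Finset.range M, K / ((N : ℝ) + n) ^ 2 ≤
      K / (N - 1) - K / (N + M - 1) := by
    intro M
    induction M with
    | zero => simp
    | succ M ih =>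
      rw [Finset.sum_range_succ]
      have h1 : K / ((N : ℝ) + M) ^ 2 ≤ K / (N + M - 1) - K / (N + M) := by
        have hp : (0 : ℝ) ≤ M := by positivity
        rw [div_sub_div _ _ (by linarith) (by linarith)]
        rw [div_le_div_iff₀ (by positivity) (mul_pos (by linarith) (by linarith))]
        have : 0 ≤ K * (N + M) := by positivity
        nlinarith
      push_cast
      rw [show (N : ℝ) + (M + 1) - 1 = N + M by ring]
      linarith
  refine (h M).trans ?_
  have hp : (0 : ℝ) ≤ M := by positivity
  have : 0 ≤ K / ((N : ℝ) + M - 1) := div_nonneg hK (by linarith)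
  linarith

end kernel

/-- Bounds for the edge weights, uniform in `W`. -/
lemma exists_edgeWeight_bound : ∃ K : ℝ, 1 ≤ K ∧ ∀ W : ℕ, 2 ≤ W → ∀ N : ℕ, 2 ≤ N →
    ∀ c : ℝ≥0∞,
      ∑' d, edgeWeight W N c d ≤ N + c + c ^ 2 * ENNReal.ofReal (K / (N - 1)) ∧
      ∀ d, edgeWeight W N c d ≤ ENNReal.ofReal (1 / (2 * W - 1)) *
        (N + c + c ^ 2 * ENNReal.ofReal (K / (N - 1))) := by
  obtain ⟨K, hK, h⟩ := exists_opLe_nbOp_pow_diff_sq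
  refine ⟨2 * K, by linarith, fun W hW N hN c => ?_⟩
  have hW0 : 0 < W := by omega
  have hN2 : (2 : ℝ) ≤ N := by exact_mod_cast hN
  have hK0 : 0 ≤ K := by linarith
  have hsplit : ENNReal.ofReal (2 * K / (N - 1)) =
      ENNReal.ofReal (K / (N - 1)) + ENNReal.ofReal (K / (N - 1)) := by
    have : 0 ≤ K / ((N : ℝ) - 1) := div_nonneg hK0 (by linarith)
    rw [← ENNReal.ofReal_add this this]
    congr 1
    ring
  have hpow : ∀ n, ∑' d, kerTotal W (nbOp W ^ n) d ≤ 1 := fun n => by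
    simpa using (opLe_nbOp_pow hW0 n).tsum_kerTotal_le hW0
  have hpow' : ∀ n d, kerTotal W (nbOp W ^ n) d ≤ ENNReal.ofReal (1 / (2 * W - 1)) := by
    intro n d
    rcases n with _ | n
    · rw [pow_zero]; exact kerTotal_one_le hW0 d
    · rw [pow_succ]
      simpa using (opLe_nbOp_pow hW0 n).kerTotal_mul_nbOp_le hW0 d
  have hcomm : ∀ n, Commute (nbOp W) ((nbOp W - 1) ^ n) := fun n =>
    ((Commute.refl (nbOp W)).sub_right (Commute.one_right _)).pow_right n
  refine ⟨?_, fun d => ?_⟩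
  · simp_rw [edgeWeight_eq]
    rw [ENNReal.tsum_add, ENNReal.tsum_add, ENNReal.tsum_mul_left, ENNReal.tsum_mul_left,
      ENNReal.tsum_add]
    refine add_le_add (add_le_add ?_ ?_) ?_
    · rw [Summable.tsum_finsetSum fun _ _ => ENNReal.summable]
      refine (Finset.sum_le_sum fun n _ => hpow n).trans ?_
      simp
    · exact mul_le_of_le_one_right' (hpow N)
    · rw [hsplit]
      gcongr
      · refine ((h W hW N).1.tsum_kerTotal_le hW0).trans
          (ENNReal.ofReal_le_ofReal ?_)
        exact div_le_div_of_nonneg_left hK0 (by linarith) (by linarith)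
      · rw [ENNReal.tsum_comm]
        refine le_trans (ENNReal.tsum_le_tsum fun n => ?_) (tsum_ofReal_div_sq_le hK0 hN)
        refine ((h W hW (N + n)).2.tsum_kerTotal_le hW0).trans
          (ENNReal.ofReal_le_ofReal ?_)
        push_cast
        exact div_le_div_of_nonneg_left hK0 (by positivity)
          (pow_le_pow_left₀ (by positivity) (by linarith) 2)
  · rw [edgeWeight_eq, mul_add (ENNReal.ofReal _), mul_add (ENNReal.ofReal _)]
    refine add_le_add (add_le_add ?_ ?_) ?_
    · refine (Finset.sum_le_sum fun n _ => hpow' n d).trans ?_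
      simp [mul_comm]
    · rw [mul_comm]
      gcongr
      exact hpow' N d
    · rw [hsplit, mul_left_comm, mul_add (ENNReal.ofReal (1 / (2 * (W : ℝ) - 1)))]
      gcongr
      -- One factor of `nbOp` is split off as the last step; it supplies the factor 1/(2W - 1), and
      -- `N` ≥ 2 leaves enough steps for the decay.
      · obtain ⟨N, rfl⟩ : ∃ k, N = k + 1 := ⟨N - 1, by omega⟩
        have e : nbOp W ^ (N + 1) * (nbOp W - 1) = nbOp W ^ N * (nbOp W - 1) * nbOp W := by
          have := (hcomm 1).eq
          rw [pow_one] at this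
          rw [pow_succ, mul_assoc, this, mul_assoc]
        rw [e]
        refine ((h W hW N).1.kerTotal_mul_nbOp_le hW0 d).trans ?_
        gcongr
        · linarith
        · push_cast; linarith
      · refine le_trans ?_ (mul_le_mul_right (tsum_ofReal_div_sq_le hK0 hN) _)
        rw [← ENNReal.tsum_mul_left]
        refine ENNReal.tsum_le_tsum fun n => ?_
        obtain ⟨m, hm⟩ : ∃ m, N + n = m + 1 := ⟨N + n - 1, by omega⟩
        have e : nbOp W ^ (m + 1) * (nbOp W - 1) ^ 2 =
            nbOp W ^ m * (nbOp W - 1) ^ 2 * nbOp W := by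
          rw [pow_succ, mul_assoc, (hcomm 2).eq, mul_assoc]
        rw [hm, e]
        refine ((h W hW m).2.kerTotal_mul_nbOp_le hW0 d).trans ?_
        have : (N : ℝ) + n = m + 1 := by exact_mod_cast hm
        rw [this]

end

/-! ### Counting non-backtracking walks by powers of `nbOp`. -/

noncomputable section

open scoped ENNReal

/-- A finite set that contains all `n + 1`-step non-backtracking walks from `x`, and nothing
else (`mem_nbWalks`). -/
def nbWalks (W : ℕ) (x : ℤ) : (n : ℕ) → Finset (Fin (n + 2) → ℤ)
  | 0 => (bandSteps W).image fun t => Fin.snoc (α := fun _ => ℤ) (fun _ : Fin 1 => x) (x + t)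
  | n + 1 => (nbWalks W x n).biUnion fun γ =>
      ((bandSteps W).erase (-(γ (Fin.last _) - γ ⟨n, by omega⟩))).image fun t =>
        Fin.snoc (α := fun _ => ℤ) γ (γ (Fin.last _) + t)

section walks

variable {W : ℕ} {x : ℤ}

lemma bandGraph_adj_iff (u v : ℤ) : (bandGraph W).Adj u v ↔ v - u ∈ bandSteps W := by
  rw [mem_bandSteps, abs_sub_comm]
  rfl

lemma isNBWalk_one_iff (γ : Fin 2 → ℤ) :
    IsNBWalk W 1 x γ ↔ γ 0 = x ∧ γ 1 - γ 0 ∈ bandSteps W := by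
  rw [IsNBWalk]
  constructor
  · rintro ⟨h0, h1, -⟩
    exact ⟨h0, (bandGraph_adj_iff _ _).1 (h1 0)⟩
  · rintro ⟨h0, h1⟩
    refine ⟨h0, fun j => ?_, fun j hj => by omega⟩
    rw [Subsingleton.elim j 0]
    exact (bandGraph_adj_iff _ _).2 h1

lemma isNBWalk_snoc_iff (n : ℕ) (γ : Fin (n + 2) → ℤ) (y : ℤ) :
    IsNBWalk W (n + 2) x (Fin.snoc (α := fun _ => ℤ) γ y) ↔ IsNBWalk W (n + 1) x γ ∧
      y - γ (Fin.last _) ∈ bandSteps W ∧ γ ⟨n, by omega⟩ ≠ y := by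
  have hv : ∀ (j : ℕ) (hj : j < n + 3) (hj' : j < n + 2),
      (Fin.snoc (α := fun _ => ℤ) γ y : Fin (n + 3) → ℤ) ⟨j, hj⟩ = γ ⟨j, hj'⟩ := fun j hj hj' =>
    Fin.snoc_castSucc (α := fun _ => ℤ) y γ ⟨j, hj'⟩
  have hl : (Fin.snoc (α := fun _ => ℤ) γ y : Fin (n + 3) → ℤ) ⟨n + 2, by omega⟩ = y :=
    Fin.snoc_last (α := fun _ => ℤ) y γ
  constructor
  · rintro ⟨h0, h1, h2⟩
    refine ⟨⟨(hv 0 (by omega) (by omega)).symm.trans h0, fun j => ?_, fun j hj => ?_⟩, ?_, ?_⟩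
    · have := h1 j.castSucc
      rw [Fin.snoc_castSucc, Fin.succ_castSucc, Fin.snoc_castSucc] at this
      exact this
    · have := h2 j (by omega)
      rwa [hv j _ (by omega), hv (j + 2) _ (by omega)] at this
    · have := h1 (Fin.last _)
      rw [Fin.snoc_castSucc, Fin.succ_last, Fin.snoc_last, bandGraph_adj_iff] at this
      exact this
    · have := h2 n (by omega)
      rwa [hv n _ (by omega), hl] at this
  · rintro ⟨⟨h0, h1, h2⟩, h3, h4⟩
    refine ⟨(hv 0 (by omega) (by omega)).trans h0, fun j => ?_, fun j hj => ?_⟩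
    · induction j using Fin.lastCases with
      | last =>
        rw [Fin.snoc_castSucc, Fin.succ_last, Fin.snoc_last, bandGraph_adj_iff]
        exact h3
      | cast j =>
        rw [Fin.snoc_castSucc, Fin.succ_castSucc, Fin.snoc_castSucc]
        exact h1 j
    · rcases Nat.lt_or_ge (j + 2) (n + 2) with h | h
      · rw [hv j _ (by omega), hv (j + 2) _ h]
        exact h2 j h
      · obtain rfl : j = n := by omega
        rw [hv j _ (by omega), hl]
        exact h4

lemma mem_nbWalks (n : ℕ) (γ : Fin (n + 2) → ℤ) :
    γ ∈ nbWalks W x n ↔ IsNBWalk W (n + 1) x γ := by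
  induction n with
  | zero =>
    rw [nbWalks, Finset.mem_image, isNBWalk_one_iff]
    constructor
    · rintro ⟨t, ht, rfl⟩
      have e0 : (Fin.snoc (α := fun _ => ℤ) (fun _ : Fin 1 => x) (x + t) : Fin 2 → ℤ) 0 = x :=
        Fin.snoc_castSucc (α := fun _ => ℤ) (x + t) (fun _ : Fin 1 => x) 0
      have e1 : (Fin.snoc (α := fun _ => ℤ) (fun _ : Fin 1 => x) (x + t) : Fin 2 → ℤ) 1 = x + t :=
        Fin.snoc_last (α := fun _ => ℤ) (x + t) (fun _ : Fin 1 => x)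
      refine ⟨e0, ?_⟩
      rw [e0, e1]
      simpa using ht
    · rintro ⟨h0, h1⟩
      refine ⟨_, h1, ?_⟩
      refine Eq.trans ?_ (Fin.snoc_init_self γ)
      congr 1
      · ext j
        rw [Subsingleton.elim j 0]
        exact h0.symm
      · rw [h0, add_sub_cancel]
        rfl
  | succ n ih =>
    simp only [nbWalks, Finset.mem_biUnion, Finset.mem_image, Finset.mem_erase]
    constructor
    · rintro ⟨γ, hγ, t, ⟨ht, ht'⟩, rfl⟩
      rw [isNBWalk_snoc_iff]
      refine ⟨(ih γ).1 hγ, by simpa using ht', fun h => ht ?_⟩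
      omega
    · intro h
      rw [← Fin.snoc_init_self γ, isNBWalk_snoc_iff] at h
      refine ⟨Fin.init γ, (ih _).2 h.1, _, ⟨fun h' => h.2.2 ?_, h.2.1⟩, ?_⟩
      · omega
      · rw [add_sub_cancel]
        exact Fin.snoc_init_self γ

lemma sum_nbWalks_zero (h : (Fin 2 → ℤ) → ℝ) : ∑ γ ∈ nbWalks W x 0, h γ =
    ∑ t ∈ bandSteps W, h (Fin.snoc (α := fun _ => ℤ) (fun _ : Fin 1 => x) (x + t)) := by
  rw [nbWalks, Finset.sum_image]
  intro t _ t' _ e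
  exact add_left_cancel (Fin.snoc_injective2 (α := fun _ => ℤ) e).2

lemma sum_nbWalks_succ (n : ℕ) (h : (Fin (n + 3) → ℤ) → ℝ) : ∑ γ ∈ nbWalks W x (n + 1), h γ =
    ∑ γ ∈ nbWalks W x n, ∑ t ∈ (bandSteps W).erase (-(γ (Fin.last _) - γ ⟨n, by omega⟩)),
      h (Fin.snoc (α := fun _ => ℤ) γ (γ (Fin.last _) + t)) := by
  rw [nbWalks, Finset.sum_biUnion]
  · refine Finset.sum_congr rfl fun γ _ => ?_
    rw [Finset.sum_image]
    intro t _ t' _ e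
    exact add_left_cancel (Fin.snoc_injective2 (α := fun _ => ℤ) e).2
  · intro γ _ γ' _ hne
    rw [Function.onFun, Finset.disjoint_left]
    intro δ h1 h2
    obtain ⟨t, -, rfl⟩ := Finset.mem_image.1 h1
    obtain ⟨t', -, e⟩ := Finset.mem_image.1 h2
    exact hne (Fin.snoc_injective2 (α := fun _ => ℤ) e).1.symm

lemma last_step_mem (n : ℕ) {γ : Fin (n + 2) → ℤ} (hγ : γ ∈ nbWalks W x n) :
    γ (Fin.last _) - γ ⟨n, by omega⟩ ∈ bandSteps W := by
  have := ((mem_nbWalks n γ).1 hγ).2.1 (Fin.last _)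
  rwa [bandGraph_adj_iff] at this

lemma first_step_mem (n : ℕ) {γ : Fin (n + 2) → ℤ} (hγ : γ ∈ nbWalks W x n) :
    γ ⟨1, by omega⟩ - x ∈ bandSteps W := by
  obtain ⟨h0, h1, -⟩ := (mem_nbWalks n γ).1 hγ
  have := h1 0
  rw [bandGraph_adj_iff] at this
  rw [← h0]
  exact this

lemma card_nbWalks (hW : 0 < W) (n : ℕ) :
    ((nbWalks W x n).card : ℝ) = 2 * W * (2 * W - 1) ^ n := by
  induction n with
  | zero =>
    have := sum_nbWalks_zero (W := W) (x := x) fun _ => 1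
    simp only [Finset.sum_const, nsmul_eq_mul, mul_one, card_bandSteps] at this
    rw [this]
    push_cast
    ring
  | succ n ih =>
    have := sum_nbWalks_succ (W := W) (x := x) n fun _ => 1
    simp only [Finset.sum_const (1 : ℝ), nsmul_eq_mul, mul_one] at this
    rw [this, Finset.sum_congr rfl (g := fun _ => (2 * W - 1 : ℝ)), Finset.sum_const,
      nsmul_eq_mul, ih]
    · ring
    · intro γ hγ
      rw [Finset.card_erase_of_mem (neg_mem_bandSteps.2 (last_step_mem n hγ)), card_bandSteps,
        Nat.cast_sub (by omega)]
      push_cast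
      ring

/-- Induction by removing the final step: summing over its admissible values is (2W - 1) times
`nbOp` acting on the test function. The first step `s` plays the role of the initial state, so n + 1
steps correspond to the n-th power. -/
lemma sum_nbWalks_eq_nbOp_pow (hW : 0 < W) (n : ℕ) {s : ℤ} (hs : s ∈ bandSteps W)
    (f : StepFun) :
    ∑ γ ∈ nbWalks W x n, (if γ ⟨1, by omega⟩ = x + s then
      f (γ (Fin.last _) - x) (γ (Fin.last _) - γ ⟨n, by omega⟩) else 0) =
    (2 * W - 1) ^ n * (nbOp W ^ n) f s s := by
  have hW1 : (1 : ℝ) ≤ W := by exact_mod_cast hW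
  induction n generalizing f with
  | zero =>
    rw [sum_nbWalks_zero, Finset.sum_eq_single s]
    · have e0 : (Fin.snoc (α := fun _ => ℤ) (fun _ : Fin 1 => x) (x + s) : Fin 2 → ℤ)
          ⟨0, by omega⟩ = x :=
        Fin.snoc_castSucc (α := fun _ => ℤ) (x + s) (fun _ : Fin 1 => x) 0
      have e1 : (Fin.snoc (α := fun _ => ℤ) (fun _ : Fin 1 => x) (x + s) : Fin 2 → ℤ)
          ⟨1, by omega⟩ = x + s :=
        Fin.snoc_last (α := fun _ => ℤ) (x + s) (fun _ : Fin 1 => x)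
      rw [if_pos e1, Fin.snoc_last, e0]
      simp
    · intro t _ ht
      refine if_neg fun h => ht ?_
      have e1 : (Fin.snoc (α := fun _ => ℤ) (fun _ : Fin 1 => x) (x + t) : Fin 2 → ℤ)
          ⟨1, by omega⟩ = x + t :=
        Fin.snoc_last (α := fun _ => ℤ) (x + t) (fun _ : Fin 1 => x)
      exact add_left_cancel (e1.symm.trans h)
    · exact fun h => absurd hs h
  | succ n ih =>
    rw [sum_nbWalks_succ, pow_succ (nbOp W), Module.End.mul_apply, pow_succ (2 * W - 1 : ℝ),
      mul_right_comm, ← ih, Finset.sum_mul]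
    refine Finset.sum_congr rfl fun γ hγ => ?_
    have hv : ∀ (y : ℤ) (j : ℕ) (hj : j < n + 3) (hj' : j < n + 2),
        (Fin.snoc (α := fun _ => ℤ) γ y : Fin (n + 3) → ℤ) ⟨j, hj⟩ = γ ⟨j, hj'⟩ :=
      fun y j hj hj' => Fin.snoc_castSucc (α := fun _ => ℤ) y γ ⟨j, hj'⟩
    simp only [Fin.snoc_last]
    split_ifs with h
    · rw [nbOp_apply hW _ _ (last_step_mem n hγ), mul_right_comm, one_div_mul_cancel
        (by linarith), one_mul]
      refine Finset.sum_congr rfl fun t _ => ?_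
      rw [if_pos (by rw [hv _ 1 _ (by omega), h]), hv _ (n + 1) _ (by omega)]
      congr 1
      · ring
      · exact add_sub_cancel_left _ _
    · rw [zero_mul]
      refine Finset.sum_eq_zero fun t _ => if_neg ?_
      rwa [hv _ 1 _ (by omega)]

lemma card_filter_nbWalks (hW : 0 < W) (n : ℕ) {s : ℤ} (hs : s ∈ bandSteps W) (t y : ℤ) :
    (((nbWalks W x n).filter fun γ => γ ⟨1, by omega⟩ = x + s ∧ γ ⟨n, by omega⟩ = y - t ∧
      γ (Fin.last _) = y).card : ℝ) = (nbWalks W x n).card * nbProb W n s t (y - x) := by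
  have hW1 : (1 : ℝ) ≤ W := by exact_mod_cast hW
  have h := sum_nbWalks_eq_nbOp_pow (x := x) hW n hs (deltaFun (y - x) t)
  rw [card_nbWalks hW, nbProb, nbKer, mul_mul_mul_comm, mul_one_div_cancel (by positivity),
    one_mul, ← h, Finset.card_filter]
  push_cast
  refine Finset.sum_congr rfl fun γ _ => ?_
  rw [deltaFun, ← ite_and]
  congr 1
  rw [eq_iff_iff]
  constructor
  · rintro ⟨h1, h2, h3⟩
    exact ⟨h1, by rw [h3], by rw [h3, h2]; ring⟩
  · rintro ⟨h1, h2, h3⟩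
    exact ⟨h1, by omega, by omega⟩

end walks

end

/-! ### From conditional probabilities to a sum of products over the edges. -/

noncomputable section

open scoped ENNReal

/-- Conditional probabilities given the preceding events multiply up to the probability of the
intersection. -/
lemma prod_ncard_div_ncard {Ω ι : Type*} [Fintype ι] [LinearOrder ι] {S : Set Ω} (hS : S.Finite)
    (hne : S.Nonempty) (P : ι → Ω → Prop) :
    ∏ e, (({ω | ω ∈ S ∧ ∀ f ≤ e, P f ω}.ncard : ℝ) / {ω | ω ∈ S ∧ ∀ f < e, P f ω}.ncard) =
      {ω | ω ∈ S ∧ ∀ f, P f ω}.ncard / S.ncard := by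
  -- The statement for arbitrary subsets allows induction by adding a largest element, which leaves
  -- the earlier quotients unchanged.
  have key : ∀ s : Finset ι, ∏ e ∈ s, (({ω | ω ∈ S ∧ ∀ f ∈ s, f ≤ e → P f ω}.ncard : ℝ) /
      {ω | ω ∈ S ∧ ∀ f ∈ s, f < e → P f ω}.ncard) =
      {ω | ω ∈ S ∧ ∀ f ∈ s, P f ω}.ncard / S.ncard := by
    intro s
    induction s using Finset.induction_on_max with
    | empty =>
      have : (S.ncard : ℝ) ≠ 0 := by exact_mod_cast (Set.ncard_pos hS).2 hne |>.ne'
      simp [this]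
    | insert a s hmax ih =>
      have ha : a ∉ s := fun h => lt_irrefl _ (hmax a h)
      have e1 : {ω | ω ∈ S ∧ ∀ f ∈ insert a s, f ≤ a → P f ω} =
          {ω | ω ∈ S ∧ ∀ f ∈ insert a s, P f ω} := by
        ext ω
        simp only [Set.mem_ofPred_eq, Finset.mem_insert]
        refine and_congr_right fun _ => forall₂_congr fun f hf => ⟨fun h => h ?_, fun h _ => h⟩
        rcases hf with rfl | hf
        exacts [le_rfl, (hmax f hf).le]
      have e2 : {ω | ω ∈ S ∧ ∀ f ∈ insert a s, f < a → P f ω} =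
          {ω | ω ∈ S ∧ ∀ f ∈ s, P f ω} := by
        ext ω
        simp only [Set.mem_ofPred_eq, Finset.mem_insert]
        refine and_congr_right fun _ => ⟨fun h f hf => h f (Or.inr hf) (hmax f hf), ?_⟩
        rintro h f (rfl | hf) hlt
        exacts [absurd hlt (lt_irrefl _), h f hf]
      rw [Finset.prod_insert ha, e1, e2]
      have e3 : ∀ e ∈ s,
          (({ω | ω ∈ S ∧ ∀ f ∈ insert a s, f ≤ e → P f ω}.ncard : ℝ) /
            {ω | ω ∈ S ∧ ∀ f ∈ insert a s, f < e → P f ω}.ncard) =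
          (({ω | ω ∈ S ∧ ∀ f ∈ s, f ≤ e → P f ω}.ncard : ℝ) /
            {ω | ω ∈ S ∧ ∀ f ∈ s, f < e → P f ω}.ncard) := by
        intro e he
        simp only [Finset.forall_mem_insert, (hmax e he).not_ge, (hmax e he).not_gt,
          false_imp_iff, true_and]
      rw [Finset.prod_congr rfl e3, ih]
      -- If the preceding events are incompatible, both sides vanish, in agreement with the value 0
      -- of a division by 0; otherwise the product telescopes.
      by_cases h0 : ({ω | ω ∈ S ∧ ∀ f ∈ s, P f ω}.ncard : ℝ) = 0
      · have : {ω | ω ∈ S ∧ ∀ f ∈ insert a s, P f ω}.ncard = 0 := by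
          refine Nat.eq_zero_of_le_zero ((Set.ncard_le_ncard ?_
            (hS.subset (Set.sep_subset _ _))).trans (by exact_mod_cast h0.le))
          exact fun ω h => ⟨h.1, fun f hf => h.2 f (Finset.mem_insert_of_mem hf)⟩
        rw [this]
        simp
      · field_simp
  simpa using key Finset.univ

namespace MarkedMultigraph

variable {V E : Type*} (G : MarkedMultigraph V E) (T : Set ((E × Bool) × (E × Bool)))

/-- The conditions of `T` when the walk of every edge `e` makes the first step `(p e).1` and the
last step `(p e).2`. -/
def TurnsOk (R : V → ℤ) (p : E → ℤ × ℤ) : Prop :=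
  ∀ h h' : E × Bool, (h, h') ∈ T → h ≠ h' → G.base h = G.base h' →
    (if h.2 then R (G.tgt h.1) - (p h.1).2 else R (G.src h.1) + (p h.1).1) ≠
    (if h'.2 then R (G.tgt h'.1) - (p h'.1).2 else R (G.src h'.1) + (p h'.1).1)

/-- The vectors of first and last steps. -/
def stepPairs (W : ℕ) (E : Type*) [Fintype E] [DecidableEq E] : Finset (E → ℤ × ℤ) :=
  Fintype.piFinset fun _ => bandSteps W ×ˢ bandSteps W

-- Success of all edges depends on the walks only through their endpoints and their first and last
-- steps. Sorting by these steps turns the count into a product over the edges, restricted by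
-- `TurnsOk`.
open Classical in
lemma prod_tildeProb [Fintype E] [LinearOrder E] {W : ℕ} (hW : 0 < W) (R : V → ℤ) (n : E → ℕ) :
    ∏ e, G.tildeProb T W R (fun e => (n e).succPNat) e =
      ∑ p ∈ stepPairs W E, if G.TurnsOk T R p then
        ∏ e, nbProb W (n e) (p e).1 (p e).2 (R (G.tgt e) - R (G.src e)) else 0 := by
  have hW1 : (1 : ℝ) ≤ W := by exact_mod_cast hW
  set F : Finset ((e : E) → Fin (n e + 2) → ℤ) :=
    Fintype.piFinset fun e => nbWalks W (R (G.src e)) (n e) with hF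
  let Ω : Set ((e : E) → Fin (n e + 2) → ℤ) := G.walkTuples W R fun e => (n e).succPNat
  let S : E → ((e : E) → Fin (n e + 2) → ℤ) → Prop := fun e Γ =>
    G.Succeeds T R (fun e => (n e).succPNat) Γ e
  have hset : Ω = ↑F := by
    ext Γ
    rw [hF, Finset.mem_coe, Fintype.mem_piFinset]
    exact forall_congr' fun e => (mem_nbWalks (n e) (Γ e)).symm
  have hcard0 : ∀ e, 0 < ((nbWalks W (R (G.src e)) (n e)).card : ℝ) := by
    intro e
    rw [card_nbWalks hW]
    have : (0 : ℝ) < 2 * W - 1 := by linarith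
    positivity
  have hFcard : (F.card : ℝ) = ∏ e, ((nbWalks W (R (G.src e)) (n e)).card : ℝ) := by
    rw [hF, Fintype.card_piFinset]
    push_cast
    rfl
  have hF0 : 0 < (F.card : ℝ) := hFcard ▸ Finset.prod_pos fun e _ => hcard0 e
  have hFne : F.Nonempty := Finset.card_pos.1 (by exact_mod_cast hF0)
  have hall : ∀ Γ : (e : E) → Fin (n e + 2) → ℤ,
      (∀ e, S e Γ) ↔ (∀ e, Γ e (Fin.last _) = R (G.tgt e)) ∧
      G.TurnsOk T R fun e => (Γ e ⟨1, by omega⟩ - R (G.src e), R (G.tgt e) - Γ e ⟨n e, by omega⟩) := by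
    intro Γ
    have hnp : ∀ h : E × Bool, nextPoint (fun e => (n e).succPNat) Γ h =
        if h.2 then R (G.tgt h.1) - (R (G.tgt h.1) - Γ h.1 ⟨n h.1, by omega⟩) else
          R (G.src h.1) + (Γ h.1 ⟨1, by omega⟩ - R (G.src h.1)) := by
      intro h
      rw [sub_sub_cancel, add_sub_cancel]
      rfl
    constructor
    · intro hs
      refine ⟨fun e => (hs e).1, fun h h' hT hne hb => ?_⟩
      rw [← hnp, ← hnp]
      -- A turn is tested when the later of its two edges is treated.
      rcases le_total h.1 h'.1 with hle | hle
      · exact (hs h'.1).2 h h' hT hne hb hle le_rfl (Or.inr rfl)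
      · exact (hs h.1).2 h h' hT hne hb le_rfl hle (Or.inl rfl)
    · rintro ⟨h1, h2⟩ e
      refine ⟨h1 e, fun h h' hT hne hb _ _ _ => ?_⟩
      rw [hnp, hnp]
      exact h2 h h' hT hne hb
  change ∏ e, (({Γ | Γ ∈ Ω ∧ ∀ f ≤ e, S f Γ}.ncard : ℝ) /
    {Γ | Γ ∈ Ω ∧ ∀ f < e, S f Γ}.ncard) = _
  rw [prod_ncard_div_ncard (hset ▸ F.finite_toSet) (hset ▸ hFne)]
  have hsucc : {Γ | Γ ∈ Ω ∧ ∀ e, S e Γ} = ↑(F.filter fun Γ =>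
        (∀ e, Γ e (Fin.last _) = R (G.tgt e)) ∧ G.TurnsOk T R fun e =>
          (Γ e ⟨1, by omega⟩ - R (G.src e), R (G.tgt e) - Γ e ⟨n e, by omega⟩)) := by
    ext Γ
    rw [Finset.coe_filter, Set.mem_ofPred_eq, Set.mem_ofPred_eq, hset, Finset.mem_coe, hall]
  rw [hsucc, hset, Set.ncard_coe_finset, Set.ncard_coe_finset, div_eq_iff hF0.ne',
    Finset.card_eq_sum_card_fiberwise (t := stepPairs W E) (f := fun Γ e =>
      (Γ e ⟨1, by omega⟩ - R (G.src e), R (G.tgt e) - Γ e ⟨n e, by omega⟩))]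
  · push_cast
    rw [Finset.sum_mul]
    refine Finset.sum_congr rfl fun p hp => ?_
    rw [stepPairs, Fintype.mem_piFinset] at hp
    split_ifs with hok
    · rw [hFcard, ← Finset.prod_mul_distrib]
      have : ∀ e ∈ Finset.univ, nbProb W (n e) (p e).1 (p e).2 (R (G.tgt e) - R (G.src e)) *
          ((nbWalks W (R (G.src e)) (n e)).card : ℝ) =
          (((nbWalks W (R (G.src e)) (n e)).filter fun γ => γ ⟨1, by omega⟩ = R (G.src e) + (p e).1
            ∧ γ ⟨n e, by omega⟩ = R (G.tgt e) - (p e).2 ∧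
            γ (Fin.last _) = R (G.tgt e)).card : ℝ) := fun e _ => by
        rw [mul_comm, card_filter_nbWalks hW (n e) (Finset.mem_product.1 (hp e)).1]
      rw [Finset.prod_congr rfl this, ← Nat.cast_prod, ← Fintype.card_piFinset]
      congr 2
      ext Γ
      simp only [Finset.mem_filter, Fintype.mem_piFinset, hF, funext_iff, Prod.ext_iff]
      constructor
      · rintro ⟨⟨h1, h2, -⟩, h3⟩ e
        have := h3 e
        exact ⟨h1 e, by omega, by omega, h2 e⟩
      · intro h
        have h3 : ∀ e, Γ e ⟨1, by omega⟩ - R (G.src e) = (p e).1 ∧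
            R (G.tgt e) - Γ e ⟨n e, by omega⟩ = (p e).2 := fun e => by
          have := h e
          exact ⟨by omega, by omega⟩
        refine ⟨⟨fun e => (h e).1, fun e => (h e).2.2.2, ?_⟩, h3⟩
        have e1 : (fun e => (Γ e ⟨1, by omega⟩ - R (G.src e),
            R (G.tgt e) - Γ e ⟨n e, by omega⟩)) = p := funext fun e => Prod.ext (h3 e).1 (h3 e).2
        rw [e1]
        exact hok
    · rw [zero_mul, Nat.cast_eq_zero, Finset.card_eq_zero, Finset.filter_eq_empty_iff]
      rintro Γ hΓ rfl
      exact hok (Finset.mem_filter.1 hΓ).2.2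
  · intro Γ hΓ
    obtain ⟨h1, h2, -⟩ := Finset.mem_filter.1 hΓ
    rw [hF, Fintype.mem_piFinset] at h1
    rw [stepPairs, Finset.mem_coe, Fintype.mem_piFinset]
    refine fun e => Finset.mem_product.2 ⟨first_step_mem _ (h1 e), ?_⟩
    have := last_step_mem _ (h1 e)
    rwa [h2 e] at this

end MarkedMultigraph

end

/-! ### Absolute convergence and the bound by a sum of products of edge weights. -/

noncomputable section

open scoped ENNReal

lemma summable_of_tsum_enorm_ne_top {ι : Type*} {F : ι → ℂ} (h : ∑' i, ‖F i‖ₑ ≠ ∞) : Summable F :=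
  Summable.of_nnnorm (ENNReal.tsum_coe_ne_top_iff_summable.1 h)

lemma tsum_enorm_ne_top {ι : Type*} {F : ι → ℂ} (h : Summable fun i => ‖F i‖) :
    ∑' i, ‖F i‖ₑ ≠ ∞ :=
  ENNReal.tsum_coe_ne_top_iff_summable.2 (NNReal.summable_coe.1 h)

lemma enorm_finset_prod {ι : Type*} (s : Finset ι) (F : ι → ℂ) :
    ‖∏ i ∈ s, F i‖ₑ = ∏ i ∈ s, ‖F i‖ₑ := by
  classical
  induction s using Finset.induction_on with
  | empty => simp
  | insert a s ha ih => rw [Finset.prod_insert ha, Finset.prod_insert ha, enorm_mul, ih]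

lemma abs_nbProb_le_one {W : ℕ} (hW : 0 < W) (n : ℕ) {s : ℤ} (hs : s ∈ bandSteps W) (t d : ℤ) :
    |nbProb W n s t d| ≤ 1 := by
  have hW1 : (1 : ℝ) ≤ W := by exact_mod_cast hW
  have h := (opLe_nbOp_pow hW n).sum_abs_apply_deltaFun_le hs {(d, t)}
  rw [Finset.sum_singleton] at h
  rw [nbProb, abs_mul, abs_of_nonneg (by positivity)]
  refine mul_le_one₀ ?_ (abs_nonneg _) h
  rw [div_le_one (by positivity)]
  linarith

/-- The lengths `n e ≥ 1` in terms of the numbers `n e - 1`. -/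
def lengthEquiv (E : Type*) : (E → ℕ) ≃ (E → ℕ+) :=
  Equiv.piCongrRight fun _ => Equiv.pnatEquivNat.symm

namespace MarkedMultigraph

variable {V E : Type*} (G : MarkedMultigraph V E) (T : Set ((E × Bool) × (E × Bool)))

/-- The displacement along the edge `e`. -/
def disp (R : V → ℤ) (e : E) : ℤ := R (G.tgt e) - R (G.src e)

lemma prod_sum_stepPairs [Fintype E] [DecidableEq E] (W : ℕ) (h : E → ℤ → ℤ → ℝ≥0∞) :
    ∑ p ∈ stepPairs W E, ∏ e, h e (p e).1 (p e).2 =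
      ∏ e, ∑ s ∈ bandSteps W, ∑ t ∈ bandSteps W, h e s t := by
  refine (Finset.prod_univ_sum (fun _ : E => bandSteps W ×ˢ bandSteps W)
    fun e s => h e s.1 s.2).symm.trans ?_
  exact Finset.prod_congr rfl fun e _ => Finset.sum_product _ _ _

variable [Fintype E] [LinearOrder E] {W : ℕ}

-- With lengths written as n_e + 1, the argument of φ_q is shifted by |E| and a factor g^{|E|} of
-- modulus 1 comes out. The remaining sum has the form treated by `enorm_tsum_multi_le`.
open Classical in
lemma embTerm_lengthEquiv (hW : 0 < W) (q : ℕ) (g : ℂ) (ε : ℝ) (R : V → ℤ) (n : E → ℕ) :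
    G.embTerm T q W g ε R (lengthEquiv E n) = g ^ Fintype.card E *
      ∑ p ∈ stepPairs W E, if G.TurnsOk T R p then
        (phiReg q ((Fintype.card E + ∑ e, n e : ℕ) * ε) : ℂ) *
          ∏ e, (g ^ n e * (nbProb W (n e) (p e).1 (p e).2 (G.disp R e) : ℂ)) else 0 := by
  have h := G.prod_tildeProb T hW R n
  have e1 : ∑ e, (((lengthEquiv E n e : ℕ+) : ℕ) : ℝ) * ε =
      ((Fintype.card E + ∑ e, n e : ℕ) : ℝ) * ε := by
    rw [← Finset.sum_mul]
    congr 1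
    push_cast
    have : ∀ e, (((lengthEquiv E n e : ℕ+) : ℕ) : ℝ) = 1 + n e := fun e => by
      change (((n e).succPNat : ℕ) : ℝ) = _
      rw [Nat.succPNat_coe, Nat.succ_eq_add_one]
      push_cast
      ring
    simp [this, Finset.sum_add_distrib]
  have e2 : ∏ e, g ^ ((lengthEquiv E n e : ℕ+) : ℕ) = g ^ Fintype.card E * ∏ e, g ^ n e := by
    have : ∀ e, g ^ ((lengthEquiv E n e : ℕ+) : ℕ) = g * g ^ n e := fun e => pow_succ' g (n e)
    simp [this, Finset.prod_mul_distrib]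
  have e3 : ∏ e, (G.tildeProb T W R (lengthEquiv E n) e : ℂ) = ∑ p ∈ stepPairs W E,
      if G.TurnsOk T R p then ∏ e, (nbProb W (n e) (p e).1 (p e).2 (G.disp R e) : ℂ) else 0 := by
    refine Eq.trans ?_ ((congrArg (fun r : ℝ => (r : ℂ)) h).trans ?_)
    · push_cast
      rfl
    · push_cast
      refine Finset.sum_congr rfl fun p _ => ?_
      split_ifs
      · push_cast; rfl
      · rfl
  rw [embTerm, e1, Finset.prod_mul_distrib, e2, e3, mul_left_comm, mul_assoc]
  congr 1
  rw [mul_left_comm, Finset.mul_sum, Finset.mul_sum]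
  refine Finset.sum_congr rfl fun p _ => ?_
  rw [mul_ite, mul_ite, mul_zero, mul_zero, Finset.prod_mul_distrib]

lemma enorm_embTerm_le (hW : 0 < W) (q : ℕ) {g : ℂ} (hg : ‖g‖ = 1) (ε : ℝ) (R : V → ℤ)
    (n : E → ℕ) : ‖G.embTerm T q W g ε R (lengthEquiv E n)‖ₑ ≤
      ‖(phiReg q ((Fintype.card E + ∑ e, n e : ℕ) * ε) : ℂ)‖ₑ *
        ∏ e, kerTotal W (nbOp W ^ n e) (R (G.tgt e) - R (G.src e)) := by
  classical
  rw [G.embTerm_lengthEquiv T hW, enorm_mul, enorm_pow_eq_one hg, one_mul]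
  simp only [kerTotal]
  rw [← prod_sum_stepPairs, Finset.mul_sum]
  refine (enorm_sum_le _ _).trans (Finset.sum_le_sum fun p _ => ?_)
  split_ifs
  · rw [enorm_mul, enorm_finset_prod]
    refine le_of_eq (congrArg _ (Finset.prod_congr rfl fun e _ => ?_))
    rw [enorm_mul, enorm_pow_eq_one hg, one_mul, enorm_complex_ofReal]
    rfl
  · simp

/-- For fixed lengths the kernels have total mass at most 1, so the sum over positions costs
nothing; the decay of φ_q makes the sum over lengths finite. -/
lemma summable_embTerm [Fintype V] (hG : G.IsConnected) (hW : 0 < W) (q : ℕ) {g : ℂ}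
    (hg : ‖g‖ = 1) {ε x : ℝ} (hx : 0 ≤ x) (hx1 : x < 1)
    (hf : ExpDecay x fun m => (phiReg q (m * ε) : ℂ)) :
    Summable fun p : {R : V → ℤ // R G.root = 0} × (E → ℕ+) =>
      G.embTerm T q W g ε p.1.1 p.2 := by
  have hs : ∑' n : E → ℕ, ‖(phiReg q ((Fintype.card E + ∑ e, n e : ℕ) * ε) : ℂ)‖ₑ ≠ ∞ := by
    refine tsum_enorm_ne_top ((summable_norm_multi_fintype hx hx1 (fun (_ : E) _ => 1)
      (fun _ => ⟨1, zero_le_one, fun _ => by simp⟩) hf (Fintype.card E)).congr fun n => ?_)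
    rw [Finset.prod_const_one, mul_one]
  refine summable_of_tsum_enorm_ne_top (ne_top_of_le_ne_top hs ?_)
  calc ∑' p : {R : V → ℤ // R G.root = 0} × (E → ℕ+), ‖G.embTerm T q W g ε p.1.1 p.2‖ₑ
      = ∑' (n : E → ℕ+) (R : {R : V → ℤ // R G.root = 0}), ‖G.embTerm T q W g ε R.1 n‖ₑ := by
        rw [ENNReal.tsum_prod', ENNReal.tsum_comm]
    _ = ∑' (n : E → ℕ) (R : {R : V → ℤ // R G.root = 0}),
          ‖G.embTerm T q W g ε R.1 (lengthEquiv E n)‖ₑ := ((lengthEquiv E).tsum_eq _).symm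
    _ ≤ _ := ENNReal.tsum_le_tsum fun n => ?_
  have h0 : ∀ R : {R : V → ℤ // R G.root = 0}, ‖G.embTerm T q W g ε R.1 (lengthEquiv E n)‖ₑ ≤
      ‖(phiReg q ((Fintype.card E + ∑ e, n e : ℕ) * ε) : ℂ)‖ₑ *
        ∏ e, kerTotal W (nbOp W ^ n e) (R.1 (G.tgt e) - R.1 (G.src e)) := fun R =>
    G.enorm_embTerm_le T hW q hg ε R.1 n
  refine (ENNReal.tsum_le_tsum h0).trans ?_
  rw [ENNReal.tsum_mul_left]
  have h1 : ∀ e, ∑' d, kerTotal W (nbOp W ^ n e) d ≤ 1 := fun e => by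
    simpa using (opLe_nbOp_pow hW (n e)).tsum_kerTotal_le hW
  have h2 := (hG.tsum_positions_le (fun e => kerTotal W (nbOp W ^ n e)) h1
    fun e d => (ENNReal.le_tsum d).trans (h1 e)).2
  rw [one_pow, one_pow, mul_one] at h2
  exact mul_le_of_le_one_right' h2

/-- The triangle inequality is applied over positions and over first and last steps, but never over
lengths, where the oscillation of gⁿ is needed. The restriction by `TurnsOk` only removes
nonnegative terms. -/
lemma enorm_emb_le (hW : 0 < W) (q : ℕ) {g : ℂ} (hg : ‖g‖ = 1) {ε x : ℝ} (hx : 0 ≤ x)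
    (hx1 : x < 1) (hf : ExpDecay x fun m => (phiReg q (m * ε) : ℂ)) {M c : ℝ≥0∞}
    (hM : ResolventBound g c M fun m => (phiReg q (m * ε) : ℂ)) (N : ℕ) :
    ‖G.emb T q W g ε‖ₑ ≤ M * ∑' R : {R : V → ℤ // R G.root = 0},
      ∏ e, edgeWeight W N c (R.1 (G.tgt e) - R.1 (G.src e)) := by
  classical
  refine enorm_tsum_le_tsum_enorm.trans ?_
  rw [← ENNReal.tsum_mul_left]
  refine ENNReal.tsum_le_tsum fun R => ?_
  have hk : ∀ p ∈ stepPairs W E, ∀ e n,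
      |nbProb W n (p e).1 (p e).2 (G.disp R.1 e)| ≤ 1 := fun p hp e n =>
    abs_nbProb_le_one hW n (Finset.mem_product.1 (Fintype.mem_piFinset.1 hp e)).1 _ _
  rw [← (lengthEquiv E).tsum_eq, tsum_congr (G.embTerm_lengthEquiv T hW q g ε R.1), tsum_mul_left,
    enorm_mul, enorm_pow_eq_one hg, one_mul, Summable.tsum_finsetSum]
  · simp only [edgeWeight]
    rw [← prod_sum_stepPairs, Finset.mul_sum]
    refine (enorm_sum_le _ _).trans (Finset.sum_le_sum fun p hp => ?_)
    split_ifs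
    · exact enorm_tsum_multi_le hx hx1 hg
        (fun e n => nbProb W n (p e).1 (p e).2 (G.disp R.1 e)) (hk p hp) hf hM N _
    · simp
  · intro p hp
    split_ifs
    · exact (summable_norm_multi_fintype hx hx1
        (fun e n => g ^ n * (nbProb W n (p e).1 (p e).2 (G.disp R.1 e) : ℂ))
        (fun e => bddSeq_pow_mul hg (hk p hp e)) hf _).of_norm
    · exact summable_zero

end MarkedMultigraph

/-- The cut-off N ≈ 1/δ balances the contributions: the initial block costs N, the boundary term
C/δ, and the tail (C/δ)² K/N. -/
lemma edgeWeight_total_le {K C δ : ℝ} (hK : 1 ≤ K) (hC : 1 ≤ C) (hδ : 0 < δ) (hδ2 : δ ≤ 2) :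
    ((⌈1 / δ⌉₊ + 2 : ℕ) : ℝ≥0∞) + ENNReal.ofReal (C / δ) + ENNReal.ofReal (C / δ) ^ 2 *
      ENNReal.ofReal (K / ((⌈1 / δ⌉₊ + 2 : ℕ) - 1)) ≤
    ENNReal.ofReal ((7 + C + C ^ 2 * K) / δ) := by
  have h0 : 0 < 1 / δ := by positivity
  have h1 : (⌈1 / δ⌉₊ : ℝ) < 1 / δ + 1 := Nat.ceil_lt_add_one h0.le
  have h2 : 1 / δ ≤ (⌈1 / δ⌉₊ : ℝ) := Nat.le_ceil _
  have h3 : 1 ≤ 2 * (1 / δ) := by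
    rw [mul_one_div, le_div_iff₀ hδ]
    linarith
  have h4 : 0 < ((⌈1 / δ⌉₊ + 2 : ℕ) : ℝ) - 1 := by push_cast; linarith
  rw [← ENNReal.ofReal_natCast, ← ENNReal.ofReal_pow (by positivity),
    ← ENNReal.ofReal_mul (by positivity), ← ENNReal.ofReal_add (by positivity) (by positivity),
    ← ENNReal.ofReal_add (by positivity) (by positivity)]
  refine ENNReal.ofReal_le_ofReal ?_
  have h5 : K / (((⌈1 / δ⌉₊ + 2 : ℕ) : ℝ) - 1) ≤ K / (1 / δ) := by
    gcongr
    push_cast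
    linarith
  have h6 : (C / δ) ^ 2 * (K / (((⌈1 / δ⌉₊ + 2 : ℕ) : ℝ) - 1)) ≤ C ^ 2 * K / δ := by
    refine (mul_le_mul_of_nonneg_left h5 (by positivity)).trans (le_of_eq ?_)
    field_simp
  have h7 : ((⌈1 / δ⌉₊ + 2 : ℕ) : ℝ) ≤ 7 / δ := by
    push_cast
    have : 7 / δ = 7 * (1 / δ) := by ring
    linarith
  rw [add_div, add_div]
  linarith

/-- The prefactor C is absorbed into one additional power of 1/δ, possible as δ ≤ 2; hence the
exponent |E| + 1. The condition L ≥ 1/2 covers both L = log W and L = 1. -/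
lemma mul_pow_mul_pow_le {C D δ L : ℝ} (hC : 1 ≤ C) (hD : 0 ≤ D) (hδ : 0 < δ) (hδ2 : δ ≤ 2)
    (hL : 1 / 2 ≤ L) {W v m : ℕ} (hW : 2 ≤ W) (hv : 1 ≤ v) (hvm : v ≤ m + 1) :
    C * ((D / δ) ^ (v - 1) * (1 / (2 * W - 1) * (D / δ)) ^ (m + 1 - v)) ≤
      (2 * (C + D) / δ) ^ (m + 1) * (L / W) ^ (m + 1 - v) := by
  have hW2 : (2 : ℝ) ≤ W := by exact_mod_cast hW
  have hE : v - 1 + (m + 1 - v) = m := by omega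
  have h1 : (1 / (2 * W - 1) : ℝ) ^ (m + 1 - v) ≤ 2 ^ m * (L / W) ^ (m + 1 - v) := by
    have : (1 / (2 * W - 1) : ℝ) ≤ 2 * (L / W) := by
      rw [← mul_div_assoc]
      exact div_le_div₀ (by linarith) (by linarith) (by linarith) (by linarith)
    have h0 : (0 : ℝ) ≤ 1 / (2 * W - 1) := one_div_nonneg.2 (by linarith)
    refine (pow_le_pow_left₀ h0 this _).trans ?_
    rw [mul_pow]
    gcongr
    · norm_num
    · omega
  have h2 : C ≤ 2 * (C + D) / δ := by
    rw [le_div_iff₀ hδ]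
    nlinarith
  calc C * ((D / δ) ^ (v - 1) * (1 / (2 * W - 1) * (D / δ)) ^ (m + 1 - v))
      = C * (D / δ) ^ m * (1 / (2 * W - 1)) ^ (m + 1 - v) := by
        rw [mul_pow, mul_left_comm ((D / δ) ^ (v - 1)), ← pow_add, hE]
        ring
    _ ≤ C * (D / δ) ^ m * (2 ^ m * (L / W) ^ (m + 1 - v)) := by gcongr
    _ = C * (2 * D / δ) ^ m * (L / W) ^ (m + 1 - v) := by
        rw [mul_div_assoc, mul_pow]
        ring
    _ ≤ (2 * (C + D) / δ) * (2 * (C + D) / δ) ^ m * (L / W) ^ (m + 1 - v) := by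
        gcongr
        linarith
    _ = _ := by rw [← pow_succ']

end

theorem mainTheorem2 (q : ℕ) (hq : 1 ≤ q) :
    ∃ C : ℝ, 0 < C ∧
      ∀ (V E : Type*) [Fintype V] [Fintype E] [LinearOrder E]
        (G : MarkedMultigraph V E) (_ : G.IsConnected)
        (T : Set ((E × Bool) × (E × Bool)))
        (W : ℕ) (_ : 2 ≤ W) (g : ℂ) (_ : ‖g‖ = 1) (_ : g ≠ 1) (ε : ℝ) (_ : 0 < ε),
        -- the double series converges absolutely
        Summable (fun p : {R : V → ℤ // R G.root = 0} × (E → ℕ+) =>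
          G.embTerm T q W g ε p.1.1 p.2) ∧
        -- the general bound; `card V ≤ card E + 1` by connectedness
        ‖G.emb T q W g ε‖ ≤ (C / ‖1 - g‖) ^ (Fintype.card E + 1) *
          (Real.log W / W) ^ (Fintype.card E + 1 - Fintype.card V) ∧
        -- no logarithm for the graph with one vertex and one edge (a loop)
        (Fintype.card V = 1 → Fintype.card E = 1 →
          ‖G.emb T q W g ε‖ ≤ (C / ‖1 - g‖) ^ (Fintype.card E + 1) *
            (1 / (W : ℝ)) ^ (Fintype.card E + 1 - Fintype.card V)) := by
  obtain ⟨C, hC, hres⟩ := exists_shiftResolvent_phiReg_bound q hq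
  obtain ⟨K, hK, hedge⟩ := exists_edgeWeight_bound
  set D := 7 + C + C ^ 2 * K with hD
  have hD0 : 0 ≤ D := by positivity
  refine ⟨2 * (C + D), by positivity, ?_⟩
  intro V E _ _ _ G hG T W hW g hg hg1 ε hε
  obtain ⟨⟨x, hx, hx1, hf⟩, hM⟩ := hres g hg hg1 ε hε
  have hδ : 0 < ‖1 - g‖ := norm_pos_iff.2 (sub_ne_zero.2 hg1.symm)
  have hδ2 := norm_one_sub_le_two hg
  have hW2 : (2 : ℝ) ≤ W := by exact_mod_cast hW
  have hW0 : 0 < W := by omega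
  have hM' : ResolventBound g (ENNReal.ofReal (C / ‖1 - g‖)) (ENNReal.ofReal C)
      fun m => (phiReg q (m * ε) : ℂ) := by
    intro j m
    rw [← ENNReal.ofReal_pow (by positivity), ← ENNReal.ofReal_mul (by positivity), ← ofReal_norm]
    exact ENNReal.ofReal_le_ofReal (hM j m)
  have htot := edgeWeight_total_le hK hC hδ hδ2
  obtain ⟨hA, hb⟩ := hedge W hW (⌈1 / ‖1 - g‖⌉₊ + 2) (by omega) (ENNReal.ofReal (C / ‖1 - g‖))
  obtain ⟨hVE, hpos⟩ := hG.tsum_positions_le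
    (fun _ => edgeWeight W (⌈1 / ‖1 - g‖⌉₊ + 2) (ENNReal.ofReal (C / ‖1 - g‖)))
    (fun _ => hA.trans htot) (fun _ d => (hb d).trans (mul_le_mul_right htot _))
  have hβ : 0 ≤ 1 / (2 * W - 1 : ℝ) := one_div_nonneg.2 (by linarith)
  -- This bound holds for every connected graph and has no logarithm; both claims are weakenings of
  -- it.
  have hemb : ‖G.emb T q W g ε‖ ≤ C * ((D / ‖1 - g‖) ^ (Fintype.card V - 1) *
      (1 / (2 * W - 1) * (D / ‖1 - g‖)) ^ (Fintype.card E + 1 - Fintype.card V)) := by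
    have h := (G.enorm_emb_le T hW0 q hg hx hx1 hf hM' (⌈1 / ‖1 - g‖⌉₊ + 2)).trans
      (mul_le_mul_right hpos _)
    rw [← ENNReal.ofReal_mul hβ, ← ENNReal.ofReal_pow (by positivity),
      ← ENNReal.ofReal_pow (by positivity), ← ENNReal.ofReal_mul (by positivity),
      ← ENNReal.ofReal_mul (by positivity), ← ofReal_norm] at h
    exact (ENNReal.ofReal_le_ofReal_iff (by positivity)).1 h
  have hV : 1 ≤ Fintype.card V := Fintype.card_pos_iff.2 ⟨G.root⟩
  refine ⟨G.summable_embTerm T hG hW0 q hg hx hx1 hf, ?_, fun _ _ => ?_⟩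
  · refine hemb.trans (mul_pow_mul_pow_le hC hD0 hδ hδ2 ?_ hW hV hVE)
    have := Real.log_le_log two_pos hW2
    linarith [Real.log_two_gt_d9]
  · exact hemb.trans (mul_pow_mul_pow_le hC hD0 hδ hδ2 (by norm_num) hW hV hVE)
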